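/- For each $n\ge 1$ consider a linear model $y=X\beta^*+\varepsilon\in\mathbb R^n$, where $p=p_n$, the vector $\beta^*=\beta^*_n\in\mathbb R^p$, the matrix $\Sigma=\Sigma_n\in\mathbb R^{p\times p}$, the penalty $g=g_n:\mathbb R^p\to\mathbb R$ and the noise level $\sigma=\sigma_n>0$ may depend on $n$. Let $\gamma,\mu>0$ be constants independent of $n$ and assume: $p/n\le\gamma$; $\Sigma$ is symmetric positive definite; $X$ has i.i.d. rows $x_1,\dots,x_n\sim N(0,\Sigma)$; $\varepsilon\sim N(0,\sigma^2 I_n)$ is independent of $X$; and $b\mapsto g(b)-\frac{\mu}{2}b^\top\Sigma b$ is convex on $\mathbb R^p$. For $(y,X)\in\mathbb R^n\times\mathbb R^{n\times p}$ let $$\hat\beta(y,X)=\arg\min_{b\in\mathbb R^p}\ \frac1n\sum_{i=1}^n\frac{(y_i-x_i^\top b)^2}{2}+g(b),\qquad r_i=y_i-x_i^\top\hat\beta(y,X).$$ Then: (i) for every $n$ and for Lebesgue-almost every $(y,X)$, the map $(y,X)\mapsto\hat\beta(y,X)$ is differentiable at $(y,X)$ and there is a matrix $\hat A\in\mathbb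 R^{p\times p}$ with $\|\Sigma^{1/2}\hat A\Sigma^{1/2}\|_{op}\le (n\mu)^{-1}$ such that, for all $i\in\{1,\dots,n\}$ and $j\in\{1,\dots,p\}$, $$\frac{\partial\hat\beta}{\partial y_i}(y,X)=\hat A X^\top e_i,\qquad \frac{\partial\hat\beta}{\partial x_{ij}}(y,X)=\hat A e_j\,r_i-\hat A X^\top e_i\,\hat\beta_j; \tag{$*$}$$ (ii) whenever, for every $n$, $\hat A=\hat A(y,X)$ is a matrix-valued function of $(y,X)$ with $\|\Sigma^{1/2}\hat A\Sigma^{1/2}\|_{op}\le (n\mu)^{-1}$ and $(*)$ for Lebesgue-almost every $(y,X)$, one has, evaluating $\hat\beta$ and $\hat A$ at the observed data $(y,X)$ with $y=X\beta^*+\varepsilon$, $$\bigl(\sigma^2+\|\Sigma^{1/2}(\hat\beta-\beta^*)\|^2\bigr)^{-1/2}\,\bigl(1+\operatorname{tr}[\Sigma\hat A]\bigr)\,\bigl(y_1-x_1^\top\hat\beta\bigr)\ \xrightarrow{\ d\ }\ N(0,1)\qquad\text{as } n\to+\infty.$$ -/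

import Mathlib

open MeasureTheory ProbabilityTheory Filter Topology Matrix
open scoped MatrixOrder

namespace RegMEst

noncomputable section

/-- Response vectors `y ∈ ℝⁿ`. -/
abbrev Resp (n : ℕ) : Type := EuclideanSpace ℝ (Fin n)

/-- Design matrices `X ∈ ℝ^{n × p}`, stored as the family of their rows `x_1, …, x_n ∈ ℝᵖ`. -/
abbrev Design (n p : ℕ) : Type := Fin n → EuclideanSpace ℝ (Fin p)

/-- The linear map `b ↦ M b` of Euclidean spaces attached to a square matrix. -/
abbrev act {p : ℕ} (M : Matrix (Fin p) (Fin p) ℝ) :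
    EuclideanSpace ℝ (Fin p) →L[ℝ] EuclideanSpace ℝ (Fin p) :=
  Matrix.toEuclideanCLM (𝕜 := ℝ) M

/-- The objective `b ↦ (1/n) ∑ᵢ ρ(yᵢ - xᵢᵀ b) + g(b)`. -/
def objective {n p : ℕ} (ρ : ℝ → ℝ) (g : EuclideanSpace ℝ (Fin p) → ℝ)
    (y : Resp n) (X : Design n p) (b : EuclideanSpace ℝ (Fin p)) : ℝ :=
  (1 / (n : ℝ)) * ∑ i, ρ (y i - inner ℝ (X i) b) + g b

/-- The regularized M-estimator: a minimizer over `ℝᵖ` of the objective. (The objective has a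
unique minimizer when `ρ` is convex and bounded below and `g` is strongly convex.) -/
def mEstimator {n p : ℕ} (ρ : ℝ → ℝ) (g : EuclideanSpace ℝ (Fin p) → ℝ)
    (y : Resp n) (X : Design n p) : EuclideanSpace ℝ (Fin p) :=
  Classical.epsilon fun b => ∀ b', objective ρ g y X b ≤ objective ρ g y X b'

/-- The `i`-th residual `rᵢ = yᵢ - xᵢᵀ β̂(y, X)`. -/
def residual {n p : ℕ} (ρ : ℝ → ℝ) (g : EuclideanSpace ℝ (Fin p) → ℝ)
    (y : Resp n) (X : Design n p) (i : Fin n) : ℝ :=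
  y i - inner ℝ (X i) (mEstimator ρ g y X)

/-- The square loss `ρ(u) = u²/2`. -/
def squareLoss (u : ℝ) : ℝ := u ^ 2 / 2

/-- `g` is `μ`-strongly convex with respect to `S`: `b ↦ g(b) - (μ/2) bᵀ S b` is convex. -/
def StronglyConvexWrt {p : ℕ} (S : Matrix (Fin p) (Fin p) ℝ) (μ : ℝ)
    (g : EuclideanSpace ℝ (Fin p) → ℝ) : Prop :=
  ConvexOn ℝ Set.univ fun b => g b - μ / 2 * (b.ofLp ⬝ᵥ S *ᵥ b.ofLp)

/-- `A` is a derivative matrix of the M-estimator at `(y, X)`: the map `(y, X) ↦ β̂(y, X)` is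
differentiable at `(y, X)`, `‖S^{1/2} A S^{1/2}‖_op ≤ (n μ)⁻¹`, and, with `ψ = ρ'`,
`∂β̂/∂yᵢ = A Xᵀ eᵢ ψ'(rᵢ)` and `∂β̂/∂x_{ij} = A eⱼ ψ(rᵢ) - A Xᵀ eᵢ ψ'(rᵢ) β̂ⱼ`
for all `i, j` (note that `Xᵀ eᵢ = xᵢ`). -/
def IsDerivMatrix {n p : ℕ} (ρ : ℝ → ℝ) (g : EuclideanSpace ℝ (Fin p) → ℝ)
    (S : Matrix (Fin p) (Fin p) ℝ) (μ : ℝ) (y : Resp n) (X : Design n p)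
    (A : Matrix (Fin p) (Fin p) ℝ) : Prop :=
  DifferentiableAt ℝ (fun z : Resp n × Design n p => mEstimator ρ g z.1 z.2) (y, X) ∧
  ‖act (CFC.sqrt S * A * CFC.sqrt S)‖ ≤ ((n : ℝ) * μ)⁻¹ ∧
  (∀ i : Fin n,
    fderiv ℝ (fun z : Resp n × Design n p => mEstimator ρ g z.1 z.2) (y, X)
        (EuclideanSpace.single i 1, 0)
      = deriv (deriv ρ) (residual ρ g y X i) • act A (X i)) ∧
  (∀ (i : Fin n) (j : Fin p),
    fderiv ℝ (fun z : Resp n × Design n p => mEstimator ρ g z.1 z.2) (y, X)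
        (0, Pi.single i (EuclideanSpace.single j 1))
      = deriv ρ (residual ρ g y X i) • act A (EuclideanSpace.single j 1)
        - (deriv (deriv ρ) (residual ρ g y X i) * mEstimator ρ g y X j) • act A (X i))

/-- The response `y = X β* + ε` of the linear model. -/
def response {n p : ℕ} (X : Design n p) (βs : EuclideanSpace ℝ (Fin p)) (ε : Resp n) :
    Resp n :=
  WithLp.toLp 2 (fun i => inner ℝ (X i) βs) + ε

/-- `(σ² + ‖S^{1/2}(β̂ - β*)‖²)^{-1/2} (1 + tr[S A]) (yᵢ - xᵢᵀ β̂)`. -/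
def normalizedResidual {n p : ℕ} (ρ : ℝ → ℝ) (g : EuclideanSpace ℝ (Fin p) → ℝ)
    (S : Matrix (Fin p) (Fin p) ℝ) (βs : EuclideanSpace ℝ (Fin p)) (σ : ℝ)
    (A : Matrix (Fin p) (Fin p) ℝ) (y : Resp n) (X : Design n p) (i : Fin n) : ℝ :=
  (σ ^ 2 + ‖act (CFC.sqrt S) (mEstimator ρ g y X - βs)‖ ^ 2) ^ (-(1 / 2) : ℝ)
    * (1 + (S * A).trace) * residual ρ g y X i

end

end RegMEst

/-! Everything rests on one deterministic estimate, `estimator_stability`. Adding the strong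
convexity inequalities at the minimizers for two data sets z and z' bounds S^{1/2}(β̂(z) - β̂(z'))
by (nμ)⁻¹ times S^{-1/2} applied to the change of the score Xᵀ(y - Xb), taken at the fixed point b =
β̂(z).

For (i), this makes β̂ locally Lipschitz, hence differentiable almost everywhere by Rademacher's
theorem. Its infinitesimal form shows that the derivative of β̂ in a direction depends only on the
derivative of the score (b fixed) in that direction. The latter is onto ℝᵖ as soon as one residual
is nonzero, so the derivative of β̂ is a matrix A composed with it; the formulas (*) are its values
on coordinate directions, and (nμ)⁻¹ becomes the norm bound (`exists_isDerivMatrix`). Data whose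
residuals all vanish lie in a fixed hyperplane.

For (ii), freeze all rows but one and the noise e of that row, and write the row as S^{1/2}w with w
standard Gaussian. Let β̂₀ be the estimator for the data with this row zeroed, r₀ = e - ⟨S^{1/2}w,
β̂₀ - β*⟩ and τ₀² = σ² + ‖S^{1/2}(β̂₀ - β*)‖². Since β̂₀ is independent of (w, e), the ratio u =
r₀/τ₀ is exactly N(0,1). For f(w) = S^{1/2}(β̂₀ - β̂), (*) yields w·f - div f = (1 + tr[SA]) r - r₀
- ⟨S^{1/2}(β̂ - β*), S^{1/2}AS^{1/2}w⟩ (`gaussianDiv_rowField`). The second order Stein inequality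
(`lintegral_sq_gaussianDiv_le`) controls the second moment of the left side by those of f and of its
Jacobian, which stability makes O(τ₀²/n) because p/(nμ)² ≤ γ/(μ²n). The inner product, and the
replacement of τ₀ by its analogue τ for β̂, cost relative errors of order ‖w‖/(nμ) = O(n^{-1/2}). So
the normalized residual differs from u by o(1) in probability (`dataLaw_deviation_le`), and
Slutsky's theorem concludes. All errors are proportional to τ₀, so neither σ nor β* needs to be
controlled. -/

namespace RegMEst
set_option linter.unusedSectionVars false

/-! ### The density of the standard Gaussian measure and integration by parts -/

section Gaussian

variable {ι : Type*} [Fintype ι]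

/-- The density of the standard Gaussian measure on `ℝ^ι`. -/
noncomputable def gaussianDensity (z : EuclideanSpace ℝ ι) : ℝ := ∏ i, gaussianPDFReal 0 1 (z i)

lemma gaussianDensity_pos (z : EuclideanSpace ℝ ι) : 0 < gaussianDensity z :=
  Finset.prod_pos fun _ _ => gaussianPDFReal_pos _ _ _ one_ne_zero

lemma gaussianDensity_eq (z : EuclideanSpace ℝ ι) :
    gaussianDensity z = (∏ _i : ι, (√(2 * Real.pi))⁻¹) * Real.exp (-(‖z‖ ^ 2 / 2)) := by
  simp only [gaussianDensity, gaussianPDFReal_def, Finset.prod_mul_distrib, ← Real.exp_sum,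
    EuclideanSpace.real_norm_sq_eq]
  congr 1
  · simp
  · congr 1
    simp [Finset.sum_div, neg_div, Finset.sum_neg_distrib]

lemma hasFDerivAt_gaussianDensity (z : EuclideanSpace ℝ ι) :
    HasFDerivAt gaussianDensity (-(gaussianDensity z) • innerSL ℝ z) z := by
  have h1 : HasFDerivAt (fun x : EuclideanSpace ℝ ι => -(‖x‖ ^ 2 / 2))
      (-((1 / 2 : ℝ) • (2 • innerSL ℝ z))) z := by
    have := ((hasStrictFDerivAt_norm_sq z).hasFDerivAt.const_mul (1 / 2 : ℝ)).neg
    refine this.congr_of_eventuallyEq (Eventually.of_forall fun x => ?_)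
    simp only [Pi.neg_apply]
    ring
  have h2 := (h1.exp.const_mul (∏ _i : ι, (√(2 * Real.pi))⁻¹))
  rw [show (gaussianDensity : EuclideanSpace ℝ ι → ℝ) = _ from funext gaussianDensity_eq]
  refine h2.congr_fderiv ?_
  ext v
  simp
  ring

lemma continuous_gaussianDensity :
    Continuous (gaussianDensity : EuclideanSpace ℝ ι → ℝ) :=
  continuous_iff_continuousAt.2 fun z => (hasFDerivAt_gaussianDensity z).continuousAt

lemma stdGaussian_eq_withDensity :
    stdGaussian (EuclideanSpace ℝ ι)
      = volume.withDensity fun z => ENNReal.ofReal (gaussianDensity z) := by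
  classical
  have hint : ∀ i : ι, Integrable (gaussianPDFReal 0 1) := fun _ => integrable_gaussianPDFReal 0 1
  have key : Measure.pi (fun _ : ι => gaussianReal 0 1)
      = (volume : Measure (ι → ℝ)).withDensity
          fun z => ENNReal.ofReal (∏ i, gaussianPDFReal 0 1 (z i)) := by
    refine Measure.pi_eq fun s hs => ?_
    rw [withDensity_apply _ (MeasurableSet.univ_pi hs), volume_pi, Measure.restrict_pi_pi,
      ← ofReal_integral_eq_lintegral_ofReal]
    · rw [integral_fintype_prod_eq_prod (fun _ x => gaussianPDFReal 0 1 x),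
        ENNReal.ofReal_prod_of_nonneg
          (fun i _ => integral_nonneg fun x => gaussianPDFReal_nonneg _ _ _)]
      refine Finset.prod_congr rfl fun i _ => ?_
      rw [gaussianReal_apply_eq_integral _ one_ne_zero]
    · exact Integrable.fintype_prod (fun i => (hint i).restrict)
    · exact Eventually.of_forall fun x =>
        Finset.prod_nonneg fun _ _ => gaussianPDFReal_nonneg _ _ _
  rw [← map_pi_eq_stdGaussian, key]
  have hmp := PiLp.volume_preserving_toLp ι
  ext s hs
  rw [Measure.map_apply (by fun_prop) hs,
    withDensity_apply _ (hs.preimage (by fun_prop)), withDensity_apply _ hs,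
    ← hmp.setLIntegral_comp_preimage hs]
  · rfl
  · exact continuous_gaussianDensity.measurable.ennreal_ofReal

lemma stdGaussian_absolutelyContinuous :
    stdGaussian (EuclideanSpace ℝ ι) ≪ volume := by
  rw [stdGaussian_eq_withDensity]
  exact withDensity_absolutelyContinuous _ _

lemma integral_stdGaussian_eq (h : EuclideanSpace ℝ ι → ℝ) :
    ∫ z, h z ∂(stdGaussian (EuclideanSpace ℝ ι)) = ∫ z, h z * gaussianDensity z := by
  rw [stdGaussian_eq_withDensity, integral_withDensity_eq_integral_toReal_smul
    continuous_gaussianDensity.measurable.ennreal_ofReal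
    (Eventually.of_forall fun _ => ENNReal.ofReal_lt_top)]
  refine integral_congr_ae (Eventually.of_forall fun z => ?_)
  simp only [smul_eq_mul]
  rw [ENNReal.toReal_ofReal (gaussianDensity_pos z).le, mul_comm]

variable [DecidableEq ι]

/-- The partial derivative of `h` in the direction of the `j`-th coordinate. -/
noncomputable def pderiv (j : ι) (h : EuclideanSpace ℝ ι → ℝ) (z : EuclideanSpace ℝ ι) : ℝ :=
  fderiv ℝ h z (EuclideanSpace.single j 1)

lemma hasCompactSupport_pderiv {h : EuclideanSpace ℝ ι → ℝ} (hs : HasCompactSupport h) (j : ι) :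
    HasCompactSupport (pderiv j h) :=
  hs.fderiv_apply (𝕜 := ℝ) _

lemma contDiff_pderiv {h : EuclideanSpace ℝ ι → ℝ} {m n : WithTop ℕ∞} (hh : ContDiff ℝ n h)
    (hmn : m + 1 ≤ n) (j : ι) : ContDiff ℝ m (pderiv j h) :=
  (hh.fderiv_right hmn).clm_apply contDiff_const

/-- Gaussian integration by parts. -/
lemma integral_coord_mul_stdGaussian {h : EuclideanSpace ℝ ι → ℝ} (hh : ContDiff ℝ 1 h)
    (hs : HasCompactSupport h) (j : ι) :
    ∫ z, z j * h z ∂(stdGaussian (EuclideanSpace ℝ ι))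
      = ∫ z, pderiv j h z ∂(stdGaussian (EuclideanSpace ℝ ι)) := by
  rw [integral_stdGaussian_eq, integral_stdGaussian_eq]
  -- The logarithmic derivative of the density is -z, which turns integration by parts for Lebesgue
  -- measure into the Gaussian formula.
  have hd : ∀ z : EuclideanSpace ℝ ι,
      fderiv ℝ gaussianDensity z (EuclideanSpace.single j 1) = -(z j * gaussianDensity z) := by
    intro z
    rw [(hasFDerivAt_gaussianDensity z).fderiv]
    simp [EuclideanSpace.inner_single_right]
    ring
  have hdc : Continuous (pderiv j h) := (contDiff_pderiv (m := 0) hh (by simp) j).continuous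
  have hg := continuous_gaussianDensity (ι := ι)
  have hz : Continuous fun z : EuclideanSpace ℝ ι => z j := by fun_prop
  have hcs := hasCompactSupport_pderiv hs j
  have := integral_mul_fderiv_eq_neg_fderiv_mul_of_integrable (μ := volume)
    (f := h) (g := gaussianDensity) (v := EuclideanSpace.single j 1)
    ((hdc.mul hg).integrable_of_hasCompactSupport hcs.mul_right)
    (by
      simp_rw [hd]
      exact (hh.continuous.mul (hz.mul hg).neg).integrable_of_hasCompactSupport hs.mul_right)
    ((hh.continuous.mul hg).integrable_of_hasCompactSupport hs.mul_right)
    (fun z _ => hh.differentiable one_ne_zero z)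
    (fun z _ => (hasFDerivAt_gaussianDensity z).differentiableAt)
  simp_rw [hd] at this
  rw [← neg_inj, ← integral_neg]
  unfold pderiv
  rw [← this]
  refine integral_congr_ae (Eventually.of_forall fun z => ?_)
  simp only
  ring

end Gaussian

/-! ### The second order Stein inequality -/

section Stein

variable {ι : Type*} [Fintype ι] [DecidableEq ι]

lemma pderiv_mul {f g : EuclideanSpace ℝ ι → ℝ} {z : EuclideanSpace ℝ ι}
    (hf : DifferentiableAt ℝ f z) (hg : DifferentiableAt ℝ g z) (j : ι) :
    pderiv j (fun z => f z * g z) z = f z * pderiv j g z + g z * pderiv j f z := by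
  simp [pderiv, fderiv_fun_mul hf hg]

lemma pderiv_sub {f g : EuclideanSpace ℝ ι → ℝ} {z : EuclideanSpace ℝ ι}
    (hf : DifferentiableAt ℝ f z) (hg : DifferentiableAt ℝ g z) (j : ι) :
    pderiv j (fun z => f z - g z) z = pderiv j f z - pderiv j g z := by
  simp [pderiv, fderiv_fun_sub hf hg]

lemma pderiv_sum {f : ι → EuclideanSpace ℝ ι → ℝ} {z : EuclideanSpace ℝ ι}
    (hf : ∀ i, DifferentiableAt ℝ (f i) z) (j : ι) :
    pderiv j (fun z => ∑ i, f i z) z = ∑ i, pderiv j (f i) z := by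
  simp [pderiv, fderiv_fun_sum (fun i _ => hf i)]

lemma pderiv_coord (i j : ι) (z : EuclideanSpace ℝ ι) :
    pderiv j (fun z : EuclideanSpace ℝ ι => z i) z = if i = j then 1 else 0 := by
  have : fderiv ℝ (fun z : EuclideanSpace ℝ ι => z i) z
      = (EuclideanSpace.proj i : EuclideanSpace ℝ ι →L[ℝ] ℝ) :=
    (EuclideanSpace.proj i : EuclideanSpace ℝ ι →L[ℝ] ℝ).fderiv
  rw [pderiv, this]
  simp

lemma pderiv_comm {f : EuclideanSpace ℝ ι → ℝ} (hf : ContDiff ℝ 2 f) (i j : ι)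
    (z : EuclideanSpace ℝ ι) : pderiv i (pderiv j f) z = pderiv j (pderiv i f) z := by
  have hd : DifferentiableAt ℝ (fderiv ℝ f) z :=
    (hf.fderiv_right (m := 1) (by norm_num)).differentiable one_ne_zero z
  have h : ∀ k l : ι, pderiv k (pderiv l f) z
      = fderiv ℝ (fderiv ℝ f) z (EuclideanSpace.single k 1) (EuclideanSpace.single l 1) := by
    intro k l
    unfold pderiv
    rw [fderiv_clm_apply hd (differentiableAt_const _)]
    simp
  rw [h, h]
  exact (hf.contDiffAt.isSymmSndFDerivAt (by simp)).eq _ _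

lemma integrable_stdGaussian_of_hasCompactSupport {h : EuclideanSpace ℝ ι → ℝ}
    (hc : Continuous h) (hs : HasCompactSupport h) :
    Integrable h (stdGaussian (EuclideanSpace ℝ ι)) :=
  hc.integrable_of_hasCompactSupport hs

/-- The gap is half the squared Frobenius norm of the antisymmetric difference a - aᵀ. This replaces
the trace of the squared Jacobian in Stein's identity by a Frobenius norm. -/
lemma sum_mul_swap_le_sum_sq (a : ι → ι → ℝ) :
    ∑ i, ∑ j, a i j * a j i ≤ ∑ i, ∑ j, a i j ^ 2 := by
  have h1 : ∑ i, ∑ j, a j i ^ 2 = ∑ i, ∑ j, a i j ^ 2 := Finset.sum_comm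
  have h2 : 0 ≤ ∑ i, ∑ j, (a i j - a j i) ^ 2 :=
    Finset.sum_nonneg fun i _ => Finset.sum_nonneg fun j _ => sq_nonneg _
  have h3 : ∑ i, ∑ j, (a i j - a j i) ^ 2
      = ∑ i, ∑ j, a i j ^ 2 + ∑ i, ∑ j, a j i ^ 2 - 2 * ∑ i, ∑ j, a i j * a j i := by
    simp only [Finset.mul_sum, ← Finset.sum_add_distrib, ← Finset.sum_sub_distrib]
    refine Finset.sum_congr rfl fun i _ => Finset.sum_congr rfl fun j _ => ?_
    ring
  linarith

/-- The Gaussian divergence `zᵀ f(z) - div f(z)` of a vector field. -/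
noncomputable def gaussianDiv (f : ι → EuclideanSpace ℝ ι → ℝ) (z : EuclideanSpace ℝ ι) : ℝ :=
  ∑ i, (z i * f i z - pderiv i (f i) z)

/-- The operator δf = z·f - div f is the adjoint of the gradient in L² of the Gaussian measure and
satisfies ∂ᵢδf = fᵢ + δ(∂ᵢf). Moving one δ across as a gradient, commuting, then moving the second δ
across gives the identity. -/
lemma integral_sq_gaussianDiv_of_contDiff {f : ι → EuclideanSpace ℝ ι → ℝ}
    (hf : ∀ i, ContDiff ℝ 2 (f i)) (hs : ∀ i, HasCompactSupport (f i)) :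
    ∫ z, gaussianDiv f z ^ 2 ∂(stdGaussian (EuclideanSpace ℝ ι))
      = ∫ z, (∑ i, f i z ^ 2 + ∑ i, ∑ j, pderiv j (f i) z * pderiv i (f j) z)
          ∂(stdGaussian (EuclideanSpace ℝ ι)) := by
  have hf1 : ∀ i, ContDiff ℝ 1 (f i) := fun i => (hf i).of_le (by norm_num)
  have hd : ∀ i z, DifferentiableAt ℝ (f i) z := fun i z => (hf i).differentiable two_ne_zero z
  have hp1 : ∀ i j, ContDiff ℝ 1 (pderiv j (f i)) := fun i j =>
    contDiff_pderiv (hf i) (by norm_num) j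
  have hpd : ∀ i j z, DifferentiableAt ℝ (pderiv j (f i)) z :=
    fun i j z => (hp1 i j).differentiable one_ne_zero z
  have hpp : ∀ i j k, Continuous (pderiv k (pderiv j (f i))) := fun i j k =>
    (contDiff_pderiv (m := 0) (hp1 i j) (by simp) k).continuous
  have hps : ∀ i j, HasCompactSupport (pderiv j (f i)) := fun i j =>
    hasCompactSupport_pderiv (hs i) j
  have hcoord : ∀ i : ι, ContDiff ℝ 1 fun z : EuclideanSpace ℝ ι => z i := fun i =>
    (EuclideanSpace.proj (𝕜 := ℝ) i).contDiff
  have hcd : ∀ (i : ι) z, DifferentiableAt ℝ (fun z : EuclideanSpace ℝ ι => z i) z :=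
    fun i z => (hcoord i).differentiable one_ne_zero z
  have hG1 : ContDiff ℝ 1 (gaussianDiv f) :=
    ContDiff.sum fun i _ => ((hcoord i).mul (hf1 i)).sub (hp1 i i)
  have hGd : ∀ z, DifferentiableAt ℝ (gaussianDiv f) z :=
    fun z => hG1.differentiable one_ne_zero z
  have hGp : ∀ i, Continuous (pderiv i (gaussianDiv f)) := fun i =>
    (contDiff_pderiv (m := 0) hG1 (by simp) i).continuous
  -- The commutation relation; the symmetry of second derivatives enters here.
  have hGi : ∀ i z, pderiv i (gaussianDiv f) z
      = f i z + ∑ j, (z j * pderiv i (f j) z - pderiv j (pderiv i (f j)) z) := by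
    intro i z
    have : gaussianDiv f = fun z => ∑ j, (z j * f j z - pderiv j (f j) z) := rfl
    rw [this, pderiv_sum (f := fun j z => z j * f j z - pderiv j (f j) z)
      (fun j => ((hcd j z).mul (hd j z)).sub (hpd j j z))]
    have h : ∀ j, pderiv i (fun z => z j * f j z - pderiv j (f j) z) z
        = (if j = i then f j z else 0)
          + (z j * pderiv i (f j) z - pderiv j (pderiv i (f j)) z) := by
      intro j
      rw [pderiv_sub (f := fun z => z j * f j z) ((hcd j z).mul (hd j z)) (hpd j j z), pderiv_mul (hcd j z) (hd j z),
        pderiv_coord, pderiv_comm (hf j) i j]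
      split_ifs <;> ring
    simp_rw [h, Finset.sum_add_distrib]
    simp
  have step1 : ∀ i, ∫ z, (z i * f i z - pderiv i (f i) z) * gaussianDiv f z
        ∂(stdGaussian (EuclideanSpace ℝ ι))
      = ∫ z, f i z * pderiv i (gaussianDiv f) z ∂(stdGaussian (EuclideanSpace ℝ ι)) := by
    intro i
    have h := integral_coord_mul_stdGaussian ((hf1 i).mul hG1) ((hs i).mul_right) i
    simp_rw [sub_mul, mul_assoc]
    rw [integral_sub, h, ← integral_sub]
    · refine integral_congr_ae (Eventually.of_forall fun z => ?_)
      simp only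
      rw [pderiv_mul (hd i z) (hGd z)]
      ring
    · exact integrable_stdGaussian_of_hasCompactSupport
        (contDiff_pderiv (m := 0) ((hf1 i).mul hG1) (by simp) i).continuous
        (hasCompactSupport_pderiv ((hs i).mul_right) i)
    · exact integrable_stdGaussian_of_hasCompactSupport
        ((hp1 i i).continuous.mul hG1.continuous) (hps i i).mul_right
    · exact integrable_stdGaussian_of_hasCompactSupport
        ((hcoord i).continuous.mul ((hf i).continuous.mul hG1.continuous))
        ((hs i).mul_right).mul_left
    · exact integrable_stdGaussian_of_hasCompactSupport
        ((hp1 i i).continuous.mul hG1.continuous) (hps i i).mul_right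
  -- Second integration by parts, applied to fᵢ ∂ᵢfⱼ in direction j: the second derivatives of f
  -- cancel.
  have step2 : ∀ i j, ∫ z, (z j * (f i z * pderiv i (f j) z)
        - f i z * pderiv j (pderiv i (f j)) z) ∂(stdGaussian (EuclideanSpace ℝ ι))
      = ∫ z, pderiv j (f i) z * pderiv i (f j) z ∂(stdGaussian (EuclideanSpace ℝ ι)) := by
    intro i j
    have h := integral_coord_mul_stdGaussian ((hf1 i).mul (hp1 j i)) ((hs i).mul_right) j
    rw [integral_sub, h, ← integral_sub]
    · refine integral_congr_ae (Eventually.of_forall fun z => ?_)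
      simp only
      rw [pderiv_mul (hd i z) (hpd j i z)]
      ring
    · exact integrable_stdGaussian_of_hasCompactSupport
        (contDiff_pderiv (m := 0) ((hf1 i).mul (hp1 j i)) (by simp) j).continuous
        (hasCompactSupport_pderiv ((hs i).mul_right) j)
    · exact integrable_stdGaussian_of_hasCompactSupport
        ((hf i).continuous.mul (hpp j i j)) (hs i).mul_right
    · exact integrable_stdGaussian_of_hasCompactSupport
        ((hcoord j).continuous.mul ((hf i).continuous.mul (hp1 j i).continuous))
        ((hs i).mul_right).mul_left
    · exact integrable_stdGaussian_of_hasCompactSupport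
        ((hf i).continuous.mul (hpp j i j)) (hs i).mul_right
  have i1 : ∀ i, Integrable (fun z => (z i * f i z - pderiv i (f i) z) * gaussianDiv f z)
      (stdGaussian (EuclideanSpace ℝ ι)) := fun i =>
    integrable_stdGaussian_of_hasCompactSupport
      ((((hcoord i).mul (hf1 i)).sub (hp1 i i)).continuous.mul hG1.continuous)
      (((hs i).mul_left.sub (hps i i)).mul_right)
  have i2 : ∀ i, Integrable (fun z => f i z ^ 2) (stdGaussian (EuclideanSpace ℝ ι)) := fun i =>
    integrable_stdGaussian_of_hasCompactSupport ((hf i).continuous.pow 2)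
      (by simp_rw [pow_two]; exact (hs i).mul_right)
  have i3 : ∀ i j, Integrable (fun z => z j * (f i z * pderiv i (f j) z)
        - f i z * pderiv j (pderiv i (f j)) z) (stdGaussian (EuclideanSpace ℝ ι)) := fun i j =>
    integrable_stdGaussian_of_hasCompactSupport
      (((hcoord j).continuous.mul ((hf i).continuous.mul (hp1 j i).continuous)).sub
        ((hf i).continuous.mul (hpp j i j))) (((hs i).mul_right).mul_left.sub (hs i).mul_right)
  have i4 : ∀ i j, Integrable (fun z => pderiv j (f i) z * pderiv i (f j) z)
      (stdGaussian (EuclideanSpace ℝ ι)) := fun i j =>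
    integrable_stdGaussian_of_hasCompactSupport ((hp1 i j).continuous.mul (hp1 j i).continuous)
      (hps i j).mul_right
  calc ∫ z, gaussianDiv f z ^ 2 ∂(stdGaussian (EuclideanSpace ℝ ι))
      = ∫ z, ∑ i, (z i * f i z - pderiv i (f i) z) * gaussianDiv f z
          ∂(stdGaussian (EuclideanSpace ℝ ι)) := by
        simp_rw [← Finset.sum_mul, pow_two]
        rfl
    _ = ∑ i, ∫ z, f i z * pderiv i (gaussianDiv f) z ∂(stdGaussian (EuclideanSpace ℝ ι)) := by
        rw [integral_finsetSum _ fun i _ => i1 i]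
        exact Finset.sum_congr rfl fun i _ => step1 i
    _ = ∑ i, (∫ z, f i z ^ 2 ∂(stdGaussian (EuclideanSpace ℝ ι))
          + ∑ j, ∫ z, pderiv j (f i) z * pderiv i (f j) z
            ∂(stdGaussian (EuclideanSpace ℝ ι))) := by
        refine Finset.sum_congr rfl fun i _ => ?_
        simp_rw [← step2]
        rw [← integral_finsetSum _ fun j _ => i3 i j,
          ← integral_add (i2 i) (integrable_finsetSum _ fun j _ => i3 i j)]
        refine integral_congr_ae (Eventually.of_forall fun z => ?_)
        simp only
        rw [hGi, mul_add, Finset.mul_sum, pow_two]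
        congr 1
        refine Finset.sum_congr rfl fun j _ => ?_
        ring
    _ = _ := by
        rw [integral_add (integrable_finsetSum _ fun i _ => i2 i)
          (integrable_finsetSum _ fun i _ => integrable_finsetSum _ fun j _ => i4 i j),
          integral_finsetSum _ fun i _ => i2 i,
          integral_finsetSum _ fun i _ => integrable_finsetSum _ fun j _ => i4 i j,
          Finset.sum_add_distrib]
        congr 1
        refine Finset.sum_congr rfl fun i _ => ?_
        rw [integral_finsetSum _ fun j _ => i4 i j]

end Stein

/-- **Rademacher's theorem** for locally Lipschitz functions. -/
lemma ae_differentiableAt_of_locallyLipschitz {E F : Type*} [NormedAddCommGroup E]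
    [NormedSpace ℝ E] [FiniteDimensional ℝ E] [MeasurableSpace E] [BorelSpace E]
    [NormedAddCommGroup F] [NormedSpace ℝ F] [FiniteDimensional ℝ F] {μ : Measure E}
    [μ.IsAddHaarMeasure] {f : E → F} (hf : LocallyLipschitz f) :
    ∀ᵐ x ∂μ, DifferentiableAt ℝ f x := by
  have : ProperSpace E := FiniteDimensional.proper ℝ E
  -- On each compact ball the function is Lipschitz; countably many balls exhaust the space.
  have h : ∀ k : ℕ, ∀ᵐ x ∂μ, x ∈ Metric.closedBall (0 : E) k →
      DifferentiableWithinAt ℝ f (Metric.closedBall (0 : E) k) x := by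
    intro k
    obtain ⟨K, hK⟩ := (hf.locallyLipschitzOn (s := Metric.closedBall (0 : E) k)
      ).exists_lipschitzOnWith_of_compact (isCompact_closedBall _ _)
    exact hK.ae_differentiableWithinAt_of_mem
  filter_upwards [ae_all_iff.2 h] with x hx
  obtain ⟨k, hk⟩ := exists_nat_gt ‖x‖
  refine (hx k (by simpa using hk.le)).differentiableAt ?_
  exact mem_of_superset (Metric.isOpen_ball.mem_nhds (by simpa using hk))
    Metric.ball_subset_closedBall

/-! ### Mollification of Lipschitz functions -/

section Mollification

variable {ι : Type*} [Fintype ι] [DecidableEq ι]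

/-- A sequence of bump functions on `ℝ^ι` whose supports shrink to the origin. -/
noncomputable def shrinkingBump (ι : Type*) [Fintype ι] (k : ℕ) :
    ContDiffBump (0 : EuclideanSpace ℝ ι) where
  rIn := 1 / (k + 1)
  rOut := 2 / (k + 1)
  rIn_pos := by positivity
  rIn_lt_rOut := by gcongr; norm_num

/-- The mollification of `h` by `shrinkingBump ι k`. -/
noncomputable def mollify (k : ℕ) (h : EuclideanSpace ℝ ι → ℝ) : EuclideanSpace ℝ ι → ℝ :=
  convolution ((shrinkingBump ι k).normed volume) h (ContinuousLinearMap.lsmul ℝ ℝ) volume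

lemma mollify_apply (k : ℕ) (h : EuclideanSpace ℝ ι → ℝ) (z : EuclideanSpace ℝ ι) :
    mollify k h z = ∫ t, (shrinkingBump ι k).normed volume t * h (z - t) := rfl

lemma tendsto_rOut_shrinkingBump :
    Tendsto (fun k => (shrinkingBump ι k).rOut) atTop (𝓝 0) := by
  have := (tendsto_one_div_add_atTop_nhds_zero_nat (𝕜 := ℝ)).const_mul 2
  simpa [shrinkingBump, div_eq_mul_inv] using this

lemma contDiff_mollify (k : ℕ) {h : EuclideanSpace ℝ ι → ℝ} (hh : LocallyIntegrable h) :
    ContDiff ℝ 2 (mollify k h) :=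
  (shrinkingBump ι k).hasCompactSupport_normed.contDiff_convolution_left (n := 2) _
    ((shrinkingBump ι k).contDiff_normed) hh

lemma hasCompactSupport_mollify (k : ℕ) {h : EuclideanSpace ℝ ι → ℝ} (hh : HasCompactSupport h) :
    HasCompactSupport (mollify k h) :=
  HasCompactSupport.convolution _ (shrinkingBump ι k).hasCompactSupport_normed hh

lemma abs_mollify_le (k : ℕ) {h : EuclideanSpace ℝ ι → ℝ} {M : ℝ} (hh : ∀ z, |h z| ≤ M)
    (z : EuclideanSpace ℝ ι) : |mollify k h z| ≤ M := by
  rw [mollify_apply, ← Real.norm_eq_abs]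
  calc ‖∫ t, (shrinkingBump ι k).normed volume t * h (z - t)‖
      ≤ ∫ t, (shrinkingBump ι k).normed volume t * M := by
        refine norm_integral_le_of_norm_le ((shrinkingBump ι k).integrable_normed.mul_const M)
          (Eventually.of_forall fun t => ?_)
        rw [norm_mul, Real.norm_of_nonneg ((shrinkingBump ι k).nonneg_normed t)]
        exact mul_le_mul_of_nonneg_left (hh _) ((shrinkingBump ι k).nonneg_normed t)
    _ = M := by rw [integral_mul_const, (shrinkingBump ι k).integral_normed, one_mul]

lemma abs_pderiv_le {h : EuclideanSpace ℝ ι → ℝ} {K : NNReal} (hh : LipschitzWith K h) (j : ι)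
    (z : EuclideanSpace ℝ ι) : |pderiv j h z| ≤ K := by
  refine ((fderiv ℝ h z).le_opNorm _).trans ?_
  simpa using norm_fderiv_le_of_lipschitz ℝ hh

lemma measurable_pderiv (h : EuclideanSpace ℝ ι → ℝ) (j : ι) : Measurable (pderiv j h) :=
  measurable_fderiv_apply_const ℝ h _

lemma locallyIntegrable_of_measurable_of_abs_le {h : EuclideanSpace ℝ ι → ℝ} {M : ℝ}
    (hm : Measurable h) (hh : ∀ z, |h z| ≤ M) : LocallyIntegrable h := by
  refine (locallyIntegrable_const M).mono hm.aestronglyMeasurable (Eventually.of_forall fun z => ?_)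
  exact (hh z).trans (le_abs_self M)

/-- Differentiation under the integral sign, dominated by the Lipschitz constant. Rademacher's
theorem supplies the derivative of the integrand for almost every t, because t ↦ z - t preserves
null sets. -/
lemma pderiv_mollify (k : ℕ) {h : EuclideanSpace ℝ ι → ℝ} {K : NNReal} (hh : LipschitzWith K h)
    (j : ι) : pderiv j (mollify k h) = mollify k (pderiv j h) := by
  funext z
  set φ := (shrinkingBump ι k).normed (volume : Measure (EuclideanSpace ℝ ι)) with hφ
  have hφc : Continuous φ := (shrinkingBump ι k).continuous_normed
  have hφs : HasCompactSupport φ := (shrinkingBump ι k).hasCompactSupport_normed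
  have hφi : Integrable φ := (shrinkingBump ι k).integrable_normed
  have hcont : ∀ x, Continuous fun t => φ t * h (x - t) := fun x =>
    hφc.mul (hh.continuous.comp (by fun_prop))
  have hmeas : Measurable fun t => φ t • fderiv ℝ h (z - t) :=
    hφc.measurable.smul ((measurable_fderiv ℝ h).comp (by fun_prop))
  have hdiff : ∀ᵐ t, DifferentiableAt ℝ h (z - t) := by
    have := ae_differentiableAt_of_locallyLipschitz
      (μ := (volume : Measure (EuclideanSpace ℝ ι))) hh.locallyLipschitz
    exact (quasiMeasurePreserving_sub_left volume z).ae this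
  have := hasFDerivAt_integral_of_dominated_loc_of_lip (μ := volume) (𝕜 := ℝ)
    (F := fun x t => φ t * h (x - t)) (x₀ := z) (s := Set.univ)
    (bound := fun t => φ t * K) (F' := fun t => φ t • fderiv ℝ h (z - t)) univ_mem
    (Eventually.of_forall fun x => (hcont x).aestronglyMeasurable)
    ((hcont z).integrable_of_hasCompactSupport hφs.mul_right)
    hmeas.aestronglyMeasurable
    (Eventually.of_forall fun t => by
      refine LipschitzOnWith.of_dist_le_mul fun x _ y _ => ?_
      have h0 : 0 ≤ φ t := (shrinkingBump ι k).nonneg_normed t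
      rw [Real.coe_nnabs, abs_of_nonneg (by positivity), Real.dist_eq, ← mul_sub, abs_mul,
        abs_of_nonneg h0, mul_assoc]
      refine mul_le_mul_of_nonneg_left ?_ h0
      have := hh.dist_le_mul (x - t) (y - t)
      rwa [dist_sub_right, Real.dist_eq] at this)
    (hφi.mul_const _)
    (by
      filter_upwards [hdiff] with t ht
      have h1 : HasFDerivAt (fun x => h (x - t)) (fderiv ℝ h (z - t)) z := by
        have := ht.hasFDerivAt.comp z ((hasFDerivAt_id z).sub_const t)
        simpa [Function.comp_def] using this
      exact h1.const_mul (φ t))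
  have h2 : HasFDerivAt (mollify k h) (∫ t, φ t • fderiv ℝ h (z - t)) z := this.2
  rw [pderiv, h2.fderiv, ContinuousLinearMap.integral_apply this.1, mollify_apply]
  rfl

/-- Lebesgue differentiation, which applies because the ratio of outer to inner radius stays equal
to 2. -/
lemma ae_tendsto_mollify {h : EuclideanSpace ℝ ι → ℝ} (hh : LocallyIntegrable h) :
    ∀ᵐ z, Tendsto (fun k => mollify k h z) atTop (𝓝 (h z)) :=
  ContDiffBump.ae_convolution_tendsto_right_of_locallyIntegrable (φ := shrinkingBump ι) (K := 2)
    tendsto_rOut_shrinkingBump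
    (Eventually.of_forall fun k => by
      change 2 / ((k : ℝ) + 1) ≤ 2 * (1 / ((k : ℝ) + 1))
      rw [mul_one_div]) hh

end Mollification

/-! ### From smooth compactly supported to locally Lipschitz vector fields -/

section SteinLipschitz

variable {ι : Type*} [Fintype ι] [DecidableEq ι]

lemma measurable_gaussianDiv {f : ι → EuclideanSpace ℝ ι → ℝ} (hf : ∀ i, Measurable (f i)) :
    Measurable (gaussianDiv f) :=
  Finset.measurable_sum _ fun i _ =>
    ((Measurable.mul (by fun_prop) (hf i)).sub (measurable_pderiv (f i) i))

lemma lintegral_sq_gaussianDiv_le_of_contDiff {f : ι → EuclideanSpace ℝ ι → ℝ}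
    (hf : ∀ i, ContDiff ℝ 2 (f i)) (hs : ∀ i, HasCompactSupport (f i)) :
    ∫⁻ z, ENNReal.ofReal (gaussianDiv f z ^ 2) ∂(stdGaussian (EuclideanSpace ℝ ι))
      ≤ ∫⁻ z, ENNReal.ofReal (∑ i, f i z ^ 2 + ∑ i, ∑ j, pderiv j (f i) z ^ 2)
          ∂(stdGaussian (EuclideanSpace ℝ ι)) := by
  have hp1 : ∀ i j, ContDiff ℝ 1 (pderiv j (f i)) := fun i j =>
    contDiff_pderiv (hf i) (by norm_num) j
  have hps : ∀ i j, HasCompactSupport (pderiv j (f i)) := fun i j =>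
    hasCompactSupport_pderiv (hs i) j
  have hz : ∀ i : ι, Continuous fun z : EuclideanSpace ℝ ι => z i := fun i => by fun_prop
  have i0 : ∀ i, Integrable (fun z => f i z ^ 2) (stdGaussian (EuclideanSpace ℝ ι)) := fun i =>
    integrable_stdGaussian_of_hasCompactSupport ((hf i).continuous.pow 2)
      (by simp_rw [pow_two]; exact (hs i).mul_right)
  have i1 : ∀ i j, Integrable (fun z => pderiv j (f i) z * pderiv i (f j) z)
      (stdGaussian (EuclideanSpace ℝ ι)) := fun i j =>
    integrable_stdGaussian_of_hasCompactSupport ((hp1 i j).continuous.mul (hp1 j i).continuous)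
      (hps i j).mul_right
  have i2 : ∀ i j, Integrable (fun z => pderiv j (f i) z ^ 2)
      (stdGaussian (EuclideanSpace ℝ ι)) := fun i j =>
    integrable_stdGaussian_of_hasCompactSupport ((hp1 i j).continuous.pow 2)
      (by simp_rw [pow_two]; exact (hps i j).mul_right)
  have hgc : Continuous (gaussianDiv f) := continuous_finsetSum _ fun i _ =>
    ((hz i).mul (hf i).continuous).sub (hp1 i i).continuous
  have hgs : HasCompactSupport (gaussianDiv f) := by
    have : gaussianDiv f = ∑ i, fun z => (z i * f i z - pderiv i (f i) z) := by
      funext z; simp [gaussianDiv]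
    rw [this]
    refine Finset.sum_induction _ (fun h : EuclideanSpace ℝ ι → ℝ => HasCompactSupport h)
      (fun _ _ => HasCompactSupport.add) HasCompactSupport.zero fun i _ => ?_
    exact (hs i).mul_left.sub (hps i i)
  have i3 : Integrable (fun z => gaussianDiv f z ^ 2) (stdGaussian (EuclideanSpace ℝ ι)) :=
    integrable_stdGaussian_of_hasCompactSupport (hgc.pow 2)
      (by simp_rw [pow_two]; exact hgs.mul_right)
  have i4 : Integrable (fun z => ∑ i, f i z ^ 2 + ∑ i, ∑ j, pderiv j (f i) z ^ 2)
      (stdGaussian (EuclideanSpace ℝ ι)) :=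
    (integrable_finsetSum Finset.univ fun i _ => i0 i).add (integrable_finsetSum Finset.univ
      fun i _ => integrable_finsetSum Finset.univ fun j _ => i2 i j)
  rw [← ofReal_integral_eq_lintegral_ofReal i3 (Eventually.of_forall fun z => sq_nonneg _),
    ← ofReal_integral_eq_lintegral_ofReal i4 (Eventually.of_forall fun z => by
      simp only [Pi.zero_apply]; positivity)]
  refine ENNReal.ofReal_le_ofReal ?_
  rw [integral_sq_gaussianDiv_of_contDiff hf hs]
  refine integral_mono ((integrable_finsetSum _ fun i _ => i0 i).add
    (integrable_finsetSum _ fun i _ => integrable_finsetSum _ fun j _ => i1 i j)) i4 fun z => ?_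
  refine add_le_add_right ?_ _
  exact sum_mul_swap_le_sum_sq fun i j => pderiv j (f i) z

/-- Fatou's lemma, in the form used both for mollification and for truncation. No integrability of
the limit is needed. -/
lemma lintegral_le_of_ae_tendsto {α : Type*} [MeasurableSpace α] {μ : Measure α}
    {u : ℕ → α → ℝ} {v : α → ℝ} {B : ENNReal} (hu : ∀ k, Measurable (u k))
    (huv : ∀ᵐ z ∂μ, Tendsto (fun k => u k z) atTop (𝓝 (v z))) {w : ℕ → ENNReal}
    (hw : Tendsto w atTop (𝓝 B)) (hB : ∀ k, ∫⁻ z, ENNReal.ofReal (u k z) ∂μ ≤ w k) :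
    ∫⁻ z, ENNReal.ofReal (v z) ∂μ ≤ B := by
  calc ∫⁻ z, ENNReal.ofReal (v z) ∂μ
      = ∫⁻ z, liminf (fun k => ENNReal.ofReal (u k z)) atTop ∂μ := by
        refine lintegral_congr_ae ?_
        filter_upwards [huv] with z hz
        exact ((ENNReal.continuous_ofReal.tendsto _).comp hz).liminf_eq.symm
    _ ≤ liminf (fun k => ∫⁻ z, ENNReal.ofReal (u k z) ∂μ) atTop :=
        lintegral_liminf_le fun k => (hu k).ennreal_ofReal
    _ ≤ liminf w atTop := liminf_le_liminf (Eventually.of_forall hB)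
    _ = B := hw.liminf_eq

/-- Mollify: Fatou handles the left side. The right side passes to the limit by dominated
convergence, since mollification preserves the bounds on f and on its partial derivatives. -/
lemma lintegral_sq_gaussianDiv_le_of_lipschitzWith {f : ι → EuclideanSpace ℝ ι → ℝ} {K : NNReal}
    (hf : ∀ i, LipschitzWith K (f i)) (hs : ∀ i, HasCompactSupport (f i)) :
    ∫⁻ z, ENNReal.ofReal (gaussianDiv f z ^ 2) ∂(stdGaussian (EuclideanSpace ℝ ι))
      ≤ ∫⁻ z, ENNReal.ofReal (∑ i, f i z ^ 2 + ∑ i, ∑ j, pderiv j (f i) z ^ 2)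
          ∂(stdGaussian (EuclideanSpace ℝ ι)) := by
  have hM : ∀ i, ∃ M, ∀ z, |f i z| ≤ M := fun i =>
    (hs i).exists_bound_of_continuous (hf i).continuous
  choose M hM using hM
  have hfl : ∀ i, LocallyIntegrable (f i) := fun i =>
    locallyIntegrable_of_measurable_of_abs_le (hf i).continuous.measurable (hM i)
  have hpl : ∀ i j, LocallyIntegrable (pderiv j (f i)) := fun i j =>
    locallyIntegrable_of_measurable_of_abs_le (measurable_pderiv _ _) (abs_pderiv_le (hf i) j)
  have hc : ∀ k i, ContDiff ℝ 2 (mollify k (f i)) := fun k i => contDiff_mollify k (hfl i)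
  have htf : ∀ᵐ z ∂(stdGaussian (EuclideanSpace ℝ ι)), ∀ i,
      Tendsto (fun k => mollify k (f i) z) atTop (𝓝 (f i z)) :=
    stdGaussian_absolutelyContinuous.ae_le (ae_all_iff.2 fun i => ae_tendsto_mollify (hfl i))
  have htp : ∀ᵐ z ∂(stdGaussian (EuclideanSpace ℝ ι)), ∀ i j,
      Tendsto (fun k => pderiv j (mollify k (f i)) z) atTop (𝓝 (pderiv j (f i) z)) := by
    refine stdGaussian_absolutelyContinuous.ae_le
      (ae_all_iff.2 fun i => ae_all_iff.2 fun j => ?_)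
    filter_upwards [ae_tendsto_mollify (hpl i j)] with z hz
    simpa only [pderiv_mollify _ (hf i)] using hz
  refine lintegral_le_of_ae_tendsto (u := fun k z => gaussianDiv (fun i => mollify k (f i)) z ^ 2)
    (fun k => (measurable_gaussianDiv fun i => (hc k i).continuous.measurable).pow_const 2) ?_ ?_
    (fun k => lintegral_sq_gaussianDiv_le_of_contDiff (hc k)
      fun i => hasCompactSupport_mollify k (hs i))
  · filter_upwards [htf, htp] with z h1 h2
    exact (tendsto_finsetSum _ fun i _ => ((h1 i).const_mul _).sub (h2 i i)).pow 2
  · refine tendsto_lintegral_of_dominated_convergence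
      (fun _ => ENNReal.ofReal (∑ i, M i ^ 2 + ∑ _i : ι, ∑ _j : ι, (K : ℝ) ^ 2)) ?_ ?_ ?_ ?_
    · intro k
      refine Measurable.ennreal_ofReal (Measurable.add ?_ ?_)
      · exact Finset.measurable_sum _ fun i _ => (hc k i).continuous.measurable.pow_const 2
      · exact Finset.measurable_sum _ fun i _ => Finset.measurable_sum _ fun j _ =>
          (measurable_pderiv _ _).pow_const 2
    · intro k
      refine Eventually.of_forall fun z => ENNReal.ofReal_le_ofReal ?_
      refine add_le_add (Finset.sum_le_sum fun i _ => ?_)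
        (Finset.sum_le_sum fun i _ => Finset.sum_le_sum fun j _ => ?_)
      · rw [← sq_abs]
        exact pow_le_pow_left₀ (abs_nonneg _) (abs_mollify_le k (hM i) z) 2
      · rw [← sq_abs, pderiv_mollify _ (hf i)]
        exact pow_le_pow_left₀ (abs_nonneg _) (abs_mollify_le k (abs_pderiv_le (hf i) j) z) 2
    · simp
    · filter_upwards [htf, htp] with z h1 h2
      refine (ENNReal.continuous_ofReal.tendsto _).comp ?_
      exact (tendsto_finsetSum _ fun i _ => (h1 i).pow 2).add
        (tendsto_finsetSum _ fun i _ => tendsto_finsetSum _ fun j _ => (h2 i j).pow 2)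

/-- The Lipschitz cutoff function equal to `1` on the ball of radius `R` and to `0` outside of the
ball of radius `R + 1`. -/
noncomputable def cutoff {E : Type*} [NormedAddCommGroup E] (R : ℝ) (z : E) : ℝ :=
  max 0 (min 1 (R + 1 - ‖z‖))

lemma lipschitzWith_cutoff {E : Type*} [NormedAddCommGroup E] (R : ℝ) :
    LipschitzWith 1 (cutoff R : E → ℝ) := by
  have h : LipschitzWith 1 fun z : E => R + 1 - ‖z‖ := by
    refine LipschitzWith.of_dist_le_mul fun x y => ?_
    rw [NNReal.coe_one, one_mul, Real.dist_eq, dist_eq_norm,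
      show R + 1 - ‖x‖ - (R + 1 - ‖y‖) = ‖y‖ - ‖x‖ by ring, abs_sub_comm]
    exact abs_norm_sub_norm_le x y
  exact (h.const_min 1).const_max 0

lemma cutoff_nonneg {E : Type*} [NormedAddCommGroup E] (R : ℝ) (z : E) : 0 ≤ cutoff R z :=
  le_max_left _ _

lemma cutoff_le_one {E : Type*} [NormedAddCommGroup E] (R : ℝ) (z : E) : cutoff R z ≤ 1 :=
  max_le zero_le_one (min_le_left _ _)

lemma cutoff_eq_zero {E : Type*} [NormedAddCommGroup E] {R : ℝ} {z : E} (hz : R + 1 ≤ ‖z‖) :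
    cutoff R z = 0 :=
  max_eq_left ((min_le_right _ _).trans (by linarith))

lemma cutoff_eq_one {E : Type*} [NormedAddCommGroup E] {R : ℝ} {z : E} (hz : ‖z‖ ≤ R) :
    cutoff R z = 1 := by
  rw [cutoff, min_eq_left (by linarith), max_eq_right zero_le_one]

lemma exists_lipschitzWith_cutoff_mul {E : Type*} [NormedAddCommGroup E] [ProperSpace E]
    {f : E → ℝ} (hf : LocallyLipschitz f) (R : ℝ) :
    ∃ K, LipschitzWith K fun z => cutoff R z * f z := by
  obtain ⟨K, hK⟩ := (hf.locallyLipschitzOn (s := Metric.closedBall (0 : E) (R + 1))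
    ).exists_lipschitzOnWith_of_compact (isCompact_closedBall _ _)
  obtain ⟨M, hM⟩ := (isCompact_closedBall (0 : E) (R + 1)).exists_bound_of_continuousOn
    hf.continuous.continuousOn
  -- Only y has to lie in the ball: if x is outside, the factor `cutoff R x` kills the term
  -- containing f x - f y.
  have key : ∀ x y : E, ‖y‖ ≤ R + 1 →
      |cutoff R x * f x - cutoff R y * f y| ≤ (K + |M|) * dist x y := by
    intro x y hy
    have hyM : |f y| ≤ |M| := (hM y (by simpa using hy)).trans (le_abs_self M)
    have h1 : cutoff R x * |f x - f y| ≤ K * dist x y := by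
      rcases le_total (R + 1) ‖x‖ with hx | hx
      · rw [cutoff_eq_zero hx, zero_mul]; positivity
      · refine (mul_le_of_le_one_left (abs_nonneg _) (cutoff_le_one R x)).trans ?_
        exact hK.dist_le_mul x (by simpa using hx) y (by simpa using hy)
    have h2 : |cutoff R x - cutoff R y| ≤ dist x y := by
      simpa [Real.dist_eq] using (lipschitzWith_cutoff R).dist_le_mul x y
    calc |cutoff R x * f x - cutoff R y * f y|
        = |cutoff R x * (f x - f y) + (cutoff R x - cutoff R y) * f y| := by ring_nf
      _ ≤ cutoff R x * |f x - f y| + |cutoff R x - cutoff R y| * |f y| := by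
          refine (abs_add_le _ _).trans_eq ?_
          rw [abs_mul, abs_mul, abs_of_nonneg (cutoff_nonneg R x)]
      _ ≤ K * dist x y + dist x y * |M| := by gcongr
      _ = _ := by ring
  refine ⟨K + ‖M‖₊, LipschitzWith.of_dist_le_mul fun x y => ?_⟩
  rw [Real.dist_eq]
  simp only [NNReal.coe_add, coe_nnnorm, Real.norm_eq_abs]
  rcases le_total ‖y‖ (R + 1) with hy | hy
  · exact key x y hy
  rcases le_total ‖x‖ (R + 1) with hx | hx
  · rw [abs_sub_comm, dist_comm]
    exact key y x hx
  · rw [cutoff_eq_zero hx, cutoff_eq_zero hy]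
    simp only [zero_mul, sub_self, abs_zero]
    positivity

/-- Evaluate the derivative on the gradient vector itself, then divide by its norm. -/
lemma sum_sq_pderiv (h : EuclideanSpace ℝ ι → ℝ) (z : EuclideanSpace ℝ ι) :
    ∑ j, pderiv j h z ^ 2 ≤ ‖fderiv ℝ h z‖ ^ 2 := by
  set g : EuclideanSpace ℝ ι := WithLp.toLp 2 fun j => pderiv j h z
  have hg : ‖g‖ ^ 2 = ∑ j, pderiv j h z ^ 2 := by
    rw [EuclideanSpace.real_norm_sq_eq]
  have h1 : fderiv ℝ h z g = ‖g‖ ^ 2 := by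
    have : g = ∑ j, g j • EuclideanSpace.single j (1 : ℝ) := by
      ext i; simp [Pi.single_apply]
    conv_lhs => rw [this, map_sum]
    rw [hg]
    refine Finset.sum_congr rfl fun j _ => ?_
    rw [map_smul, smul_eq_mul, pow_two]
    rfl
  rw [← hg]
  have h2 := (fderiv ℝ h z).le_opNorm g
  rw [h1, Real.norm_of_nonneg (by positivity)] at h2
  rcases eq_or_ne ‖g‖ 0 with h0 | h0
  · rw [h0]; simp
  · have : 0 < ‖g‖ := lt_of_le_of_ne (norm_nonneg _) h0.symm
    have h3 : ‖g‖ ≤ ‖fderiv ℝ h z‖ := by nlinarith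
    gcongr

/-- The second order Stein inequality for locally Lipschitz vector fields. -/
theorem lintegral_sq_gaussianDiv_le {f : ι → EuclideanSpace ℝ ι → ℝ}
    (hf : ∀ i, LocallyLipschitz (f i)) :
    ∫⁻ z, ENNReal.ofReal (gaussianDiv f z ^ 2) ∂(stdGaussian (EuclideanSpace ℝ ι))
      ≤ ∫⁻ z, ENNReal.ofReal (3 * ∑ i, f i z ^ 2 + 2 * ∑ i, ∑ j, pderiv j (f i) z ^ 2)
          ∂(stdGaussian (EuclideanSpace ℝ ι)) := by
  have hL : ∀ k : ℕ, ∃ K, ∀ i, LipschitzWith K fun z => cutoff (k : ℝ) z * f i z := by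
    intro k
    choose K hK using fun i => exists_lipschitzWith_cutoff_mul (hf i) (k : ℝ)
    exact ⟨∑ i, K i, fun i => (hK i).weaken (Finset.single_le_sum (fun _ _ => zero_le)
      (Finset.mem_univ i))⟩
  have hs : ∀ (k : ℕ) i, HasCompactSupport fun z => cutoff (k : ℝ) z * f i z := fun k i =>
    HasCompactSupport.intro (isCompact_closedBall (0 : EuclideanSpace ℝ ι) (k + 1)) fun z hz => by
      rw [cutoff_eq_zero, zero_mul]
      simp only [Metric.mem_closedBall, dist_zero_right, not_le] at hz
      exact hz.le
  -- Near a given point the truncated fields are eventually equal to f, and the bound does not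
  -- depend on k, so no growth condition on f is required.
  refine lintegral_le_of_ae_tendsto
    (u := fun (k : ℕ) z => gaussianDiv (fun i z => cutoff (k : ℝ) z * f i z) z ^ 2)
    (fun k => (measurable_gaussianDiv fun i =>
      ((lipschitzWith_cutoff _).continuous.mul (hf i).continuous).measurable).pow_const 2) ?_
    tendsto_const_nhds ?_
  · refine Eventually.of_forall fun z => tendsto_const_nhds.congr' ?_
    filter_upwards [(tendsto_natCast_atTop_atTop (R := ℝ)).eventually_gt_atTop ‖z‖] with k hk
    have : ∀ i, (fun z => cutoff (k : ℝ) z * f i z) =ᶠ[𝓝 z] f i := by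
      intro i
      filter_upwards [Metric.isOpen_ball.mem_nhds
        (show z ∈ Metric.ball (0 : EuclideanSpace ℝ ι) k by simpa using hk)] with x hx
      rw [cutoff_eq_one (by simpa using (Metric.mem_ball.1 hx).le), one_mul]
    simp only [gaussianDiv, pderiv]
    congr 1
    refine Finset.sum_congr rfl fun i _ => ?_
    rw [(this i).fderiv_eq, (this i).eq_of_nhds]
  · intro k
    obtain ⟨K, hK⟩ := hL k
    refine (lintegral_sq_gaussianDiv_le_of_lipschitzWith hK (hs k)).trans ?_
    have hdf : ∀ᵐ z ∂(stdGaussian (EuclideanSpace ℝ ι)), ∀ i, DifferentiableAt ℝ (f i) z :=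
      stdGaussian_absolutelyContinuous.ae_le
        (ae_all_iff.2 fun i => ae_differentiableAt_of_locallyLipschitz (hf i))
    have hdc : ∀ᵐ z ∂(stdGaussian (EuclideanSpace ℝ ι)),
        DifferentiableAt ℝ (cutoff (k : ℝ) : EuclideanSpace ℝ ι → ℝ) z :=
      stdGaussian_absolutelyContinuous.ae_le (lipschitzWith_cutoff _).ae_differentiableAt
    refine lintegral_mono_ae ?_
    filter_upwards [hdf, hdc] with z h1 h2
    refine ENNReal.ofReal_le_ofReal ?_
    set c := cutoff (k : ℝ) z
    have hc0 : c ^ 2 ≤ 1 := pow_le_one₀ (cutoff_nonneg _ _) (cutoff_le_one _ _)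
    set d : ι → ℝ := fun j => pderiv j (cutoff (k : ℝ)) z
    have hd : ∑ j, d j ^ 2 ≤ 1 := by
      refine (sum_sq_pderiv _ z).trans ?_
      have := norm_fderiv_le_of_lipschitz ℝ (x₀ := z)
        (lipschitzWith_cutoff (E := EuclideanSpace ℝ ι) (k : ℝ))
      exact pow_le_one₀ (norm_nonneg _) (by simpa using this)
    have e1 : ∑ i, (c * f i z) ^ 2 ≤ ∑ i, f i z ^ 2 := by
      refine Finset.sum_le_sum fun i _ => ?_
      rw [mul_pow]
      exact mul_le_of_le_one_left (sq_nonneg _) hc0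
    -- The product rule with (a + b)² ≤ 2a² + 2b² and a cutoff of slope at most 1. The extra 2f²,
    -- added to the f² already present, is the origin of the constant 3.
    have e2 : ∀ i, ∑ j, pderiv j (fun z => cutoff (k : ℝ) z * f i z) z ^ 2
        ≤ 2 * ∑ j, pderiv j (f i) z ^ 2 + 2 * f i z ^ 2 := by
      intro i
      have : ∀ j, pderiv j (fun z => cutoff (k : ℝ) z * f i z) z ^ 2
          ≤ 2 * pderiv j (f i) z ^ 2 + 2 * f i z ^ 2 * d j ^ 2 := by
        intro j
        rw [pderiv_mul h2 (h1 i)]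
        change (c * pderiv j (f i) z + f i z * d j) ^ 2 ≤ _
        nlinarith [sq_nonneg (c * pderiv j (f i) z - f i z * d j),
          mul_le_of_le_one_left (sq_nonneg (pderiv j (f i) z)) hc0]
      refine (Finset.sum_le_sum fun j _ => this j).trans ?_
      rw [Finset.sum_add_distrib, ← Finset.mul_sum, ← Finset.mul_sum]
      exact add_le_add_right (mul_le_of_le_one_right (by positivity) hd) _
    calc ∑ i, (c * f i z) ^ 2 + ∑ i, ∑ j, pderiv j (fun z => cutoff (k : ℝ) z * f i z) z ^ 2
        ≤ ∑ i, f i z ^ 2 + ∑ i, (2 * ∑ j, pderiv j (f i) z ^ 2 + 2 * f i z ^ 2) :=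
          add_le_add e1 (Finset.sum_le_sum fun i _ => e2 i)
      _ = _ := by
          rw [Finset.sum_add_distrib, ← Finset.mul_sum, ← Finset.mul_sum]
          ring

end SteinLipschitz

/-! ### The square root of the covariance matrix -/

section Sqrt

variable {p : ℕ} {S : Matrix (Fin p) (Fin p) ℝ}

lemma act_mul (M N : Matrix (Fin p) (Fin p) ℝ) (v : EuclideanSpace ℝ (Fin p)) :
    act (M * N) v = act M (act N v) := by
  simp [act, map_mul]

/-- Holds for every S because `CFC.sqrt S` is always nonnegative, hence self-adjoint. -/
lemma inner_act_sqrt (S : Matrix (Fin p) (Fin p) ℝ) (u v : EuclideanSpace ℝ (Fin p)) :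
    inner ℝ (act (CFC.sqrt S) u) v = inner ℝ u (act (CFC.sqrt S) v) := by
  have h : IsSelfAdjoint (act (CFC.sqrt S)) := (CFC.sqrt_nonneg S).isSelfAdjoint.map _
  rw [← ContinuousLinearMap.adjoint_inner_right, h.adjoint_eq]

lemma norm_sq_act_sqrt (hS : S.PosDef) (v : EuclideanSpace ℝ (Fin p)) :
    ‖act (CFC.sqrt S) v‖ ^ 2 = v.ofLp ⬝ᵥ S *ᵥ v.ofLp := by
  rw [← real_inner_self_eq_norm_sq, inner_act_sqrt, ← act_mul,
    CFC.sqrt_mul_sqrt_self _ hS.posSemidef.nonneg, inner_toEuclideanCLM]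

lemma isUnit_sqrt (hS : S.PosDef) : IsUnit (CFC.sqrt S).det := by
  have h := congrArg Matrix.det (CFC.sqrt_mul_sqrt_self S hS.posSemidef.nonneg)
  rw [Matrix.det_mul] at h
  rw [isUnit_iff_ne_zero]
  intro h0
  rw [h0, mul_zero] at h
  exact hS.det_pos.ne h

lemma act_inv_sqrt_act (hS : S.PosDef) (v : EuclideanSpace ℝ (Fin p)) :
    act (CFC.sqrt S)⁻¹ (act (CFC.sqrt S) v) = v := by
  rw [← act_mul, Matrix.nonsing_inv_mul _ (isUnit_sqrt hS)]
  simp [act]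

lemma act_sqrt_act_inv (hS : S.PosDef) (v : EuclideanSpace ℝ (Fin p)) :
    act (CFC.sqrt S) (act (CFC.sqrt S)⁻¹ v) = v := by
  rw [← act_mul, Matrix.mul_nonsing_inv _ (isUnit_sqrt hS)]
  simp [act]

end Sqrt

/-! ### Existence and stability of the estimator -/

section Estimator

variable {n p : ℕ} {S : Matrix (Fin p) (Fin p) ℝ} {μ : ℝ} {g : EuclideanSpace ℝ (Fin p) → ℝ}

/-- Along a segment a squared Euclidean norm equals its chord minus t(1 - t) times the squared
length; adding this back to the convex part of g produces the quadratic gain. -/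
lemma StronglyConvexWrt.le_combo (hS : S.PosDef) (hg : StronglyConvexWrt S μ g)
    (b b' : EuclideanSpace ℝ (Fin p)) {t : ℝ} (h0 : 0 ≤ t) (h1 : t ≤ 1) :
    g (b + t • (b' - b)) ≤ (1 - t) * g b + t * g b'
      - t * (1 - t) * (μ / 2 * ‖act (CFC.sqrt S) (b' - b)‖ ^ 2) := by
  have h := (show ConvexOn ℝ Set.univ _ from hg).2 (Set.mem_univ b) (Set.mem_univ b')
    (show 0 ≤ 1 - t by linarith) h0 (by ring)
  simp only [← norm_sq_act_sqrt hS, smul_eq_mul] at h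
  have e : (1 - t) • b + t • b' = b + t • (b' - b) := by module
  rw [e] at h
  have key : ‖act (CFC.sqrt S) (b + t • (b' - b))‖ ^ 2
      = (1 - t) * ‖act (CFC.sqrt S) b‖ ^ 2 + t * ‖act (CFC.sqrt S) b'‖ ^ 2
        - t * (1 - t) * ‖act (CFC.sqrt S) (b' - b)‖ ^ 2 := by
    simp only [map_add, map_smul, map_sub, ← real_inner_self_eq_norm_sq, inner_add_left,
      inner_add_right, inner_sub_left, inner_sub_right, real_inner_smul_left,
      real_inner_smul_right]
    rw [real_inner_comm (act (CFC.sqrt S) b') (act (CFC.sqrt S) b)]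
    ring
  rw [key] at h
  linarith

lemma StronglyConvexWrt.continuous (hg : StronglyConvexWrt S μ g) : Continuous g := by
  have h : Continuous fun b => g b - μ / 2 * (b.ofLp ⬝ᵥ S *ᵥ b.ofLp) :=
    (ConvexOn.locallyLipschitz hg).continuous
  have h2 : Continuous fun b : EuclideanSpace ℝ (Fin p) => μ / 2 * (b.ofLp ⬝ᵥ S *ᵥ b.ofLp) := by
    simp only [dotProduct, mulVec]
    fun_prop
  exact (h.add h2).congr fun b => sub_add_cancel _ _

/-- The quadratic part of the objective. -/
noncomputable def quadPart (S : Matrix (Fin p) (Fin p) ℝ) (μ : ℝ) (X : Design n p)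
    (d : EuclideanSpace ℝ (Fin p)) : ℝ :=
  μ / 2 * ‖act (CFC.sqrt S) d‖ ^ 2 + 1 / (n : ℝ) * ∑ i, inner ℝ (X i) d ^ 2 / 2

lemma objective_combo_le (hS : S.PosDef) (hg : StronglyConvexWrt S μ g) (y : Resp n)
    (X : Design n p) (b b' : EuclideanSpace ℝ (Fin p)) {t : ℝ} (h0 : 0 ≤ t) (h1 : t ≤ 1) :
    objective squareLoss g y X (b + t • (b' - b)) ≤ (1 - t) * objective squareLoss g y X b
      + t * objective squareLoss g y X b' - t * (1 - t) * quadPart S μ X (b' - b) := by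
  have h := hg.le_combo hS b b' h0 h1
  have key : ∑ i, squareLoss (y i - inner ℝ (X i) (b + t • (b' - b)))
      = (1 - t) * ∑ i, squareLoss (y i - inner ℝ (X i) b)
        + t * ∑ i, squareLoss (y i - inner ℝ (X i) b')
        - t * (1 - t) * ∑ i, inner ℝ (X i) (b' - b) ^ 2 / 2 := by
    simp only [Finset.mul_sum, ← Finset.sum_add_distrib, ← Finset.sum_sub_distrib]
    refine Finset.sum_congr rfl fun i _ => ?_
    simp only [squareLoss, inner_add_right, inner_sub_right, real_inner_smul_right]
    ring
  unfold objective quadPart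
  rw [key]
  linarith

/-- Compare the minimizer b with b + t(b' - b), divide by t and let t tend to 0. -/
lemma objective_add_quadPart_le (hS : S.PosDef) (hg : StronglyConvexWrt S μ g) (y : Resp n)
    (X : Design n p) {b : EuclideanSpace ℝ (Fin p)}
    (hb : ∀ b', objective squareLoss g y X b ≤ objective squareLoss g y X b')
    (b' : EuclideanSpace ℝ (Fin p)) :
    objective squareLoss g y X b + quadPart S μ X (b' - b) ≤ objective squareLoss g y X b' := by
  have h : ∀ t : ℝ, 0 < t → t ≤ 1 → objective squareLoss g y X b
      + (1 - t) * quadPart S μ X (b' - b) ≤ objective squareLoss g y X b' := by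
    intro t h0 h1
    have h2 := (hb _).trans (objective_combo_le hS hg y X b b' h0.le h1)
    have h3 : t * (objective squareLoss g y X b + (1 - t) * quadPart S μ X (b' - b))
        ≤ t * objective squareLoss g y X b' := by linarith
    exact le_of_mul_le_mul_left h3 h0
  have hlim : Tendsto (fun t : ℝ => objective squareLoss g y X b
      + (1 - t) * quadPart S μ X (b' - b)) (𝓝[>] 0)
      (𝓝 (objective squareLoss g y X b + (1 - 0) * quadPart S μ X (b' - b))) := by
    refine Tendsto.mono_left ?_ nhdsWithin_le_nhds
    exact Continuous.tendsto (by fun_prop) 0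
  have := le_of_tendsto hlim (by
    filter_upwards [Ioc_mem_nhdsGT (zero_lt_one (α := ℝ))] with t ht
    exact h t ht.1 ht.2)
  simpa using this

/-- The objective is bounded by some m on the unit ball. If a far point b were below the value at 0,
the quadratic gain of the segment from 0 to b would force the value at b/‖b‖ below -m. So the search
reduces to a ball. -/
lemma exists_forall_objective_le (hS : S.PosDef) (hμ : 0 < μ) (hg : StronglyConvexWrt S μ g)
    (y : Resp n) (X : Design n p) :
    ∃ b, ∀ b', objective squareLoss g y X b ≤ objective squareLoss g y X b' := by
  set L := objective squareLoss g y X with hLdef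
  have hgc := hg.continuous
  have hL : Continuous L := by
    change Continuous fun b => 1 / (n : ℝ) * ∑ i, (y i - inner ℝ (X i) b) ^ 2 / 2 + g b
    fun_prop
  obtain ⟨m, hm⟩ := (isCompact_closedBall (0 : EuclideanSpace ℝ (Fin p)) 1
    ).exists_bound_of_continuousOn hL.continuousOn
  set c : ℝ := ‖act (CFC.sqrt S)⁻¹‖ ^ 2
  have hRi : ∀ d : EuclideanSpace ℝ (Fin p), ‖d‖ ^ 2 ≤ c * ‖act (CFC.sqrt S) d‖ ^ 2 := by
    intro d
    have := (act (CFC.sqrt S)⁻¹).le_opNorm (act (CFC.sqrt S) d)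
    rw [act_inv_sqrt_act hS] at this
    calc ‖d‖ ^ 2 ≤ (‖act (CFC.sqrt S)⁻¹‖ * ‖act (CFC.sqrt S) d‖) ^ 2 := by gcongr
      _ = _ := by rw [mul_pow]
  have hm0 : |L 0| ≤ m := by simpa using hm 0 (by simp)
  -- Beyond radius T the gain (‖b‖ - 1)μ/2 exceeds 4mc, whereas a far point below the value at 0
  -- would cap it at 2mc.
  obtain ⟨T, hT1, hT⟩ : ∃ T : ℝ, 1 ≤ T ∧ 4 * m * c ≤ (T - 1) * (μ / 2) := by
    refine ⟨8 * m * c / μ + 1, ?_, ?_⟩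
    · have : 0 ≤ m := (abs_nonneg _).trans hm0
      have : 0 ≤ c := by positivity
      have : 0 ≤ 8 * m * c / μ := by positivity
      linarith
    · field_simp
      linarith
  have hfar : ∀ b, T < ‖b‖ → L 0 ≤ L b := by
    intro b hb
    have hb0 : 0 < ‖b‖ := by linarith
    have ht1 : ‖b‖⁻¹ ≤ 1 := inv_le_one_of_one_le₀ (hT1.trans hb.le)
    have h := objective_combo_le hS hg y X 0 b (t := ‖b‖⁻¹) (by positivity) ht1
    simp only [sub_zero, zero_add] at h
    rw [← hLdef] at h
    have h1 : |L (‖b‖⁻¹ • b)| ≤ m := by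
      refine hm _ ?_
      rw [mem_closedBall_zero_iff, norm_smul, norm_inv, norm_norm, inv_mul_cancel₀ hb0.ne']
    have h2 : μ / 2 * ‖act (CFC.sqrt S) b‖ ^ 2 ≤ quadPart S μ X b := by
      unfold quadPart
      have : 0 ≤ 1 / (n : ℝ) * ∑ i, inner ℝ (X i) b ^ 2 / 2 := by positivity
      linarith
    by_contra hlt
    push Not at hlt
    have hm' : 0 ≤ m := (abs_nonneg _).trans hm0
    have hq : ‖b‖⁻¹ * (1 - ‖b‖⁻¹) * (μ / 2 * ‖act (CFC.sqrt S) b‖ ^ 2)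
        ≤ ‖b‖⁻¹ * (1 - ‖b‖⁻¹) * quadPart S μ X b :=
      mul_le_mul_of_nonneg_left h2 (mul_nonneg (by positivity) (by linarith))
    have h3 : ‖b‖⁻¹ * (1 - ‖b‖⁻¹) * (μ / 2 * ‖act (CFC.sqrt S) b‖ ^ 2) < 2 * m := by
      have h4 : ‖b‖⁻¹ * L b ≤ ‖b‖⁻¹ * L 0 := by gcongr
      have h5 := abs_le.1 h1
      have h6 := abs_le.1 hm0
      have h7 : ‖b‖⁻¹ * L b < ‖b‖⁻¹ * L 0 := by gcongr
      linarith
    have h4 : ‖b‖⁻¹ * (1 - ‖b‖⁻¹) * (μ / 2 * ‖b‖ ^ 2) = (‖b‖ - 1) * (μ / 2) := by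
      field_simp
    have h5 : 0 ≤ ‖b‖⁻¹ * (1 - ‖b‖⁻¹) * (μ / 2) :=
      mul_nonneg (mul_nonneg (by positivity) (by linarith)) (by positivity)
    have h6 : (‖b‖ - 1) * (μ / 2) ≤ c * (2 * m) := by
      rw [← h4]
      calc ‖b‖⁻¹ * (1 - ‖b‖⁻¹) * (μ / 2 * ‖b‖ ^ 2)
          = ‖b‖⁻¹ * (1 - ‖b‖⁻¹) * (μ / 2) * ‖b‖ ^ 2 := by ring
        _ ≤ ‖b‖⁻¹ * (1 - ‖b‖⁻¹) * (μ / 2) * (c * ‖act (CFC.sqrt S) b‖ ^ 2) := by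
            gcongr
            exact hRi b
        _ = c * (‖b‖⁻¹ * (1 - ‖b‖⁻¹) * (μ / 2 * ‖act (CFC.sqrt S) b‖ ^ 2)) := by ring
        _ ≤ c * (2 * m) := by gcongr
    have h7 : (T - 1) * (μ / 2) < (‖b‖ - 1) * (μ / 2) := by gcongr
    have h8 : 0 ≤ m * c := by positivity
    nlinarith
  refine hL.exists_forall_le' 0 ?_
  rw [Filter.eventually_iff_exists_mem]
  refine ⟨(Metric.closedBall 0 T)ᶜ, (isCompact_closedBall _ _).compl_mem_cocompact, fun b hb => ?_⟩
  exact hfar b (by simpa using hb)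

/-- The estimator as a function of the data `(y, X)`. -/
noncomputable abbrev estimator (g : EuclideanSpace ℝ (Fin p) → ℝ) (z : Resp n × Design n p) :
    EuclideanSpace ℝ (Fin p) :=
  mEstimator squareLoss g z.1 z.2

lemma objective_estimator_le (hS : S.PosDef) (hμ : 0 < μ) (hg : StronglyConvexWrt S μ g)
    (z : Resp n × Design n p) (b : EuclideanSpace ℝ (Fin p)) :
    objective squareLoss g z.1 z.2 (estimator g z) ≤ objective squareLoss g z.1 z.2 b :=
  Classical.epsilon_spec (exists_forall_objective_le hS hμ hg z.1 z.2) b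

/-- The score `Xᵀ (y - X b)`. -/
noncomputable def score (z : Resp n × Design n p) (b : EuclideanSpace ℝ (Fin p)) :
    EuclideanSpace ℝ (Fin p) :=
  ∑ i, (z.1 i - inner ℝ (z.2 i) b) • z.2 i

/-- The basic stability inequality of the estimator. -/
lemma estimator_stability (hS : S.PosDef) (hμ : 0 < μ) (hg : StronglyConvexWrt S μ g)
    (z z' : Resp n × Design n p) :
    μ * ‖act (CFC.sqrt S) (estimator g z - estimator g z')‖ ^ 2
      + 1 / (n : ℝ) * ∑ i, inner ℝ (z'.2 i) (estimator g z - estimator g z') ^ 2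
      ≤ 1 / (n : ℝ) * inner ℝ (score z (estimator g z) - score z' (estimator g z))
          (estimator g z - estimator g z') := by
  set b := estimator g z
  set b' := estimator g z'
  have h1 := objective_add_quadPart_le hS hg z.1 z.2 (objective_estimator_le hS hμ hg z) b'
  have h2 := objective_add_quadPart_le hS hg z'.1 z'.2 (objective_estimator_le hS hμ hg z') b
  change objective squareLoss g z.1 z.2 b + _ ≤ _ at h1
  change objective squareLoss g z'.1 z'.2 b' + quadPart S μ z'.2 (b - b') ≤ _ at h2
  have hn : ‖act (CFC.sqrt S) (b' - b)‖ ^ 2 = ‖act (CFC.sqrt S) (b - b')‖ ^ 2 := by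
    rw [← norm_neg, ← map_neg, neg_sub]
  change objective squareLoss g z.1 z.2 b + quadPart S μ z.2 (b' - b) ≤ _ at h1
  unfold quadPart objective at h1 h2
  rw [hn] at h1
  -- The values of g cancel when `h1` and `h2` are added. What remains of the square losses is an
  -- exact identity in which both scores are taken at the same b, so only the change of data is
  -- seen.
  have key : ∑ i, squareLoss (z.1 i - inner ℝ (z.2 i) b')
        - ∑ i, squareLoss (z.1 i - inner ℝ (z.2 i) b)
        - ∑ i, inner ℝ (z.2 i) (b' - b) ^ 2 / 2
        + ∑ i, squareLoss (z'.1 i - inner ℝ (z'.2 i) b)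
        - ∑ i, squareLoss (z'.1 i - inner ℝ (z'.2 i) b')
        - ∑ i, inner ℝ (z'.2 i) (b - b') ^ 2 / 2
        + ∑ i, inner ℝ (z'.2 i) (b - b') ^ 2
      = inner ℝ (score z b - score z' b) (b - b') := by
    simp only [score, inner_sub_left, sum_inner, real_inner_smul_left,
      ← Finset.sum_add_distrib, ← Finset.sum_sub_distrib]
    refine Finset.sum_congr rfl fun i _ => ?_
    simp only [squareLoss, inner_sub_right]
    ring
  rw [← key]
  linarith

/-- Cauchy-Schwarz after writing ⟨v, d⟩ = ⟨S^{-1/2}v, S^{1/2}d⟩. The constant is the one that later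
bounds S^{1/2}AS^{1/2}. -/
lemma norm_act_sqrt_estimator_sub_le (hn : 0 < n) (hS : S.PosDef) (hμ : 0 < μ)
    (hg : StronglyConvexWrt S μ g) (z z' : Resp n × Design n p) :
    ‖act (CFC.sqrt S) (estimator g z - estimator g z')‖ ≤ ((n : ℝ) * μ)⁻¹ *
      ‖act (CFC.sqrt S)⁻¹ (score z (estimator g z) - score z' (estimator g z))‖ := by
  have hn' : (0 : ℝ) < n := by exact_mod_cast hn
  have h := estimator_stability hS hμ hg z z'
  set d := estimator g z - estimator g z'
  set v := score z (estimator g z) - score z' (estimator g z)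
  have h1 : inner ℝ v d ≤ ‖act (CFC.sqrt S)⁻¹ v‖ * ‖act (CFC.sqrt S) d‖ := by
    conv_lhs => rw [← act_sqrt_act_inv hS v, inner_act_sqrt]
    exact real_inner_le_norm _ _
  have h2 : 0 ≤ 1 / (n : ℝ) * ∑ i, inner ℝ (z'.2 i) d ^ 2 := by positivity
  have h3 : μ * ‖act (CFC.sqrt S) d‖ ^ 2
      ≤ 1 / (n : ℝ) * (‖act (CFC.sqrt S)⁻¹ v‖ * ‖act (CFC.sqrt S) d‖) := by
    have : 1 / (n : ℝ) * inner ℝ v d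
        ≤ 1 / (n : ℝ) * (‖act (CFC.sqrt S)⁻¹ v‖ * ‖act (CFC.sqrt S) d‖) := by gcongr
    linarith
  rcases (norm_nonneg (act (CFC.sqrt S) d)).eq_or_lt with h0 | h0
  · rw [← h0]; positivity
  · rw [inv_mul_eq_div, le_div_iff₀ (by positivity)]
    rw [one_div, inv_mul_eq_div, le_div_iff₀ hn'] at h3
    nlinarith

end Estimator

/-! ### Regularity of the estimator and the structure of its derivative -/

instance (n p : ℕ) : (volume : Measure (Resp n × Design n p)).IsAddHaarMeasure :=
  Measure.prod.instIsAddHaarMeasure volume volume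

section Derivative

variable {n p : ℕ} {S : Matrix (Fin p) (Fin p) ℝ} {μ : ℝ} {g : EuclideanSpace ℝ (Fin p) → ℝ}

lemma contDiff_score : ContDiff ℝ 1
    fun w : (Resp n × Design n p) × EuclideanSpace ℝ (Fin p) => score w.1 w.2 := by
  unfold score
  refine ContDiff.sum fun i _ => ?_
  have h1 : ContDiff ℝ 1 fun w : (Resp n × Design n p) × EuclideanSpace ℝ (Fin p) => w.1.1 i :=
    (EuclideanSpace.proj i : EuclideanSpace ℝ (Fin n) →L[ℝ] ℝ).contDiff.comp
      (contDiff_fst.comp contDiff_fst)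
  have h2 : ContDiff ℝ 1 fun w : (Resp n × Design n p) × EuclideanSpace ℝ (Fin p) => w.1.2 i :=
    (contDiff_apply ℝ (EuclideanSpace ℝ (Fin p)) i).comp (contDiff_snd.comp contDiff_fst)
  exact (h1.sub (h2.inner ℝ contDiff_snd)).smul h2

lemma norm_estimator_sub_le (hn : 0 < n) (hS : S.PosDef) (hμ : 0 < μ)
    (hg : StronglyConvexWrt S μ g) : ∃ C : NNReal, ∀ z z' : Resp n × Design n p,
      ‖estimator g z - estimator g z'‖
        ≤ C * ‖score z (estimator g z) - score z' (estimator g z)‖ := by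
  refine ⟨‖act (CFC.sqrt S)⁻¹‖₊ * (Real.toNNReal ((n : ℝ) * μ)⁻¹ * ‖act (CFC.sqrt S)⁻¹‖₊),
    fun z z' => ?_⟩
  have h := norm_act_sqrt_estimator_sub_le hn hS hμ hg z z'
  have h1 := (act (CFC.sqrt S)⁻¹).le_opNorm
    (act (CFC.sqrt S) (estimator g z - estimator g z'))
  have h2 := (act (CFC.sqrt S)⁻¹).le_opNorm
    (score z (estimator g z) - score z' (estimator g z))
  rw [act_inv_sqrt_act hS] at h1
  have hpos : (0 : ℝ) ≤ ((n : ℝ) * μ)⁻¹ := by positivity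
  simp only [NNReal.coe_mul, coe_nnnorm, Real.coe_toNNReal _ hpos]
  refine h1.trans ?_
  rw [mul_assoc, mul_assoc]
  refine mul_le_mul_of_nonneg_left (h.trans ?_) (norm_nonneg _)
  exact mul_le_mul_of_nonneg_left h2 hpos

lemma continuous_estimator (hn : 0 < n) (hS : S.PosDef) (hμ : 0 < μ)
    (hg : StronglyConvexWrt S μ g) :
    Continuous (estimator g : Resp n × Design n p → EuclideanSpace ℝ (Fin p)) := by
  obtain ⟨C, hC⟩ := norm_estimator_sub_le (n := n) hn hS hμ hg
  rw [continuous_iff_continuousAt]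
  intro z
  rw [ContinuousAt, tendsto_iff_norm_sub_tendsto_zero]
  have hs : Continuous fun z' : Resp n × Design n p =>
      C * ‖score z (estimator g z) - score z' (estimator g z)‖ := by
    have : Continuous fun z' : Resp n × Design n p => score z' (estimator g z) :=
      contDiff_score.continuous.comp (by fun_prop : Continuous fun z' => (z', estimator g z))
    fun_prop
  refine squeeze_zero (fun _ => norm_nonneg _) (fun z' => ?_) (hs.tendsto' z 0 (by simp))
  rw [norm_sub_rev]
  exact hC z z'

/-- The score is smooth, hence Lipschitz near (z, β̂(z)). Continuity of the estimator keeps nearby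
pairs in that neighbourhood, so stability transfers the Lipschitz bound to β̂. -/
lemma locallyLipschitz_estimator (hn : 0 < n) (hS : S.PosDef) (hμ : 0 < μ)
    (hg : StronglyConvexWrt S μ g) :
    LocallyLipschitz (estimator g : Resp n × Design n p → EuclideanSpace ℝ (Fin p)) := by
  obtain ⟨C, hC⟩ := norm_estimator_sub_le (n := n) hn hS hμ hg
  have hcont := continuous_estimator (n := n) hn hS hμ hg
  intro z
  obtain ⟨K, W, hW, hK⟩ := contDiff_score.locallyLipschitz (z, estimator g z)
  rw [nhds_prod_eq, Filter.mem_prod_iff] at hW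
  obtain ⟨U, hU, V, hV, hUV⟩ := hW
  refine ⟨C * K, U ∩ estimator g ⁻¹' V, inter_mem hU (hcont.continuousAt hV), ?_⟩
  refine LipschitzOnWith.of_dist_le_mul fun z₁ h₁ z₂ h₂ => ?_
  have h := hK.dist_le_mul (z₁, estimator g z₁) (hUV ⟨h₁.1, h₁.2⟩)
    (z₂, estimator g z₁) (hUV ⟨h₂.1, h₁.2⟩)
  rw [dist_eq_norm]
  refine (hC z₁ z₂).trans ?_
  rw [NNReal.coe_mul, mul_assoc]
  refine mul_le_mul_of_nonneg_left ?_ C.coe_nonneg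
  rw [← dist_eq_norm]
  refine h.trans_eq ?_
  congr 1
  simp [Prod.dist_eq]

/-- The derivative of the score at `(z, b)` in the direction `d` of the data. -/
noncomputable def scoreDeriv (z : Resp n × Design n p) (b : EuclideanSpace ℝ (Fin p))
    (d : Resp n × Design n p) : EuclideanSpace ℝ (Fin p) :=
  ∑ i, ((z.1 i - inner ℝ (z.2 i) b) • d.2 i + (d.1 i - inner ℝ (d.2 i) b) • z.2 i)

lemma fderiv_score_inl (z : Resp n × Design n p) (b : EuclideanSpace ℝ (Fin p))
    (d : Resp n × Design n p) :
    fderiv ℝ (fun w : (Resp n × Design n p) × EuclideanSpace ℝ (Fin p) => score w.1 w.2) (z, b)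
      (d, 0) = scoreDeriv z b d := by
  have h1 : HasDerivAt (fun t : ℝ => score (z + t • d) b) (scoreDeriv z b d) 0 := by
    unfold score scoreDeriv
    refine HasDerivAt.fun_sum fun i _ => ?_
    have ha : HasDerivAt (fun t : ℝ => (z + t • d).1 i - inner ℝ ((z + t • d).2 i) b)
        (d.1 i - inner ℝ (d.2 i) b) 0 := by
      have e : (fun t : ℝ => (z + t • d).1 i - inner ℝ ((z + t • d).2 i) b)
          = fun t : ℝ => (z.1 i - inner ℝ (z.2 i) b) + t * (d.1 i - inner ℝ (d.2 i) b) := by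
        funext t
        simp [inner_add_left, real_inner_smul_left]
        ring
      rw [e]
      simpa using ((hasDerivAt_id (0 : ℝ)).mul_const (d.1 i - inner ℝ (d.2 i) b)).const_add
        (z.1 i - inner ℝ (z.2 i) b)
    have hb : HasDerivAt (fun t : ℝ => (z + t • d).2 i) (d.2 i) 0 := by
      simpa using ((hasDerivAt_id (0 : ℝ)).smul_const (d.2 i)).const_add (z.2 i)
    simpa using ha.fun_smul hb
  have h2 : HasDerivAt (fun t : ℝ => ((z + t • d, b) :
      (Resp n × Design n p) × EuclideanSpace ℝ (Fin p))) (d, 0) 0 := by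
    refine HasDerivAt.prodMk ?_ (hasDerivAt_const _ _)
    simpa using ((hasDerivAt_id (0 : ℝ)).smul_const d).const_add z
  have h3 := ((contDiff_score (n := n) (p := p)).differentiable one_ne_zero
    (z, b)).hasFDerivAt
  have h4 := h3.comp_hasDerivAt_of_eq (0 : ℝ) h2 (by simp)
  exact h4.unique h1

lemma norm_le_norm_of_hasDerivAt {E F : Type*} [NormedAddCommGroup E] [NormedSpace ℝ E]
    [NormedAddCommGroup F] [NormedSpace ℝ F] {u : ℝ → E} {v : ℝ → F} {u' : E} {v' : F}
    (hu : HasDerivAt u u' 0) (hv : HasDerivAt v v' 0) (hu0 : u 0 = 0) (hv0 : v 0 = 0)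
    (huv : ∀ t, ‖u t‖ ≤ ‖v t‖) : ‖u'‖ ≤ ‖v'‖ := by
  refine le_of_tendsto_of_tendsto (hasDerivAt_iff_tendsto_slope.1 hu).norm
    (hasDerivAt_iff_tendsto_slope.1 hv).norm (Eventually.of_forall fun t => ?_)
  simp only [slope, vsub_eq_sub, hu0, hv0, sub_zero, norm_smul]
  exact mul_le_mul_of_nonneg_left (huv t) (norm_nonneg _)

/-- Differentiate the stability inequality along z + td and z + td'. Both values of Γ are taken at
the same moving point B(z + td), so the derivative in the second variable cancels and only the
derivative in the data remains. -/
lemma norm_fderiv_sub_le_of_stability {F E : Type*} [NormedAddCommGroup F] [NormedSpace ℝ F]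
    [NormedAddCommGroup E] [NormedSpace ℝ E] {B : F → E} {Γ : F × E → E} {R R' : E →L[ℝ] E}
    {c : ℝ} (hc : 0 ≤ c)
    (h : ∀ z z', ‖R (B z - B z')‖ ≤ c * ‖R' (Γ (z, B z) - Γ (z', B z))‖) {z : F}
    (hB : DifferentiableAt ℝ B z) (hΓ : DifferentiableAt ℝ Γ (z, B z)) (d d' : F) :
    ‖R (fderiv ℝ B z d - fderiv ℝ B z d')‖ ≤ c * ‖R' (fderiv ℝ Γ (z, B z) (d - d', 0))‖ := by
  have hline : ∀ d : F, HasDerivAt (fun t : ℝ => z + t • d) d 0 := fun d => by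
    simpa using ((hasDerivAt_id (0 : ℝ)).smul_const d).const_add z
  have hB' : ∀ d, HasDerivAt (fun t : ℝ => B (z + t • d)) (fderiv ℝ B z d) 0 := fun d =>
    hB.hasFDerivAt.hasLineDerivAt d
  have hΓ' : ∀ e, HasDerivAt (fun t : ℝ => Γ (z + t • e, B (z + t • d)))
      (fderiv ℝ Γ (z, B z) (e, fderiv ℝ B z d)) 0 := fun e =>
    hΓ.hasFDerivAt.comp_hasDerivAt_of_eq (0 : ℝ) ((hline e).prodMk (hB' d)) (by simp)
  have hu : HasDerivAt (fun t : ℝ => R (B (z + t • d) - B (z + t • d')))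
      (R (fderiv ℝ B z d - fderiv ℝ B z d')) 0 :=
    R.hasFDerivAt.comp_hasDerivAt (0 : ℝ) ((hB' d).fun_sub (hB' d'))
  have hv : HasDerivAt (fun t : ℝ => c • R' (Γ (z + t • d, B (z + t • d))
      - Γ (z + t • d', B (z + t • d)))) (c • R' (fderiv ℝ Γ (z, B z) (d, fderiv ℝ B z d)
        - fderiv ℝ Γ (z, B z) (d', fderiv ℝ B z d))) 0 :=
    (R'.hasFDerivAt.comp_hasDerivAt (0 : ℝ) ((hΓ' d).fun_sub (hΓ' d'))).fun_const_smul c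
  have := norm_le_norm_of_hasDerivAt hu hv (by simp) (by simp) fun t => by
    rw [norm_smul, Real.norm_of_nonneg hc]
    exact h _ _
  rwa [norm_smul, Real.norm_of_nonneg hc, ← map_sub (fderiv ℝ Γ (z, B z)), Prod.mk_sub_mk,
    sub_self] at this

lemma scoreDeriv_sub (z : Resp n × Design n p) (b : EuclideanSpace ℝ (Fin p))
    (d d' : Resp n × Design n p) :
    scoreDeriv z b (d - d') = scoreDeriv z b d - scoreDeriv z b d' := by
  simp only [scoreDeriv, ← Finset.sum_sub_distrib, Prod.fst_sub, Prod.snd_sub, Pi.sub_apply,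
    PiLp.sub_apply, inner_sub_left]
  refine Finset.sum_congr rfl fun i _ => ?_
  module

lemma norm_act_sqrt_fderiv_sub_le (hn : 0 < n) (hS : S.PosDef) (hμ : 0 < μ)
    (hg : StronglyConvexWrt S μ g) {z : Resp n × Design n p}
    (hz : DifferentiableAt ℝ (estimator g) z) (d d' : Resp n × Design n p) :
    ‖act (CFC.sqrt S) (fderiv ℝ (estimator g) z d - fderiv ℝ (estimator g) z d')‖
      ≤ ((n : ℝ) * μ)⁻¹ * ‖act (CFC.sqrt S)⁻¹
        (scoreDeriv z (estimator g z) d - scoreDeriv z (estimator g z) d')‖ := by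
  rw [← scoreDeriv_sub, ← fderiv_score_inl]
  exact norm_fderiv_sub_le_of_stability (B := estimator g)
    (Γ := fun w : (Resp n × Design n p) × EuclideanSpace ℝ (Fin p) => score w.1 w.2)
    (by positivity) (norm_act_sqrt_estimator_sub_le hn hS hμ hg) hz
    (contDiff_score.differentiable one_ne_zero _) d d'

lemma deriv_squareLoss (u : ℝ) : deriv squareLoss u = u := by
  have h : HasDerivAt squareLoss u u := by
    have := ((hasDerivAt_id u).pow 2).div_const 2
    simpa [squareLoss] using! this
  exact h.deriv

lemma deriv_deriv_squareLoss (u : ℝ) : deriv (deriv squareLoss) u = 1 := by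
  rw [show deriv squareLoss = fun u => u from funext deriv_squareLoss]
  simp

/-- The direction of the data in which the score moves in the direction `a`. -/
noncomputable def scoreLift (b : EuclideanSpace ℝ (Fin p))
    (s : Fin n → ℝ) : EuclideanSpace ℝ (Fin p) →ₗ[ℝ] Resp n × Design n p where
  toFun a := (WithLp.toLp 2 fun i => s i * inner ℝ a b, fun i => s i • a)
  map_add' a a' := by
    ext i
    · simp [inner_add_left, mul_add]
    · simp
  map_smul' c a := by
    ext i
    · simp [real_inner_smul_left]; ring
    · simp; ring

/-- Shifting yᵢ by sᵢ⟨a, b⟩ while row i moves by sᵢa leaves the residuals at b unchanged, so the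
score moves by (∑ rᵢsᵢ)a. -/
lemma scoreDeriv_scoreLift (z : Resp n × Design n p) (b a : EuclideanSpace ℝ (Fin p))
    {s : Fin n → ℝ} (hs : ∑ i, (z.1 i - inner ℝ (z.2 i) b) * s i = 1) :
    scoreDeriv z b (scoreLift b s a) = a := by
  simp only [scoreDeriv, scoreLift, LinearMap.coe_mk, AddHom.coe_mk, real_inner_smul_left,
    sub_self, zero_smul, add_zero, smul_smul]
  rw [← Finset.sum_smul, hs, one_smul]

/-- By infinitesimal stability, directions with equal `scoreDeriv` have equal images under the
derivative of β̂. A nonzero residual gives `scoreDeriv` a linear right inverse, through which A is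
defined. -/
lemma exists_isDerivMatrix (hn : 0 < n) (hS : S.PosDef) (hμ : 0 < μ)
    (hg : StronglyConvexWrt S μ g) {z : Resp n × Design n p}
    (hz : DifferentiableAt ℝ (estimator g) z)
    (hr : ∃ i, residual squareLoss g z.1 z.2 i ≠ 0) :
    ∃ A, IsDerivMatrix squareLoss g S μ z.1 z.2 A := by
  set b := estimator g z with hb
  set r : Fin n → ℝ := fun i => z.1 i - inner ℝ (z.2 i) b with hrdef
  have hr2 : 0 < ∑ i, r i * r i := by
    obtain ⟨i, hi⟩ := hr
    exact Finset.sum_pos' (fun i _ => mul_self_nonneg _)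
      ⟨i, Finset.mem_univ _, mul_self_pos.2 hi⟩
  -- Weights normalized so that ∑ rᵢsᵢ = 1.
  set s : Fin n → ℝ := fun i => r i / ∑ i, r i * r i
  have hs : ∑ i, (z.1 i - inner ℝ (z.2 i) b) * s i = 1 := by
    change ∑ i, r i * (r i / ∑ i, r i * r i) = 1
    simp_rw [← mul_div_assoc]
    rw [← Finset.sum_div, div_self hr2.ne']
  set A' : EuclideanSpace ℝ (Fin p) →L[ℝ] EuclideanSpace ℝ (Fin p) :=
    LinearMap.toContinuousLinearMap
      ((fderiv ℝ (estimator g) z).toLinearMap ∘ₗ scoreLift b s)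
  set A : Matrix (Fin p) (Fin p) ℝ := (Matrix.toEuclideanCLM (𝕜 := ℝ)).symm A'
  have hA : act A = A' := (Matrix.toEuclideanCLM (𝕜 := ℝ)).apply_symm_apply A'
  have hA' : ∀ a, act A a = fderiv ℝ (estimator g) z (scoreLift b s a) := fun a => by
    rw [hA]; rfl
  have hD : ∀ d, fderiv ℝ (estimator g) z d = act A (scoreDeriv z b d) := by
    intro d
    rw [hA']
    have h := norm_act_sqrt_fderiv_sub_le hn hS hμ hg hz d (scoreLift b s (scoreDeriv z b d))
    rw [← hb, scoreDeriv_scoreLift z b _ hs, sub_self, map_zero, norm_zero, mul_zero,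
      norm_le_zero_iff] at h
    have h2 := congrArg (act (CFC.sqrt S)⁻¹) h
    rw [act_inv_sqrt_act hS, map_zero] at h2
    exact sub_eq_zero.1 h2
  refine ⟨A, hz, ?_, fun i => ?_, fun i j => ?_⟩
  -- Stability between the lift of S^{1/2}c and the zero direction: S^{-1/2} cancels S^{1/2} on the
  -- right.
  · refine ContinuousLinearMap.opNorm_le_bound _ (by positivity) fun c => ?_
    have h := norm_act_sqrt_fderiv_sub_le hn hS hμ hg hz
      (scoreLift b s (act (CFC.sqrt S) c)) 0
    have h0 : scoreDeriv z (estimator g z) 0 = 0 := by simp [scoreDeriv]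
    rw [h0, ← hb, scoreDeriv_scoreLift z b _ hs, map_zero, sub_zero, sub_zero, ← hA',
      act_inv_sqrt_act hS] at h
    rwa [act_mul, act_mul]
  · rw [deriv_deriv_squareLoss, one_smul]
    refine (hD _).trans ?_
    congr 1
    simp only [scoreDeriv, Pi.zero_apply, smul_zero, inner_zero_left, sub_zero, zero_add]
    rw [Finset.sum_eq_single i]
    · simp
    · intro k _ hk; simp [hk]
    · simp
  · rw [deriv_deriv_squareLoss, deriv_squareLoss, one_mul]
    refine (hD _).trans ?_
    rw [← map_smul, ← map_smul, ← map_sub]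
    congr 1
    simp only [scoreDeriv]
    rw [Finset.sum_eq_single i]
    · simp only [Pi.single_eq_same, EuclideanSpace.inner_single_left, PiLp.zero_apply, zero_sub]
      simp [residual, sub_eq_add_neg, hb]
    · intro k _ hk; simp [hk]
    · simp

/-- Both scores entering the stability inequality for z and 0 vanish at β̂(z). -/
lemma estimator_eq_of_residual_eq_zero (hS : S.PosDef) (hμ : 0 < μ)
    (hg : StronglyConvexWrt S μ g) {z : Resp n × Design n p}
    (hr : ∀ i, residual squareLoss g z.1 z.2 i = 0) :
    estimator g z = estimator g (0 : Resp n × Design n p) := by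
  have h := estimator_stability hS hμ hg z 0
  have h1 : score z (estimator g z) = 0 := Finset.sum_eq_zero fun i _ => by
    change residual squareLoss g z.1 z.2 i • _ = _
    rw [hr i, zero_smul]
  have h2 : score (0 : Resp n × Design n p) (estimator g z) = 0 := by simp [score]
  rw [h1, h2, sub_zero, inner_zero_left, mul_zero] at h
  have h3 : 0 ≤ 1 / (n : ℝ) * ∑ i, inner ℝ ((0 : Resp n × Design n p).2 i)
    (estimator g z - estimator g (0 : Resp n × Design n p)) ^ 2 := by positivity
  have h4 : ‖act (CFC.sqrt S) (estimator g z - estimator g (0 : Resp n × Design n p))‖ ^ 2 = 0 := by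
    refine le_antisymm ?_ (by positivity)
    by_contra hne
    push Not at hne
    have := mul_pos hμ hne
    linarith
  rw [sq_eq_zero_iff, norm_eq_zero] at h4
  have h5 := congrArg (act (CFC.sqrt S)⁻¹) h4
  rw [act_inv_sqrt_act hS, map_zero] at h5
  exact sub_eq_zero.1 h5

/-- In the exceptional set the estimator equals its value b₀ at zero data, so the first residual
becomes a fixed nonzero linear functional of the data; its kernel is null. -/
lemma ae_exists_residual_ne_zero (hn : 0 < n) (hS : S.PosDef) (hμ : 0 < μ)
    (hg : StronglyConvexWrt S μ g) :
    ∀ᵐ z : Resp n × Design n p, ∃ i, residual squareLoss g z.1 z.2 i ≠ 0 := by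
  set b₀ := estimator g (0 : Resp n × Design n p)
  set i₀ : Fin n := ⟨0, hn⟩
  let ℓ : Resp n × Design n p →ₗ[ℝ] ℝ :=
    { toFun := fun z => z.1 i₀ - inner ℝ (z.2 i₀) b₀
      map_add' := fun z z' => by simp [inner_add_left]; ring
      map_smul' := fun c z => by simp [real_inner_smul_left]; ring }
  have hℓ : LinearMap.ker ℓ ≠ ⊤ := by
    intro h
    rw [LinearMap.ker_eq_top] at h
    have := congrArg (fun f => f ((EuclideanSpace.single i₀ (1 : ℝ), 0) : Resp n × Design n p)) h
    simp [ℓ] at this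
  have h0 := Measure.addHaar_submodule (volume : Measure (Resp n × Design n p)) _ hℓ
  refine measure_mono_null (fun z hz => ?_) h0
  simp only [Set.mem_compl_iff, Set.mem_ofPred_eq, not_exists, not_not] at hz
  change ℓ z = 0
  have := hz i₀
  unfold residual at this
  change z.1 i₀ - inner ℝ (z.2 i₀) (estimator g z) = 0 at this
  rwa [estimator_eq_of_residual_eq_zero hS hμ hg hz] at this

lemma ae_exists_isDerivMatrix (hn : 0 < n) (hS : S.PosDef) (hμ : 0 < μ)
    (hg : StronglyConvexWrt S μ g) :
    ∀ᵐ z : Resp n × Design n p, ∃ A, IsDerivMatrix squareLoss g S μ z.1 z.2 A := by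
  filter_upwards [ae_differentiableAt_of_locallyLipschitz
    (locallyLipschitz_estimator (n := n) hn hS hμ hg),
    ae_exists_residual_ne_zero hn hS hμ hg] with z h1 h2
  exact exists_isDerivMatrix hn hS hμ hg h1 h2

end Derivative

/-! ### A measurable version of the derivative matrix -/

section DerivMatrix

variable {n p : ℕ} {S : Matrix (Fin p) (Fin p) ℝ} {μ : ℝ} {g : EuclideanSpace ℝ (Fin p) → ℝ}

/-- The derivative matrix, written in terms of the partial derivatives of the estimator. -/
noncomputable def derivMatrix (g : EuclideanSpace ℝ (Fin p) → ℝ) (z : Resp n × Design n p) :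
    Matrix (Fin p) (Fin p) ℝ :=
  Matrix.of fun k j => ∑ i, residual squareLoss g z.1 z.2 i
      / (∑ l, residual squareLoss g z.1 z.2 l * residual squareLoss g z.1 z.2 l)
    * (fderiv ℝ (estimator g) z (0, Pi.single i (EuclideanSpace.single j 1)) k
      + estimator g z j * fderiv ℝ (estimator g) z (EuclideanSpace.single i 1, 0) k)

lemma act_single (A : Matrix (Fin p) (Fin p) ℝ) (k j : Fin p) :
    act A (EuclideanSpace.single j 1) k = A k j := by
  simp

/-- By (*), rᵢAeⱼ = ∂β̂/∂xᵢⱼ + β̂ⱼ ∂β̂/∂yᵢ; multiplying by rᵢ and summing over i recovers A. Thus an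
arbitrary choice of A, possibly not measurable, agrees almost everywhere with a measurable one. -/
lemma IsDerivMatrix.eq_derivMatrix {z : Resp n × Design n p} {A : Matrix (Fin p) (Fin p) ℝ}
    (hA : IsDerivMatrix squareLoss g S μ z.1 z.2 A)
    (hr : ∃ i, residual squareLoss g z.1 z.2 i ≠ 0) : A = derivMatrix g z := by
  obtain ⟨-, -, h1, h2⟩ := hA
  ext k j
  set r : Fin n → ℝ := fun i => residual squareLoss g z.1 z.2 i
  have hr2 : 0 < ∑ i, r i * r i := by
    obtain ⟨i, hi⟩ := hr
    exact Finset.sum_pos' (fun i _ => mul_self_nonneg _)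
      ⟨i, Finset.mem_univ _, mul_self_pos.2 hi⟩
  have key : ∀ i, r i / (∑ l, r l * r l)
      * (fderiv ℝ (estimator g) z (0, Pi.single i (EuclideanSpace.single j 1)) k
        + estimator g z j * fderiv ℝ (estimator g) z (EuclideanSpace.single i 1, 0) k)
      = r i * r i / (∑ l, r l * r l) * A k j := by
    intro i
    have e1 := congrArg (fun v : EuclideanSpace ℝ (Fin p) => v k) (h1 i)
    have e2 := congrArg (fun v : EuclideanSpace ℝ (Fin p) => v k) (h2 i j)
    simp only [deriv_deriv_squareLoss, deriv_squareLoss, PiLp.smul_apply, PiLp.sub_apply,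
      smul_eq_mul, one_mul, act_single] at e1 e2
    change fderiv ℝ (estimator g) z _ k = _ at e1
    change fderiv ℝ (estimator g) z _ k = r i * A k j - estimator g z j * _ at e2
    rw [e1, e2]
    ring
  change A k j = ∑ i : Fin n, _
  rw [Finset.sum_congr rfl fun i _ => key i, ← Finset.sum_mul, ← Finset.sum_div,
    div_self hr2.ne', one_mul]

lemma measurable_coord {α : Type*} [MeasurableSpace α] {m : ℕ} {f : α → EuclideanSpace ℝ (Fin m)}
    (hf : Measurable f) (k : Fin m) : Measurable fun x => f x k :=
  (by fun_prop : Measurable fun v : EuclideanSpace ℝ (Fin m) => v k).comp hf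

lemma measurable_residual (hg : Measurable (estimator g : Resp n × Design n p → _)) (i : Fin n) :
    Measurable fun z : Resp n × Design n p => residual squareLoss g z.1 z.2 i := by
  unfold residual
  refine (measurable_coord measurable_fst i).sub ?_
  have h : Measurable fun z : Resp n × Design n p => z.2 i := by fun_prop
  exact h.inner hg

lemma measurable_derivMatrix (hg : Measurable (estimator g : Resp n × Design n p → _))
    (k j : Fin p) : Measurable fun z : Resp n × Design n p => derivMatrix g z k j := by
  simp only [derivMatrix, Matrix.of_apply]
  refine Finset.measurable_sum _ fun i _ => ?_
  refine ((measurable_residual hg i).div (Finset.measurable_sum _ fun l _ =>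
    (measurable_residual hg l).mul (measurable_residual hg l))).mul ?_
  refine (measurable_coord (measurable_fderiv_apply_const ℝ _ _) k).add ?_
  exact (measurable_coord hg j).mul (measurable_coord (measurable_fderiv_apply_const ℝ _ _) k)

lemma ae_isDerivMatrix_derivMatrix (hn : 0 < n) (hS : S.PosDef) (hμ : 0 < μ)
    (hg : StronglyConvexWrt S μ g) :
    ∀ᵐ z : Resp n × Design n p, IsDerivMatrix squareLoss g S μ z.1 z.2 (derivMatrix g z) := by
  filter_upwards [ae_exists_isDerivMatrix (n := n) hn hS hμ hg,
    ae_exists_residual_ne_zero (n := n) hn hS hμ hg] with z ⟨A, hA⟩ hr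
  rwa [← hA.eq_derivMatrix hr]

end DerivMatrix

/-! ### Perturbation of a single row of the data -/

section Row

variable {n p : ℕ} {S : Matrix (Fin p) (Fin p) ℝ} {μ : ℝ} {g : EuclideanSpace ℝ (Fin p) → ℝ}
  {i₀ : Fin n} {βs : EuclideanSpace ℝ (Fin p)} {z₀ : Resp n × Design n p}

/-- The data whose only nonzero row is `(⟨x, β*⟩ + e, x)`, with index `i₀`. -/
noncomputable def rowData (i₀ : Fin n) (βs x : EuclideanSpace ℝ (Fin p)) (e : ℝ) :
    Resp n × Design n p :=
  (EuclideanSpace.single i₀ (inner ℝ x βs + e), Pi.single i₀ x)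

lemma residual_add_rowData (h1 : z₀.1 i₀ = 0) (h2 : z₀.2 i₀ = 0)
    (x : EuclideanSpace ℝ (Fin p)) (e : ℝ) :
    residual squareLoss g (z₀ + rowData i₀ βs x e).1 (z₀ + rowData i₀ βs x e).2 i₀
      = e - inner ℝ x (estimator g (z₀ + rowData i₀ βs x e) - βs) := by
  change (z₀ + rowData i₀ βs x e).1 i₀ - inner ℝ ((z₀ + rowData i₀ βs x e).2 i₀)
    (estimator g (z₀ + rowData i₀ βs x e)) = _
  generalize estimator g (z₀ + rowData i₀ βs x e) = b
  simp only [Prod.fst_add, Prod.snd_add, PiLp.add_apply, Pi.add_apply, h1, h2, rowData,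
    PiLp.single_apply, Pi.single_eq_same, inner_sub_right, if_true, zero_add]
  ring

lemma score_add_rowData_sub (h1 : z₀.1 i₀ = 0) (h2 : z₀.2 i₀ = 0)
    (x : EuclideanSpace ℝ (Fin p)) (e : ℝ) (b : EuclideanSpace ℝ (Fin p)) :
    score (z₀ + rowData i₀ βs x e) b - score z₀ b = (e - inner ℝ x (b - βs)) • x := by
  unfold score
  rw [← Finset.sum_sub_distrib, Finset.sum_eq_single i₀]
  · simp only [Prod.fst_add, Prod.snd_add, PiLp.add_apply, Pi.add_apply, h1, h2, rowData,
      PiLp.single_apply, Pi.single_eq_same, inner_sub_right, if_true, zero_add, smul_zero, sub_zero]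
    congr 1
    ring
  · intro i _ hi
    simp [rowData, hi]
  · simp

/-- Adding a row changes the score by rx, so the right side of stability is r(r₀ - r)/n. It is
nonnegative, hence r² ≤ r r₀. -/
lemma row_residual_sq_le (hS : S.PosDef) (hμ : 0 < μ) (hg : StronglyConvexWrt S μ g)
    (h1 : z₀.1 i₀ = 0) (h2 : z₀.2 i₀ = 0) (x : EuclideanSpace ℝ (Fin p)) (e : ℝ) :
    |e - inner ℝ x (estimator g (z₀ + rowData i₀ βs x e) - βs)|
      ≤ |e - inner ℝ x (estimator g z₀ - βs)| := by
  have hn : (0 : ℝ) < n := by exact_mod_cast i₀.pos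
  have h := estimator_stability hS hμ hg (z₀ + rowData i₀ βs x e) z₀
  rw [score_add_rowData_sub h1 h2, real_inner_smul_left] at h
  set b := estimator g (z₀ + rowData i₀ βs x e)
  set b₀ := estimator g z₀
  have h3 : 0 ≤ μ * ‖act (CFC.sqrt S) (b - b₀)‖ ^ 2
      + 1 / (n : ℝ) * ∑ i, inner ℝ (z₀.2 i) (b - b₀) ^ 2 := by positivity
  have h4 : 0 ≤ (e - inner ℝ x (b - βs)) * inner ℝ x (b - b₀) :=
    nonneg_of_mul_nonneg_right (h3.trans h) (by positivity)
  have h5 : inner ℝ x (b - b₀)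
      = (e - inner ℝ x (b₀ - βs)) - (e - inner ℝ x (b - βs)) := by
    simp only [inner_sub_right]; ring
  rw [h5] at h4
  set r := e - inner ℝ x (b - βs)
  set r₀ := e - inner ℝ x (b₀ - βs)
  have h6 : |r| * |r| ≤ |r| * |r₀| := by
    rw [← abs_mul, ← abs_mul, abs_of_nonneg (mul_self_nonneg r)]
    exact le_trans (by linarith) (le_abs_self _)
  rcases (abs_nonneg r).eq_or_lt with h0 | h0
  · rw [← h0]; positivity
  · exact le_of_mul_le_mul_left h6 h0

/-- The score changes by r S^{1/2}w, on which S^{-1/2} leaves r w; then |r| ≤ |r₀|, where r₀ only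
involves the leave-one-out estimator. -/
lemma row_norm_sub_le (hS : S.PosDef) (hμ : 0 < μ) (hg : StronglyConvexWrt S μ g)
    (h1 : z₀.1 i₀ = 0) (h2 : z₀.2 i₀ = 0) (w : EuclideanSpace ℝ (Fin p)) (e : ℝ) :
    ‖act (CFC.sqrt S) (estimator g (z₀ + rowData i₀ βs (act (CFC.sqrt S) w) e) - estimator g z₀)‖
      ≤ |e - inner ℝ (act (CFC.sqrt S) w) (estimator g z₀ - βs)| * (((n : ℝ) * μ)⁻¹ * ‖w‖) := by
  have h := norm_act_sqrt_estimator_sub_le i₀.pos hS hμ hg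
    (z₀ + rowData i₀ βs (act (CFC.sqrt S) w) e) z₀
  rw [score_add_rowData_sub h1 h2, map_smul, act_inv_sqrt_act hS, norm_smul,
    Real.norm_eq_abs] at h
  refine h.trans ?_
  have h3 := row_residual_sq_le hS hμ hg h1 h2 (act (CFC.sqrt S) w) e (βs := βs)
  rw [mul_left_comm]
  gcongr

lemma linearMap_apply_eq_sum {F : Type*} [AddCommGroup F] [Module ℝ F]
    (T : EuclideanSpace ℝ (Fin p) →ₗ[ℝ] F) (x : EuclideanSpace ℝ (Fin p)) :
    T x = ∑ j, x j • T (EuclideanSpace.single j 1) := by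
  have hx : x = ∑ j, x j • EuclideanSpace.single j (1 : ℝ) := by
    ext i; simp [Pi.single_apply]
  conv_lhs => rw [hx, map_sum]
  simp only [map_smul]

lemma fderiv_apply_row {z : Resp n × Design n p} {A : Matrix (Fin p) (Fin p) ℝ}
    (hA : IsDerivMatrix squareLoss g S μ z.1 z.2 A) (x : EuclideanSpace ℝ (Fin p)) :
    fderiv ℝ (estimator g) z (rowData i₀ βs x 0)
      = residual squareLoss g z.1 z.2 i₀ • act A x
        - inner ℝ x (estimator g z - βs) • act A (z.2 i₀) := by
  obtain ⟨-, -, h1, h2⟩ := hA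
  simp only [deriv_deriv_squareLoss, deriv_squareLoss, one_smul, one_mul] at h1 h2
  set D := fderiv ℝ (estimator g) z with hD
  set r := residual squareLoss g z.1 z.2 i₀
  have e1 : D (EuclideanSpace.single i₀ (inner ℝ x βs), 0) = inner ℝ x βs • act A (z.2 i₀) := by
    rw [← h1 i₀, hD, ← map_smul]
    congr 1
    ext i <;> simp
  have e2 : D (0, Pi.single i₀ x)
      = r • act A x - inner ℝ x (estimator g z) • act A (z.2 i₀) := by
    let Λ : EuclideanSpace ℝ (Fin p) →ₗ[ℝ] Resp n × Design n p :=
      LinearMap.inr ℝ _ _ ∘ₗ LinearMap.single ℝ (fun _ : Fin n => EuclideanSpace ℝ (Fin p)) i₀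
    change (D.toLinearMap ∘ₗ Λ) x = r • (act A).toLinearMap x - _
    have hin : inner ℝ x (estimator g z) = ∑ j, x j * estimator g z j := by
      simp [PiLp.inner_apply, mul_comm]
    rw [linearMap_apply_eq_sum, linearMap_apply_eq_sum (act A).toLinearMap, hin, Finset.sum_smul,
      Finset.smul_sum, ← Finset.sum_sub_distrib]
    refine Finset.sum_congr rfl fun j _ => ?_
    have := h2 i₀ j
    change (D.toLinearMap ∘ₗ Λ) (EuclideanSpace.single j 1)
      = r • (act A).toLinearMap (EuclideanSpace.single j 1) - estimator g z j • _ at this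
    rw [this]
    module
  have e3 : rowData i₀ βs x 0 = ((EuclideanSpace.single i₀ (inner ℝ x βs), 0) : Resp n × Design n p)
      + (0, Pi.single i₀ x) := by
    simp [rowData]
  rw [e3, map_add, e1, e2, inner_sub_right]
  module

/-- The vector field to which the Stein inequality is applied. -/
noncomputable def rowField (S : Matrix (Fin p) (Fin p) ℝ) (g : EuclideanSpace ℝ (Fin p) → ℝ)
    (i₀ : Fin n) (βs : EuclideanSpace ℝ (Fin p)) (z₀ : Resp n × Design n p) (e : ℝ)
    (i : Fin p) (w : EuclideanSpace ℝ (Fin p)) : ℝ :=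
  act (CFC.sqrt S) (estimator g z₀
    - estimator g (z₀ + rowData i₀ βs (act (CFC.sqrt S) w) e)) i

/-- The linear part of `rowData`. -/
noncomputable def rowLinear (i₀ : Fin n) (βs : EuclideanSpace ℝ (Fin p)) :
    EuclideanSpace ℝ (Fin p) →L[ℝ] Resp n × Design n p :=
  LinearMap.toContinuousLinearMap
    { toFun := fun x => rowData i₀ βs x 0
      map_add' := fun x y => by
        ext i
        · by_cases h : i = i₀ <;> simp [rowData, inner_add_left, h]
        · by_cases h : i = i₀
          · subst h; simp [rowData]
          · simp [rowData, h]
      map_smul' := fun c x => by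
        ext i
        · by_cases h : i = i₀ <;> simp [rowData, real_inner_smul_left, h]
        · by_cases h : i = i₀
          · subst h; simp [rowData]
          · simp [rowData, h] }

lemma rowData_eq (x : EuclideanSpace ℝ (Fin p)) (e : ℝ) :
    rowData i₀ βs x e = rowData i₀ βs 0 e + rowLinear i₀ βs x := by
  change _ = _ + rowData i₀ βs x 0
  ext i
  · by_cases h : i = i₀ <;> simp [rowData, h, add_comm]
  · by_cases h : i = i₀
    · subst h; simp [rowData]
    · simp [rowData, h]

lemma locallyLipschitz_rowField (hS : S.PosDef) (hμ : 0 < μ) (hg : StronglyConvexWrt S μ g)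
    (e : ℝ) (i : Fin p) : LocallyLipschitz (rowField S g i₀ βs z₀ e i) := by
  have h0 : ContDiff ℝ 1 fun w : EuclideanSpace ℝ (Fin p) =>
      z₀ + rowData i₀ βs (act (CFC.sqrt S) w) e := by
    simp_rw [fun w => rowData_eq (i₀ := i₀) (βs := βs) (act (CFC.sqrt S) w) e]
    exact contDiff_const.add (contDiff_const.add
      ((rowLinear i₀ βs).contDiff.comp (act (CFC.sqrt S)).contDiff))
  have h1 := (locallyLipschitz_estimator i₀.pos hS hμ hg).comp h0.locallyLipschitz
  have h2 : ContDiff ℝ 1 fun b : EuclideanSpace ℝ (Fin p) =>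
      (act (CFC.sqrt S) (estimator g z₀ - b)) i :=
    (EuclideanSpace.proj i : EuclideanSpace ℝ (Fin p) →L[ℝ] ℝ).contDiff.comp
      ((act (CFC.sqrt S)).contDiff.comp (contDiff_const.sub contDiff_id))
  exact h2.locallyLipschitz.comp h1

/-- Chain rule with (*). The Jacobian splits into a rank one matrix and -r S^{1/2}AS^{1/2}; the
second part produces tr[SA]. -/
lemma pderiv_rowField (h2 : z₀.2 i₀ = 0) {e : ℝ}
    {w : EuclideanSpace ℝ (Fin p)} {z : Resp n × Design n p}
    (hz : z = z₀ + rowData i₀ βs (act (CFC.sqrt S) w) e)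
    {A : Matrix (Fin p) (Fin p) ℝ} (hA : IsDerivMatrix squareLoss g S μ z.1 z.2 A) (i j : Fin p) :
    pderiv j (rowField S g i₀ βs z₀ e i) w
      = act (CFC.sqrt S) (estimator g z - βs) j * act (CFC.sqrt S * A * CFC.sqrt S) w i
        - residual squareLoss g z.1 z.2 i₀ * (CFC.sqrt S * A * CFC.sqrt S) i j := by
  have hB : HasFDerivAt (estimator g) (fderiv ℝ (estimator g) z) z := hA.1.hasFDerivAt
  have hrow : HasFDerivAt (fun w : EuclideanSpace ℝ (Fin p) =>
      z₀ + rowData i₀ βs (act (CFC.sqrt S) w) e)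
      ((rowLinear i₀ βs).comp (act (CFC.sqrt S))) w := by
    simp_rw [fun w => rowData_eq (i₀ := i₀) (βs := βs) (act (CFC.sqrt S) w) e]
    exact ((((rowLinear i₀ βs).comp (act (CFC.sqrt S))).hasFDerivAt).const_add _).const_add _
  have hc : HasFDerivAt (fun w : EuclideanSpace ℝ (Fin p) =>
      estimator g (z₀ + rowData i₀ βs (act (CFC.sqrt S) w) e))
      ((fderiv ℝ (estimator g) z).comp ((rowLinear i₀ βs).comp (act (CFC.sqrt S)))) w := by
    rw [hz] at hB ⊢
    exact hB.comp w hrow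
  have hf : HasFDerivAt (rowField S g i₀ βs z₀ e i)
      ((EuclideanSpace.proj i : EuclideanSpace ℝ (Fin p) →L[ℝ] ℝ).comp ((act (CFC.sqrt S)).comp
        (-((fderiv ℝ (estimator g) z).comp ((rowLinear i₀ βs).comp (act (CFC.sqrt S))))))) w :=
    (EuclideanSpace.proj i : EuclideanSpace ℝ (Fin p) →L[ℝ] ℝ).hasFDerivAt.comp w
      ((act (CFC.sqrt S)).hasFDerivAt.comp w (hc.const_sub (estimator g z₀)))
  have hx : z.2 i₀ = act (CFC.sqrt S) w := by
    rw [hz]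
    simp [rowData, h2]
  rw [pderiv, hf.fderiv]
  change act (CFC.sqrt S) (-(fderiv ℝ (estimator g) z
    (rowData i₀ βs (act (CFC.sqrt S) (EuclideanSpace.single j 1)) 0))) i = _
  rw [fderiv_apply_row hA, hx, inner_act_sqrt, EuclideanSpace.inner_single_left, neg_sub, map_sub,
    map_smul, map_smul, ← act_mul, ← act_mul, ← act_mul, ← act_mul, PiLp.sub_apply,
    PiLp.smul_apply, PiLp.smul_apply, act_single]
  simp

end Row

/-! ### Comparison of the normalized residual with its leave-one-out version -/

section Comparison

variable {n p : ℕ} {S : Matrix (Fin p) (Fin p) ℝ} {μ : ℝ} {g : EuclideanSpace ℝ (Fin p) → ℝ}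
  {i₀ : Fin n} {βs : EuclideanSpace ℝ (Fin p)} {z₀ : Resp n × Design n p}

lemma trace_sqrt_mul_mul_sqrt (hS : S.PosDef) (A : Matrix (Fin p) (Fin p) ℝ) :
    (CFC.sqrt S * A * CFC.sqrt S).trace = (S * A).trace := by
  rw [Matrix.trace_mul_comm, ← Matrix.mul_assoc, CFC.sqrt_mul_sqrt_self _ hS.posSemidef.nonneg]

/-- Here w·f = r - r₀, and -div f supplies r tr[SA] minus the inner product. This is where the
factor 1 + tr[SA] comes from. -/
lemma gaussianDiv_rowField (hS : S.PosDef) (h1 : z₀.1 i₀ = 0) (h2 : z₀.2 i₀ = 0) {e : ℝ}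
    {w : EuclideanSpace ℝ (Fin p)} {z : Resp n × Design n p}
    (hz : z = z₀ + rowData i₀ βs (act (CFC.sqrt S) w) e)
    {A : Matrix (Fin p) (Fin p) ℝ} (hA : IsDerivMatrix squareLoss g S μ z.1 z.2 A) :
    gaussianDiv (rowField S g i₀ βs z₀ e) w
      = (1 + (S * A).trace) * residual squareLoss g z.1 z.2 i₀
        - (e - inner ℝ (act (CFC.sqrt S) w) (estimator g z₀ - βs))
        - inner ℝ (act (CFC.sqrt S) (estimator g z - βs))
          (act (CFC.sqrt S * A * CFC.sqrt S) w) := by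
  have hr : residual squareLoss g z.1 z.2 i₀
      = e - inner ℝ (act (CFC.sqrt S) w) (estimator g z - βs) := by
    rw [hz]; exact residual_add_rowData h1 h2 _ _
  have e1 : ∑ i, w i * rowField S g i₀ βs z₀ e i w = residual squareLoss g z.1 z.2 i₀
      - (e - inner ℝ (act (CFC.sqrt S) w) (estimator g z₀ - βs)) := by
    have : ∑ i, w i * rowField S g i₀ βs z₀ e i w
        = inner ℝ w (act (CFC.sqrt S) (estimator g z₀ - estimator g z)) := by
      rw [hz]
      simp [PiLp.inner_apply, rowField, mul_comm]
    rw [this, ← inner_act_sqrt, hr]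
    simp only [inner_sub_right]
    ring
  have e2 : ∑ i, pderiv i (rowField S g i₀ βs z₀ e i) w
      = inner ℝ (act (CFC.sqrt S) (estimator g z - βs)) (act (CFC.sqrt S * A * CFC.sqrt S) w)
        - residual squareLoss g z.1 z.2 i₀ * (S * A).trace := by
    simp_rw [pderiv_rowField h2 hz hA]
    rw [Finset.sum_sub_distrib, ← Finset.mul_sum, ← trace_sqrt_mul_mul_sqrt hS]
    congr 1
    simp [PiLp.inner_apply, mul_comm]
  rw [gaussianDiv, Finset.sum_sub_distrib, e1, e2]
  ring

/-- Each of the p columns is the image of a unit vector. -/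
lemma sum_sq_entries_le (M : Matrix (Fin p) (Fin p) ℝ) :
    ∑ i, ∑ j, M i j ^ 2 ≤ p * ‖act M‖ ^ 2 := by
  rw [Finset.sum_comm]
  have : ∀ j, ∑ i, M i j ^ 2 ≤ ‖act M‖ ^ 2 := by
    intro j
    have h := (act M).le_opNorm (EuclideanSpace.single j 1)
    rw [PiLp.norm_single, norm_one, mul_one] at h
    calc ∑ i, M i j ^ 2 = ‖act M (EuclideanSpace.single j 1)‖ ^ 2 := by
          rw [EuclideanSpace.real_norm_sq_eq]
          simp only [act_single]
      _ ≤ _ := by gcongr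
  refine (Finset.sum_le_sum fun j _ => this j).trans ?_
  simp

lemma sum_sq_pderiv_rowField_le (h2 : z₀.2 i₀ = 0) {e : ℝ}
    {w : EuclideanSpace ℝ (Fin p)} {z : Resp n × Design n p}
    (hz : z = z₀ + rowData i₀ βs (act (CFC.sqrt S) w) e)
    {A : Matrix (Fin p) (Fin p) ℝ} (hA : IsDerivMatrix squareLoss g S μ z.1 z.2 A) :
    ∑ i, ∑ j, pderiv j (rowField S g i₀ βs z₀ e i) w ^ 2
      ≤ 2 * (residual squareLoss g z.1 z.2 i₀ ^ 2 * (p * (((n : ℝ) * μ)⁻¹) ^ 2))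
        + 2 * (‖act (CFC.sqrt S) (estimator g z - βs)‖ ^ 2
          * (((n : ℝ) * μ)⁻¹ * ‖w‖) ^ 2) := by
  set M := CFC.sqrt S * A * CFC.sqrt S
  set a := act (CFC.sqrt S) (estimator g z - βs)
  set r := residual squareLoss g z.1 z.2 i₀
  have hM : ‖act M‖ ≤ ((n : ℝ) * μ)⁻¹ := hA.2.1
  have hMw : ‖act M w‖ ≤ ((n : ℝ) * μ)⁻¹ * ‖w‖ := (act M).le_of_opNorm_le hM w
  have e1 : ∑ i, ∑ j, (a j * act M w i) ^ 2 = ‖a‖ ^ 2 * ‖act M w‖ ^ 2 := by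
    rw [EuclideanSpace.real_norm_sq_eq, EuclideanSpace.real_norm_sq_eq, mul_comm,
      Finset.sum_mul_sum]
    refine Finset.sum_congr rfl fun i _ => Finset.sum_congr rfl fun j _ => ?_
    ring
  calc ∑ i, ∑ j, pderiv j (rowField S g i₀ βs z₀ e i) w ^ 2
      ≤ ∑ i, ∑ j, (2 * (r ^ 2 * M i j ^ 2) + 2 * (a j * act M w i) ^ 2) := by
        refine Finset.sum_le_sum fun i _ => Finset.sum_le_sum fun j _ => ?_
        rw [pderiv_rowField h2 hz hA]
        change (a j * act M w i - r * M i j) ^ 2 ≤ _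
        nlinarith [sq_nonneg (a j * act M w i + r * M i j)]
    _ = 2 * (r ^ 2 * ∑ i, ∑ j, M i j ^ 2) + 2 * (‖a‖ ^ 2 * ‖act M w‖ ^ 2) := by
        rw [← e1]
        simp only [Finset.sum_add_distrib, Finset.mul_sum]
    _ ≤ _ := by
        gcongr
        exact (sum_sq_entries_le M).trans (by gcongr)

/-- The normalizing factor of the residual, as a function of the estimation error. -/
noncomputable def scale (σ : ℝ) (a : EuclideanSpace ℝ (Fin p)) : ℝ := √(σ ^ 2 + ‖a‖ ^ 2)

lemma scale_pos {σ : ℝ} (hσ : 0 < σ) (a : EuclideanSpace ℝ (Fin p)) : 0 < scale σ a :=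
  Real.sqrt_pos.2 (by positivity)

lemma scale_sq (σ : ℝ) (a : EuclideanSpace ℝ (Fin p)) : scale σ a ^ 2 = σ ^ 2 + ‖a‖ ^ 2 :=
  Real.sq_sqrt (by positivity)

lemma norm_le_scale (σ : ℝ) (a : EuclideanSpace ℝ (Fin p)) : ‖a‖ ≤ scale σ a :=
  Real.le_sqrt_of_sq_le (by linarith [sq_nonneg σ])

/-- Factor the difference of squares and use ‖a‖ ≤ `scale σ a`; the constant 1 does not depend on σ.
-/
lemma abs_scale_sub_le {σ : ℝ} (hσ : 0 < σ) (a b : EuclideanSpace ℝ (Fin p)) :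
    |scale σ a - scale σ b| ≤ ‖a - b‖ := by
  have hab := abs_norm_sub_norm_le a b
  have ha := scale_pos hσ a
  have hb := scale_pos hσ b
  have h1 : (scale σ a - scale σ b) * (scale σ a + scale σ b)
      = (‖a‖ - ‖b‖) * (‖a‖ + ‖b‖) := by
    linear_combination scale_sq σ a - scale_sq σ b
  have h2 : |scale σ a - scale σ b| * (scale σ a + scale σ b)
      = |‖a‖ - ‖b‖| * (‖a‖ + ‖b‖) := by
    rw [← abs_of_pos (add_pos ha hb), ← abs_mul, h1, abs_mul, abs_of_nonneg (by positivity :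
      0 ≤ ‖a‖ + ‖b‖)]
  have h3 : |scale σ a - scale σ b| * (scale σ a + scale σ b)
      ≤ ‖a - b‖ * (scale σ a + scale σ b) := by
    rw [h2]
    gcongr
    · exact norm_le_scale σ a
    · exact norm_le_scale σ b
  exact le_of_mul_le_mul_right h3 (by positivity)

lemma normalizedResidual_eq {σ : ℝ} (hσ : 0 < σ) (z : Resp n × Design n p)
    (A : Matrix (Fin p) (Fin p) ℝ) (i : Fin n) :
    normalizedResidual squareLoss g S βs σ A z.1 z.2 i
      = (1 + (S * A).trace) * residual squareLoss g z.1 z.2 i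
        / scale σ (act (CFC.sqrt S) (estimator g z - βs)) := by
  rw [normalizedResidual, Real.rpow_neg (by positivity), ← Real.sqrt_eq_rpow, scale, mul_assoc,
    inv_mul_eq_div]

/-- The leave-one-out residual, which has a standard Gaussian distribution. -/
noncomputable def looResidual (S : Matrix (Fin p) (Fin p) ℝ) (σ : ℝ)
    (b : EuclideanSpace ℝ (Fin p)) (w : EuclideanSpace ℝ (Fin p)) (e : ℝ) : ℝ :=
  (e - inner ℝ (act (CFC.sqrt S) w) b) / scale σ (act (CFC.sqrt S) b)

/-- The case of interest is x = (1 + tr[SA])r, with δ the Gaussian divergence and c the inner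
product. When |u|v ≤ 1/2 the two scales satisfy τ ≥ τ₀/2, whence the factors 2. -/
lemma abs_div_sub_div_le {x τ τ₀ u v : ℝ} {δ c : ℝ} (hτ : 0 < τ) (hτ₀ : 0 < τ₀)
    (hx : x = δ + τ₀ * u + c) (hc : |c| ≤ τ * v) (hd : |τ - τ₀| ≤ τ₀ * |u| * v)
    (huv : |u| * v ≤ 1 / 2) :
    |x / τ - u| ≤ 2 * |δ / τ₀| + 2 * (u ^ 2 * v) + v := by
  have h1 : τ₀ / 2 ≤ τ := by
    have := (abs_le.1 hd).1
    nlinarith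
  have e : x / τ - u = δ / τ₀ * (τ₀ / τ) + u * (τ₀ - τ) / τ + c / τ := by
    rw [hx]; field_simp; ring
  have h2 : |δ / τ₀ * (τ₀ / τ)| ≤ 2 * |δ / τ₀| := by
    rw [abs_mul, abs_of_pos (div_pos hτ₀ hτ), mul_comm]
    gcongr
    rw [div_le_iff₀ hτ]; linarith
  have h3 : |u * (τ₀ - τ) / τ| ≤ 2 * (u ^ 2 * v) := by
    rw [abs_div, abs_mul, abs_of_pos hτ, div_le_iff₀ hτ, abs_sub_comm τ₀ τ]
    have h5 : 0 ≤ |u| * |u| * v := by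
      have : 0 ≤ τ * v := (abs_nonneg c).trans hc
      have : 0 ≤ v := nonneg_of_mul_nonneg_right this hτ
      positivity
    calc |u| * |τ - τ₀| ≤ |u| * (τ₀ * |u| * v) := by gcongr
      _ = τ₀ * (|u| * |u| * v) := by ring
      _ ≤ (2 * τ) * (|u| * |u| * v) := by gcongr; linarith
      _ = 2 * (u ^ 2 * v) * τ := by rw [← sq_abs u]; ring
  have h4 : |c / τ| ≤ v := by
    rw [abs_div, abs_of_pos hτ, div_le_iff₀ hτ]; linarith
  rw [e]
  exact (abs_add_three _ _ _).trans (by linarith)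

lemma abs_normalizedResidual_sub_le (hS : S.PosDef) (hμ : 0 < μ) (hg : StronglyConvexWrt S μ g)
    {σ : ℝ} (hσ : 0 < σ) (h1 : z₀.1 i₀ = 0) (h2 : z₀.2 i₀ = 0) {e : ℝ}
    {w : EuclideanSpace ℝ (Fin p)} {z : Resp n × Design n p}
    (hz : z = z₀ + rowData i₀ βs (act (CFC.sqrt S) w) e)
    {A : Matrix (Fin p) (Fin p) ℝ} (hA : IsDerivMatrix squareLoss g S μ z.1 z.2 A) {u v : ℝ}
    (hu : u = looResidual S σ (estimator g z₀ - βs) w e)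
    (hv : v = ((n : ℝ) * μ)⁻¹ * ‖w‖) (huv : |u| * v ≤ 1 / 2) :
    |normalizedResidual squareLoss g S βs σ A z.1 z.2 i₀ - u|
      ≤ 2 * |gaussianDiv (rowField S g i₀ βs z₀ e) w
          / scale σ (act (CFC.sqrt S) (estimator g z₀ - βs))| + 2 * (u ^ 2 * v) + v := by
  rw [normalizedResidual_eq hσ]
  have hτ₀ := scale_pos hσ (act (CFC.sqrt S) (estimator g z₀ - βs))
  have hτ := scale_pos hσ (act (CFC.sqrt S) (estimator g z - βs))
  have hr₀ : scale σ (act (CFC.sqrt S) (estimator g z₀ - βs)) * u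
      = e - inner ℝ (act (CFC.sqrt S) w) (estimator g z₀ - βs) := by
    rw [hu, looResidual, mul_div_cancel₀ _ hτ₀.ne']
  refine abs_div_sub_div_le hτ hτ₀
    (c := inner ℝ (act (CFC.sqrt S) (estimator g z - βs)) (act (CFC.sqrt S * A * CFC.sqrt S) w))
    ?_ ?_ ?_ huv
  · rw [gaussianDiv_rowField hS h1 h2 hz hA, hr₀]
    ring
  · refine (abs_real_inner_le_norm _ _).trans ?_
    refine mul_le_mul (norm_le_scale σ _) ?_ (norm_nonneg _) hτ.le
    rw [hv]
    exact (act _).le_of_opNorm_le hA.2.1 w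
  · refine (abs_scale_sub_le hσ _ _).trans ?_
    rw [← map_sub, sub_sub_sub_cancel_right, ← abs_of_pos hτ₀, ← abs_mul, hr₀, hv, hz]
    exact row_norm_sub_le hS hμ hg h1 h2 w e

lemma sum_sq_rowField_le (hS : S.PosDef) (hμ : 0 < μ) (hg : StronglyConvexWrt S μ g)
    {σ : ℝ} (hσ : 0 < σ) (h1 : z₀.1 i₀ = 0) (h2 : z₀.2 i₀ = 0) {e : ℝ}
    {w : EuclideanSpace ℝ (Fin p)} {u v : ℝ}
    (hu : u = looResidual S σ (estimator g z₀ - βs) w e)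
    (hv : v = ((n : ℝ) * μ)⁻¹ * ‖w‖) :
    ∑ i, rowField S g i₀ βs z₀ e i w ^ 2
      ≤ scale σ (act (CFC.sqrt S) (estimator g z₀ - βs)) ^ 2 * (u ^ 2 * v ^ 2) := by
  have hτ₀ := scale_pos hσ (act (CFC.sqrt S) (estimator g z₀ - βs))
  have hr₀ : scale σ (act (CFC.sqrt S) (estimator g z₀ - βs)) * u
      = e - inner ℝ (act (CFC.sqrt S) w) (estimator g z₀ - βs) := by
    rw [hu, looResidual, mul_div_cancel₀ _ hτ₀.ne']
  have h := row_norm_sub_le hS hμ hg h1 h2 w e (βs := βs)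
  rw [← hr₀, ← hv, ← norm_neg, ← map_neg, neg_sub] at h
  have e1 : ∑ i, rowField S g i₀ βs z₀ e i w ^ 2 = ‖act (CFC.sqrt S) (estimator g z₀
      - estimator g (z₀ + rowData i₀ βs (act (CFC.sqrt S) w) e))‖ ^ 2 := by
    rw [EuclideanSpace.real_norm_sq_eq]
    rfl
  rw [e1]
  refine (pow_le_pow_left₀ (norm_nonneg _) h 2).trans_eq ?_
  rw [mul_pow, sq_abs]
  ring

/-- Everything is homogeneous of degree 2 in τ₀, which therefore disappears after normalization. The
terms 8v² and 8u²v⁴ come from ‖S^{1/2}(β̂ - β*)‖² ≤ τ₀²(2 + 2u²v²). -/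
lemma stein_integrand_le (hS : S.PosDef) (hμ : 0 < μ) (hg : StronglyConvexWrt S μ g)
    {σ : ℝ} (hσ : 0 < σ) (h1 : z₀.1 i₀ = 0) (h2 : z₀.2 i₀ = 0) {e : ℝ}
    {w : EuclideanSpace ℝ (Fin p)} {z : Resp n × Design n p}
    (hz : z = z₀ + rowData i₀ βs (act (CFC.sqrt S) w) e)
    {A : Matrix (Fin p) (Fin p) ℝ} (hA : IsDerivMatrix squareLoss g S μ z.1 z.2 A) {u v : ℝ}
    (hu : u = looResidual S σ (estimator g z₀ - βs) w e)
    (hv : v = ((n : ℝ) * μ)⁻¹ * ‖w‖) :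
    3 * ∑ i, rowField S g i₀ βs z₀ e i w ^ 2
        + 2 * ∑ i, ∑ j, pderiv j (rowField S g i₀ βs z₀ e i) w ^ 2
      ≤ scale σ (act (CFC.sqrt S) (estimator g z₀ - βs)) ^ 2
        * (3 * (u ^ 2 * v ^ 2) + 4 * (p * (((n : ℝ) * μ)⁻¹) ^ 2 * u ^ 2) + 8 * v ^ 2
          + 8 * (u ^ 2 * v ^ 4)) := by
  have hf := sum_sq_rowField_le hS hμ hg hσ h1 h2 hu hv
  have hd := sum_sq_pderiv_rowField_le h2 hz hA
  have hτ₀ := scale_pos hσ (act (CFC.sqrt S) (estimator g z₀ - βs))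
  have hr₀ : scale σ (act (CFC.sqrt S) (estimator g z₀ - βs)) * u
      = e - inner ℝ (act (CFC.sqrt S) w) (estimator g z₀ - βs) := by
    rw [hu, looResidual, mul_div_cancel₀ _ hτ₀.ne']
  have hr : residual squareLoss g z.1 z.2 i₀ ^ 2
      ≤ scale σ (act (CFC.sqrt S) (estimator g z₀ - βs)) ^ 2 * u ^ 2 := by
    rw [← mul_pow, hr₀, hz, residual_add_rowData h1 h2]
    exact sq_le_sq.2 (row_residual_sq_le hS hμ hg h1 h2 _ _)
  have hn1 := row_norm_sub_le hS hμ hg h1 h2 w e (βs := βs)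
  rw [← hr₀, ← hv, ← hz] at hn1
  have hs := norm_le_scale σ (act (CFC.sqrt S) (estimator g z₀ - βs))
  have hn2 : ‖act (CFC.sqrt S) (estimator g z - βs)‖ ^ 2
      ≤ scale σ (act (CFC.sqrt S) (estimator g z₀ - βs)) ^ 2 * (2 + 2 * (u ^ 2 * v ^ 2)) := by
    have h3 : ‖act (CFC.sqrt S) (estimator g z - βs)‖
        ≤ scale σ (act (CFC.sqrt S) (estimator g z₀ - βs)) * (1 + |u| * v) := by
      have : estimator g z - βs = (estimator g z - estimator g z₀) + (estimator g z₀ - βs) := by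
        abel
      rw [this, map_add]
      refine (norm_add_le _ _).trans ((add_le_add hn1 hs).trans_eq ?_)
      rw [abs_mul, abs_of_pos hτ₀]
      ring
    refine (pow_le_pow_left₀ (norm_nonneg _) h3 2).trans ?_
    rw [mul_pow]
    gcongr
    nlinarith [sq_nonneg (1 - |u| * v), sq_abs u]
  rw [← hv] at hd
  set τ := scale σ (act (CFC.sqrt S) (estimator g z₀ - βs))
  have h4 : residual squareLoss g z.1 z.2 i₀ ^ 2 * (p * (((n : ℝ) * μ)⁻¹) ^ 2)
      ≤ τ ^ 2 * u ^ 2 * (p * (((n : ℝ) * μ)⁻¹) ^ 2) := by gcongr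
  have h5 : ‖act (CFC.sqrt S) (estimator g z - βs)‖ ^ 2 * v ^ 2
      ≤ τ ^ 2 * (2 + 2 * (u ^ 2 * v ^ 2)) * v ^ 2 := by gcongr
  linarith

end Comparison

/-! ### The law of the data -/

section Law

/-- On a box, coordinate i₀ of the old point is unconstrained and the fresh sample supplies the
missing factor. Such resampling replaces conditioning on the other rows. -/
lemma measurePreserving_pi_update {ι : Type*} [Fintype ι] [DecidableEq ι] {α : ι → Type*}
    [∀ i, MeasurableSpace (α i)] (μ : ∀ i, Measure (α i)) [∀ i, IsProbabilityMeasure (μ i)]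
    (i₀ : ι) : MeasurePreserving (fun q : (∀ i, α i) × α i₀ => Function.update q.1 i₀ q.2)
      ((Measure.pi μ).prod (μ i₀)) (Measure.pi μ) := by
  have hm : Measurable fun q : (∀ i, α i) × α i₀ => Function.update q.1 i₀ q.2 :=
    measurable_update'.comp measurable_id
  refine ⟨hm, (Measure.pi_eq fun s hs => ?_).symm⟩
  rw [Measure.map_apply hm (MeasurableSet.univ_pi hs)]
  have : (fun q : (∀ i, α i) × α i₀ => Function.update q.1 i₀ q.2) ⁻¹' Set.univ.pi s
      = (Set.univ.pi (Function.update s i₀ Set.univ)) ×ˢ s i₀ := by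
    ext q
    simp only [Set.mem_preimage, Set.mem_univ_pi, Set.mem_prod]
    constructor
    · intro h
      refine ⟨fun i => ?_, by simpa using h i₀⟩
      rcases eq_or_ne i i₀ with rfl | hi
      · simp
      · simpa [hi] using h i
    · rintro ⟨h1, h2⟩ i
      rcases eq_or_ne i i₀ with rfl | hi
      · simpa using h2
      · simpa [hi] using h1 i
  rw [this, Measure.prod_prod, Measure.pi_pi, ← Finset.mul_prod_erase _ _ (Finset.mem_univ i₀),
    ← Finset.mul_prod_erase Finset.univ (fun i => μ i (s i)) (Finset.mem_univ i₀)]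
  simp only [Function.update_self, measure_univ, one_mul]
  rw [mul_comm]
  congr 1
  refine Finset.prod_congr rfl fun i hi => ?_
  rw [Function.update_of_ne (Finset.ne_of_mem_erase hi)]

lemma pi_absolutelyContinuous {α : Type*} [MeasurableSpace α] {μ ν : Measure α} [SigmaFinite μ]
    [SigmaFinite ν] (h : μ ≪ ν) (n : ℕ) :
    Measure.pi (fun _ : Fin n => μ) ≪ Measure.pi (fun _ : Fin n => ν) := by
  induction n with
  | zero => rw [Measure.pi_of_empty, Measure.pi_of_empty]
  | succ n ih =>
    have h1 := (measurePreserving_piFinSuccAbove (fun _ : Fin (n + 1) => μ) 0).symm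
    have h2 := (measurePreserving_piFinSuccAbove (fun _ : Fin (n + 1) => ν) 0).symm
    rw [← h1.map_eq, ← h2.map_eq]
    exact (h.prod ih).map (MeasurableEquiv.measurable _)

lemma multivariateGaussian_absolutelyContinuous {p : ℕ} {S : Matrix (Fin p) (Fin p) ℝ}
    (hS : S.PosDef) : multivariateGaussian 0 S ≪ volume := by
  refine Measure.AbsolutelyContinuous.mk fun s hs h0 => ?_
  rw [multivariateGaussian, Measure.map_apply (by fun_prop) hs]
  refine stdGaussian_absolutelyContinuous ?_
  simp only [zero_add]
  set f : EuclideanSpace ℝ (Fin p) →ₗ[ℝ] EuclideanSpace ℝ (Fin p) :=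
    (act (CFC.sqrt S)).toLinearMap
  have hf : LinearMap.det f ≠ 0 := by
    have h1 : (act (CFC.sqrt S)⁻¹).toLinearMap ∘ₗ f = LinearMap.id :=
      LinearMap.ext fun v => act_inv_sqrt_act hS v
    have h2 := congrArg LinearMap.det h1
    rw [LinearMap.det_comp, LinearMap.det_id] at h2
    exact right_ne_zero_of_mul_eq_one h2
  change volume (f ⁻¹' s) = 0
  rw [Measure.addHaar_preimage_linearMap _ hf, h0, mul_zero]

variable {n p : ℕ}

lemma posDef_smul_one {σ : ℝ} (hσ : 0 < σ) : (σ ^ 2 • (1 : Matrix (Fin n) (Fin n) ℝ)).PosDef :=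
  Matrix.PosDef.one.smul (by positivity)

lemma multivariateGaussian_smul_one {σ : ℝ} (hσ : 0 < σ) :
    multivariateGaussian 0 (σ ^ 2 • (1 : Matrix (Fin n) (Fin n) ℝ))
      = (Measure.pi fun _ => gaussianReal 0 (σ ^ 2).toNNReal).map (WithLp.toLp 2) := by
  apply Measure.ext_of_charFun (E := EuclideanSpace ℝ (Fin n))
  ext t
  rw [charFun_multivariateGaussian (posDef_smul_one hσ).posSemidef, charFun_pi]
  simp_rw [charFun_gaussianReal, ← Complex.exp_sum]
  congr 1
  have h : ((σ ^ 2).toNNReal : ℝ) = σ ^ 2 := Real.coe_toNNReal _ (by positivity)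
  simp only [h, inner_zero_right, Complex.ofReal_zero, zero_mul, mul_zero, zero_sub,
    Finset.sum_neg_distrib, Matrix.smul_mulVec, Matrix.one_mulVec, dotProduct,
    Complex.ofReal_sum, Complex.ofReal_mul, Complex.ofReal_pow, Finset.sum_div]
  congr 1
  refine Finset.sum_congr rfl fun i _ => ?_
  simp only [Pi.smul_apply, smul_eq_mul, Complex.ofReal_mul, Complex.ofReal_pow]
  ring

/-- The law of `(X, ε)`. -/
noncomputable def dataLaw (n : ℕ) (S : Matrix (Fin p) (Fin p) ℝ) (σ : ℝ) :
    Measure (Design n p × Resp n) :=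
  (Measure.pi fun _ => multivariateGaussian 0 S).prod (multivariateGaussian 0 (σ ^ 2 • 1))

instance (S : Matrix (Fin p) (Fin p) ℝ) (σ : ℝ) : IsProbabilityMeasure (dataLaw n S σ) := by
  unfold dataLaw; infer_instance

/-- Replacement of the row of index `i₀` of the design by `x` and of the noise by `e`. -/
noncomputable def replaceRow (i₀ : Fin n) (D : Design n p × Resp n) (x : EuclideanSpace ℝ (Fin p))
    (e : ℝ) : Design n p × Resp n :=
  (Function.update D.1 i₀ x, WithLp.toLp 2 (Function.update D.2.ofLp i₀ e))

lemma measurable_replaceRow (i₀ : Fin n) :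
    Measurable fun q : (Design n p × Resp n) × (EuclideanSpace ℝ (Fin p) × ℝ) =>
      replaceRow i₀ q.1 q.2.1 q.2.2 := by
  unfold replaceRow
  refine Measurable.prodMk ?_ ?_
  · exact measurable_update'.comp (by fun_prop :
      Measurable fun q : (Design n p × Resp n) × (EuclideanSpace ℝ (Fin p) × ℝ) => (q.1.1, q.2.1))
  · refine (WithLp.measurable_toLp 2 _).comp ?_
    exact (measurable_update' (X := fun _ : Fin n => ℝ) (a := i₀)).comp (by fun_prop :
      Measurable fun q : (Design n p × Resp n) × (EuclideanSpace ℝ (Fin p) × ℝ) =>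
        (q.1.2.ofLp, q.2.2))

lemma measurePreserving_update_noise {σ : ℝ} (hσ : 0 < σ) (i₀ : Fin n) :
    MeasurePreserving (fun q : Resp n × ℝ => (WithLp.toLp 2 (Function.update q.1.ofLp i₀ q.2) : Resp n))
      ((multivariateGaussian 0 (σ ^ 2 • 1)).prod (gaussianReal 0 (σ ^ 2).toNNReal))
      (multivariateGaussian 0 (σ ^ 2 • 1)) := by
  have hto : MeasurePreserving (WithLp.toLp 2 : (Fin n → ℝ) → Resp n)
      (Measure.pi fun _ => gaussianReal 0 (σ ^ 2).toNNReal)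
      (multivariateGaussian 0 (σ ^ 2 • 1)) :=
    ⟨by fun_prop, (multivariateGaussian_smul_one hσ).symm⟩
  have hof : MeasurePreserving (WithLp.ofLp : Resp n → (Fin n → ℝ))
      (multivariateGaussian 0 (σ ^ 2 • 1))
      (Measure.pi fun _ => gaussianReal 0 (σ ^ 2).toNNReal) := by
    refine ⟨by fun_prop, ?_⟩
    rw [multivariateGaussian_smul_one hσ, Measure.map_map (by fun_prop) (by fun_prop)]
    exact Measure.map_id
  exact hto.comp ((measurePreserving_pi_update _ i₀).comp (hof.prod (MeasurePreserving.id _)))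

lemma measurePreserving_prodProdProdComm {α β γ δ : Type*} [MeasurableSpace α]
    [MeasurableSpace β] [MeasurableSpace γ] [MeasurableSpace δ] (μa : Measure α) (μb : Measure β)
    (μc : Measure γ) (μd : Measure δ) [SFinite μa] [SFinite μb] [SFinite μc] [SFinite μd] :
    MeasurePreserving (fun q : (α × β) × (γ × δ) => ((q.1.1, q.2.1), (q.1.2, q.2.2)))
      ((μa.prod μb).prod (μc.prod μd)) ((μa.prod μc).prod (μb.prod μd)) := by
  have h1 := measurePreserving_prodAssoc μa μb (μc.prod μd)
  have h2 := (measurePreserving_prodAssoc μb μc μd).symm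
  have h3 : MeasurePreserving (Prod.map Prod.swap id) ((μb.prod μc).prod μd)
    ((μc.prod μb).prod μd) := Measure.measurePreserving_swap.prod (MeasurePreserving.id _)
  have h4 := measurePreserving_prodAssoc μc μb μd
  have h5 := (measurePreserving_prodAssoc μa μc (μb.prod μd)).symm
  exact h5.comp (((MeasurePreserving.id μa).prod (h4.comp (h3.comp h2))).comp h1)

lemma measurePreserving_replaceRow (S : Matrix (Fin p) (Fin p) ℝ) {σ : ℝ} (hσ : 0 < σ)
    (i₀ : Fin n) :
    MeasurePreserving (fun q : (Design n p × Resp n) × (EuclideanSpace ℝ (Fin p) × ℝ) =>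
      replaceRow i₀ q.1 q.2.1 q.2.2)
      ((dataLaw n S σ).prod
        ((multivariateGaussian 0 S).prod (gaussianReal 0 (σ ^ 2).toNNReal))) (dataLaw n S σ) :=
  ((measurePreserving_pi_update (fun _ => multivariateGaussian 0 S) i₀).prod
    (measurePreserving_update_noise hσ i₀)).comp (measurePreserving_prodProdProdComm _ _ _ _)

lemma measurePreserving_comp_snd_swap {α β γ δ ε : Type*} [MeasurableSpace α]
    [MeasurableSpace β] [MeasurableSpace γ] [MeasurableSpace δ] [MeasurableSpace ε]
    {μa : Measure α} {μb : Measure β} {μc : Measure γ} {μd : Measure δ} {μe : Measure ε}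
    [SFinite μa] [SFinite μb] [SFinite μc] [SFinite μd] {f : α → β} {F : δ × (β × γ) → ε}
    (hf : MeasurePreserving f μa μb) (hF : MeasurePreserving F (μd.prod (μb.prod μc)) μe) :
    MeasurePreserving (fun q : δ × (γ × α) => F (q.1, (f q.2.2, q.2.1)))
      (μd.prod (μc.prod μa)) μe :=
  hF.comp ((MeasurePreserving.id μd).prod
    ((hf.prod (MeasurePreserving.id μc)).comp Measure.measurePreserving_swap))

lemma measurePreserving_act_sqrt (S : Matrix (Fin p) (Fin p) ℝ) :
    MeasurePreserving (act (CFC.sqrt S)) (stdGaussian (EuclideanSpace ℝ (Fin p)))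
      (multivariateGaussian 0 S) :=
  ⟨by fun_prop, by simp [multivariateGaussian]⟩

/-- The noise comes before w so that Fubini leaves w as the innermost variable, the one to which
Stein's inequality applies. -/
lemma measurePreserving_replaceRow_std (S : Matrix (Fin p) (Fin p) ℝ) {σ : ℝ} (hσ : 0 < σ)
    (i₀ : Fin n) :
    MeasurePreserving (fun q : (Design n p × Resp n) × (ℝ × EuclideanSpace ℝ (Fin p)) =>
      replaceRow i₀ q.1 (act (CFC.sqrt S) q.2.2) q.2.1)
      ((dataLaw n S σ).prod ((gaussianReal 0 (σ ^ 2).toNNReal).prod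
        (stdGaussian (EuclideanSpace ℝ (Fin p))))) (dataLaw n S σ) :=
  measurePreserving_comp_snd_swap (measurePreserving_act_sqrt S)
    (measurePreserving_replaceRow S hσ i₀)

/-- The data `(y, X)` of the linear model with design `X` and noise `ε`. -/
noncomputable def modelData (βs : EuclideanSpace ℝ (Fin p)) (D : Design n p × Resp n) :
    Resp n × Design n p :=
  (response D.1 βs D.2, D.1)

lemma measurable_modelData (βs : EuclideanSpace ℝ (Fin p)) :
    Measurable (modelData βs : Design n p × Resp n → _) := by
  unfold modelData response
  have h : Measurable fun D : Design n p × Resp n =>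
      (WithLp.toLp 2 fun i => inner ℝ (D.1 i) βs : Resp n) := by
    refine (WithLp.measurable_toLp 2 _).comp (measurable_pi_lambda _ fun i => ?_)
    have : Measurable fun D : Design n p × Resp n => D.1 i := by fun_prop
    exact this.inner measurable_const
  exact (h.add measurable_snd).prodMk measurable_fst

/-- For fixed X the response is a translate of ε, so this shear preserves Lebesgue measure. Hence
Lebesgue-almost-every statements hold almost surely for the observed data. -/
lemma map_modelData_absolutelyContinuous {S : Matrix (Fin p) (Fin p) ℝ} (hS : S.PosDef) {σ : ℝ}
    (hσ : 0 < σ) (βs : EuclideanSpace ℝ (Fin p)) :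
    (dataLaw n S σ).map (modelData βs) ≪ volume := by
  have h1 : dataLaw n S σ ≪ (volume : Measure (Design n p)).prod (volume : Measure (Resp n)) :=
    (pi_absolutelyContinuous (multivariateGaussian_absolutelyContinuous hS) n).prod
      (multivariateGaussian_absolutelyContinuous (posDef_smul_one hσ))
  have h2 : MeasurePreserving (fun D : Design n p × Resp n => (D.1, response D.1 βs D.2))
      ((volume : Measure (Design n p)).prod (volume : Measure (Resp n)))
      ((volume : Measure (Design n p)).prod (volume : Measure (Resp n))) :=
    (MeasurePreserving.id _).skew_product (g := fun X ε => response X βs ε)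
      (measurable_fst.comp (measurable_modelData βs))
      (Eventually.of_forall fun X => (measurePreserving_add_left volume _).map_eq)
  have h3 : MeasurePreserving (modelData βs : Design n p × Resp n → _)
      ((volume : Measure (Design n p)).prod (volume : Measure (Resp n)))
      ((volume : Measure (Resp n)).prod (volume : Measure (Design n p))) :=
    Measure.measurePreserving_swap.comp h2
  have h4 := h1.map h3.measurable
  rwa [h3.map_eq] at h4

lemma modelData_replaceRow (βs : EuclideanSpace ℝ (Fin p)) (i₀ : Fin n)
    (D : Design n p × Resp n) (x : EuclideanSpace ℝ (Fin p)) (e : ℝ) :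
    modelData βs (replaceRow i₀ D x e)
      = modelData βs (replaceRow i₀ D 0 0) + rowData i₀ βs x e := by
  ext i
  · by_cases h : i = i₀
    · subst h; simp [modelData, replaceRow, rowData, response]
    · simp [modelData, replaceRow, rowData, response, h]
  · by_cases h : i = i₀
    · subst h; simp [modelData, replaceRow, rowData]
    · simp [modelData, replaceRow, rowData, h]

lemma modelData_replaceRow_zero_fst (βs : EuclideanSpace ℝ (Fin p)) (i₀ : Fin n)
    (D : Design n p × Resp n) : (modelData βs (replaceRow i₀ D 0 0)).1 i₀ = 0 := by
  simp [modelData, replaceRow, response]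

lemma modelData_replaceRow_zero_snd (βs : EuclideanSpace ℝ (Fin p)) (i₀ : Fin n)
    (D : Design n p × Resp n) : (modelData βs (replaceRow i₀ D 0 0)).2 i₀ = 0 := by
  simp [modelData, replaceRow]

lemma replaceRow_replaceRow (i₀ : Fin n) (D : Design n p × Resp n)
    (x x' : EuclideanSpace ℝ (Fin p)) (e e' : ℝ) :
    replaceRow i₀ (replaceRow i₀ D x e) x' e' = replaceRow i₀ D x' e' := by
  simp [replaceRow]

end Law

/-! ### Moments and the law of the leave-one-out residual -/

section Moments

variable {p : ℕ}

lemma map_inner_stdGaussian (a : EuclideanSpace ℝ (Fin p)) :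
    (stdGaussian (EuclideanSpace ℝ (Fin p))).map (fun w => inner ℝ a w)
      = gaussianReal 0 (‖a‖ ^ 2).toNNReal := by
  have h := IsGaussian.map_eq_gaussianReal (μ := stdGaussian (EuclideanSpace ℝ (Fin p)))
    (innerSL ℝ a)
  rw [integral_strongDual_stdGaussian, variance_dual_stdGaussian, innerSL_apply_norm] at h
  exact h

/-- For fixed b this is a sum of two independent centred Gaussians with variances σ²/τ² and
‖S^{1/2}b‖²/τ², which add up to 1. -/
lemma map_looResidual (S : Matrix (Fin p) (Fin p) ℝ) {σ : ℝ} (hσ : 0 < σ)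
    (b : EuclideanSpace ℝ (Fin p)) :
    ((gaussianReal 0 (σ ^ 2).toNNReal).prod (stdGaussian (EuclideanSpace ℝ (Fin p)))).map
      (fun q => looResidual S σ b q.2 q.1) = gaussianReal 0 1 := by
  set τ := scale σ (act (CFC.sqrt S) b)
  have hτ : 0 < τ := scale_pos hσ _
  set a := (-τ⁻¹) • act (CFC.sqrt S) b with ha
  have e : (fun q : ℝ × EuclideanSpace ℝ (Fin p) => looResidual S σ b q.2 q.1)
      = (fun q => q.1 / τ) + fun q => inner ℝ a q.2 := by
    funext q
    simp only [looResidual, Pi.add_apply, ha, real_inner_smul_left, inner_act_sqrt]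
    rw [real_inner_comm]
    change _ / τ = _
    rw [inner_act_sqrt]
    field_simp
    ring
  have h1 : ((gaussianReal 0 (σ ^ 2).toNNReal).prod
      (stdGaussian (EuclideanSpace ℝ (Fin p)))).map (fun q => q.1 / τ)
      = gaussianReal 0 ((σ ^ 2).toNNReal / NNReal.mk (τ ^ 2) (sq_nonneg _)) := by
    have h := gaussianReal_map_div_const (μ := 0) (v := (σ ^ 2).toNNReal) τ
    rw [zero_div] at h
    have h' := (measurePreserving_fst (μ := gaussianReal 0 (σ ^ 2).toNNReal)
      (ν := stdGaussian (EuclideanSpace ℝ (Fin p)))).map_eq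
    rw [← h]
    conv_rhs => rw [← h']
    rw [Measure.map_map (by fun_prop) (by fun_prop)]
    rfl
  have h2 : ((gaussianReal 0 (σ ^ 2).toNNReal).prod
      (stdGaussian (EuclideanSpace ℝ (Fin p)))).map (fun q => inner ℝ a q.2)
      = gaussianReal 0 (‖a‖ ^ 2).toNNReal := by
    have h := (measurePreserving_snd (μ := gaussianReal 0 (σ ^ 2).toNNReal)
      (ν := stdGaussian (EuclideanSpace ℝ (Fin p)))).map_eq
    rw [← map_inner_stdGaussian]
    conv_rhs => rw [← h]
    rw [Measure.map_map (by fun_prop) (by fun_prop)]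
    rfl
  have h3 := gaussianReal_add_gaussianReal_of_indepFun
    (indepFun_prod (μ := gaussianReal 0 (σ ^ 2).toNNReal)
      (ν := stdGaussian (EuclideanSpace ℝ (Fin p))) (X := fun x => x / τ)
      (Y := fun w => inner ℝ a w) (by fun_prop) (by fun_prop)) h1 h2
  rw [e, h3, add_zero]
  congr 1
  rw [← NNReal.coe_inj]
  simp only [NNReal.coe_add, NNReal.coe_div, Real.coe_toNNReal _ (sq_nonneg _), NNReal.coe_mk,
    NNReal.coe_one]
  have hs := scale_sq σ (act (CFC.sqrt S) b)
  rw [ha, norm_smul, norm_neg, norm_inv, Real.norm_of_nonneg hτ.le]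
  change τ ^ 2 = _ at hs
  field_simp
  linarith

/-- The even moments of the standard Gaussian distribution. -/
noncomputable def gaussianMoment (k : ℕ) : ℝ := ∫ x, x ^ (2 * k) ∂(gaussianReal 0 1)

lemma gaussianMoment_nonneg (k : ℕ) : 0 ≤ gaussianMoment k :=
  integral_nonneg fun x => by
    simp only [pow_mul]
    positivity

lemma integrable_pow_gaussianReal (k : ℕ) :
    Integrable (fun x : ℝ => x ^ k) (gaussianReal 0 1) := by
  have h := (memLp_id_gaussianReal (μ := 0) (v := 1) k).integrable_norm_pow'
  refine (integrable_norm_iff (by fun_prop)).1 ?_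
  simpa using h

lemma integrable_looResidual_pow (S : Matrix (Fin p) (Fin p) ℝ) {σ : ℝ} (hσ : 0 < σ)
    (b : EuclideanSpace ℝ (Fin p)) (k : ℕ) :
    Integrable (fun q : ℝ × EuclideanSpace ℝ (Fin p) => looResidual S σ b q.2 q.1 ^ k)
      ((gaussianReal 0 (σ ^ 2).toNNReal).prod (stdGaussian (EuclideanSpace ℝ (Fin p)))) := by
  have h := integrable_pow_gaussianReal k
  rw [← map_looResidual S hσ b] at h
  exact h.comp_measurable (by unfold looResidual; fun_prop)

lemma integral_looResidual_pow (S : Matrix (Fin p) (Fin p) ℝ) {σ : ℝ} (hσ : 0 < σ)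
    (b : EuclideanSpace ℝ (Fin p)) (k : ℕ) :
    ∫ q : ℝ × EuclideanSpace ℝ (Fin p), looResidual S σ b q.2 q.1 ^ (2 * k)
      ∂((gaussianReal 0 (σ ^ 2).toNNReal).prod (stdGaussian (EuclideanSpace ℝ (Fin p))))
      = gaussianMoment k := by
  rw [gaussianMoment, ← map_looResidual S hσ b,
    integral_map (by unfold looResidual; fun_prop) (by fun_prop)]

lemma integrable_norm_pow_stdGaussian (k : ℕ) :
    Integrable (fun w : EuclideanSpace ℝ (Fin p) => ‖w‖ ^ k) (stdGaussian _) := by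
  have h := (IsGaussian.memLp_id (stdGaussian (EuclideanSpace ℝ (Fin p))) k
    (by simp)).integrable_norm_pow'
  simpa using h

/-- Convexity of t ↦ t^{k+1} over the p squared coordinates, each of which is the square of a
standard Gaussian. -/
lemma integral_norm_pow_stdGaussian_le (k : ℕ) :
    ∫ w : EuclideanSpace ℝ (Fin p), ‖w‖ ^ (2 * (k + 1)) ∂(stdGaussian _)
      ≤ (p : ℝ) ^ (k + 1) * gaussianMoment (k + 1) := by
  have hmap : ∀ i : Fin p, (stdGaussian (EuclideanSpace ℝ (Fin p))).map (fun w => w i)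
      = gaussianReal 0 1 := by
    intro i
    have h := map_inner_stdGaussian (EuclideanSpace.single i (1 : ℝ))
    simpa [EuclideanSpace.inner_single_left] using h
  have hint : ∀ i : Fin p, Integrable (fun w : EuclideanSpace ℝ (Fin p) => w i ^ (2 * (k + 1)))
      (stdGaussian _) := by
    intro i
    have h := integrable_pow_gaussianReal (2 * (k + 1))
    rw [← hmap i] at h
    exact h.comp_measurable (by fun_prop)
  have hval : ∀ i : Fin p, ∫ w : EuclideanSpace ℝ (Fin p), w i ^ (2 * (k + 1)) ∂(stdGaussian _)
      = gaussianMoment (k + 1) := by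
    intro i
    rw [gaussianMoment, ← hmap i, integral_map (by fun_prop) (by fun_prop)]
  have hpt : ∀ w : EuclideanSpace ℝ (Fin p),
      ‖w‖ ^ (2 * (k + 1)) ≤ (p : ℝ) ^ k * ∑ i, w i ^ (2 * (k + 1)) := by
    intro w
    have h := pow_sum_div_card_le_sum_pow (s := Finset.univ) (f := fun i => w i ^ 2)
      (fun i _ => sq_nonneg _) k
    rw [pow_mul, EuclideanSpace.real_norm_sq_eq]
    simp only [← pow_mul, Finset.card_univ, Fintype.card_fin] at h
    rcases Nat.eq_zero_or_pos p with hp | hp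
    · subst hp; simp
    · have : (0 : ℝ) < (p : ℝ) ^ k := by positivity
      rwa [div_le_iff₀ this, mul_comm] at h
  calc ∫ w : EuclideanSpace ℝ (Fin p), ‖w‖ ^ (2 * (k + 1)) ∂(stdGaussian _)
      ≤ ∫ w : EuclideanSpace ℝ (Fin p), (p : ℝ) ^ k * ∑ i, w i ^ (2 * (k + 1))
          ∂(stdGaussian _) :=
        integral_mono (integrable_norm_pow_stdGaussian _)
          ((integrable_finsetSum _ fun i _ => hint i).const_mul _) hpt
    _ = _ := by
        rw [integral_const_mul, integral_finsetSum _ fun i _ => hint i]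
        simp only [hval, Finset.sum_const, Finset.card_univ, Fintype.card_fin, nsmul_eq_mul]
        ring

end Moments

/-! ### The normalized residual is close in probability to its leave-one-out version -/

section Closeness

variable {n p : ℕ} {S : Matrix (Fin p) (Fin p) ℝ} {μ : ℝ} {g : EuclideanSpace ℝ (Fin p) → ℝ}
  {i₀ : Fin n} {βs : EuclideanSpace ℝ (Fin p)} {z₀ : Resp n × Design n p}

/-- The threshold in Markov's inequality that corresponds to a deviation `η`. -/
noncomputable def threshold (η : ℝ) : ℝ := min (1 / 4) (η ^ 2 / 9)

lemma threshold_pos {η : ℝ} (hη : 0 < η) : 0 < threshold η :=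
  lt_min (by norm_num) (by positivity)

/-- If |u|v > 1/2, then u²v² alone exceeds 1/4. Otherwise Cauchy-Schwarz with weights 2, 2, 1 gives
the constant 9 = 4 + 4 + 1. -/
lemma threshold_le {η d G u v : ℝ} (hη : 0 < η) (hd : η ≤ d)
    (h : |u| * v ≤ 1 / 2 → d ≤ 2 * |G| + 2 * (u ^ 2 * v) + v) :
    threshold η ≤ G ^ 2 + (u ^ 2 * v ^ 2 + u ^ 4 * v ^ 2 + v ^ 2) := by
  have h4 : 0 ≤ u ^ 4 * v ^ 2 := by positivity
  by_cases huv : |u| * v ≤ 1 / 2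
  · refine (min_le_right _ _).trans ?_
    have h1 := hd.trans (h huv)
    have h2 : η ^ 2 ≤ (2 * |G| + 2 * (u ^ 2 * v) + v) ^ 2 := by gcongr
    have h3 : (2 * |G| + 2 * (u ^ 2 * v) + v) ^ 2
        ≤ 9 * (|G| ^ 2 + (u ^ 2 * v) ^ 2 + v ^ 2) := by
      nlinarith [sq_nonneg (|G| - u ^ 2 * v), sq_nonneg (|G| - 2 * v),
        sq_nonneg (u ^ 2 * v - 2 * v)]
    rw [sq_abs] at h3
    have h5 : (u ^ 2 * v) ^ 2 = u ^ 4 * v ^ 2 := by ring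
    nlinarith [sq_nonneg (u * v)]
  · refine (min_le_left _ _).trans ?_
    push Not at huv
    have h1 : (1 / 2) ^ 2 ≤ (|u| * v) ^ 2 := by gcongr
    rw [mul_pow, sq_abs] at h1
    nlinarith [sq_nonneg G, sq_nonneg v]

/-- Markov's inequality for the sum of the squared normalized Gaussian divergence and the remainder
`H`, with the noise and the other rows frozen. Adding the Stein bound `B` to `H` turns 3 into 4 and
8 into 9. -/
lemma stdGaussian_deviation_le (hS : S.PosDef) (hμ : 0 < μ) (hg : StronglyConvexWrt S μ g)
    {σ : ℝ} (hσ : 0 < σ) (h1 : z₀.1 i₀ = 0) (h2 : z₀.2 i₀ = 0) {e : ℝ}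
    {z : EuclideanSpace ℝ (Fin p) → Resp n × Design n p}
    (hz : ∀ w, z w = z₀ + rowData i₀ βs (act (CFC.sqrt S) w) e)
    {A : EuclideanSpace ℝ (Fin p) → Matrix (Fin p) (Fin p) ℝ}
    (hA : ∀ᵐ w ∂(stdGaussian (EuclideanSpace ℝ (Fin p))),
      IsDerivMatrix squareLoss g S μ (z w).1 (z w).2 (A w))
    {u v : EuclideanSpace ℝ (Fin p) → ℝ}
    (hu : ∀ w, u w = looResidual S σ (estimator g z₀ - βs) w e)
    (hv : ∀ w, v w = ((n : ℝ) * μ)⁻¹ * ‖w‖) {η : ℝ} (hη : 0 < η) :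
    stdGaussian (EuclideanSpace ℝ (Fin p))
        {w | η ≤ |normalizedResidual squareLoss g S βs σ (A w) (z w).1 (z w).2 i₀ - u w|}
      ≤ ENNReal.ofReal (threshold η)⁻¹ * ∫⁻ w, ENNReal.ofReal
          (4 * (u w ^ 2 * v w ^ 2) + 4 * (p * (((n : ℝ) * μ)⁻¹) ^ 2 * u w ^ 2) + 9 * v w ^ 2
            + 8 * (u w ^ 2 * v w ^ 4) + u w ^ 4 * v w ^ 2) ∂(stdGaussian _) := by
  set τ := scale σ (act (CFC.sqrt S) (estimator g z₀ - βs))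
  have hτ : 0 < τ := scale_pos hσ _
  set f := rowField S g i₀ βs z₀ e
  have hmu : Measurable u := by
    have : u = fun w => looResidual S σ (estimator g z₀ - βs) w e := funext hu
    rw [this]; unfold looResidual; fun_prop
  have hmv : Measurable v := by
    have : v = fun w => ((n : ℝ) * μ)⁻¹ * ‖w‖ := funext hv
    rw [this]; fun_prop
  have hmG : Measurable (gaussianDiv f) := measurable_gaussianDiv fun i =>
    (locallyLipschitz_rowField hS hμ hg e i).continuous.measurable
  set H : EuclideanSpace ℝ (Fin p) → ℝ := fun w =>
    u w ^ 2 * v w ^ 2 + u w ^ 4 * v w ^ 2 + v w ^ 2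
  set B : EuclideanSpace ℝ (Fin p) → ℝ := fun w =>
    3 * (u w ^ 2 * v w ^ 2) + 4 * (p * (((n : ℝ) * μ)⁻¹) ^ 2 * u w ^ 2) + 8 * v w ^ 2
          + 8 * (u w ^ 2 * v w ^ 4)
  have hH : ∀ w, 0 ≤ H w := fun w => by positivity
  have hB : ∀ w, 0 ≤ B w := fun w => by positivity
  -- The leave-one-out scale τ does not depend on w, so it passes through the integral.
  have hG : ∫⁻ w, ENNReal.ofReal ((gaussianDiv f w / τ) ^ 2) ∂(stdGaussian _)
      ≤ ∫⁻ w, ENNReal.ofReal (B w) ∂(stdGaussian _) := by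
    have e1 : ∀ w, ENNReal.ofReal ((gaussianDiv f w / τ) ^ 2)
        = ENNReal.ofReal ((τ ^ 2)⁻¹) * ENNReal.ofReal (gaussianDiv f w ^ 2) := fun w => by
      rw [← ENNReal.ofReal_mul (by positivity), div_pow, div_eq_inv_mul]
    have e2 : ∀ w, ENNReal.ofReal (B w)
        = ENNReal.ofReal ((τ ^ 2)⁻¹) * ENNReal.ofReal (τ ^ 2 * B w) := fun w => by
      rw [← ENNReal.ofReal_mul (by positivity), inv_mul_cancel_left₀ (by positivity)]
    simp_rw [e1, e2]
    rw [lintegral_const_mul' _ _ ENNReal.ofReal_ne_top,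
      lintegral_const_mul' _ _ ENNReal.ofReal_ne_top]
    refine mul_le_mul' le_rfl ?_
    refine (lintegral_sq_gaussianDiv_le fun i => locallyLipschitz_rowField hS hμ hg e i).trans ?_
    refine lintegral_mono_ae ?_
    filter_upwards [hA] with w hw
    exact ENNReal.ofReal_le_ofReal (stein_integrand_le hS hμ hg hσ h1 h2 (hz w) hw (hu w) (hv w))
  have hsub : stdGaussian (EuclideanSpace ℝ (Fin p))
        {w | η ≤ |normalizedResidual squareLoss g S βs σ (A w) (z w).1 (z w).2 i₀ - u w|}
      ≤ stdGaussian (EuclideanSpace ℝ (Fin p)) {w | ENNReal.ofReal (threshold η)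
          ≤ ENNReal.ofReal ((gaussianDiv f w / τ) ^ 2) + ENNReal.ofReal (H w)} := by
    refine measure_mono_ae ?_
    filter_upwards [hA] with w hw hd
    replace hd : η ≤ |normalizedResidual squareLoss g S βs σ (A w) (z w).1 (z w).2 i₀ - u w| := hd
    change ENNReal.ofReal (threshold η)
      ≤ ENNReal.ofReal ((gaussianDiv f w / τ) ^ 2) + ENNReal.ofReal (H w)
    rw [← ENNReal.ofReal_add (sq_nonneg _) (hH w)]
    exact ENNReal.ofReal_le_ofReal (threshold_le hη hd fun huv =>
      abs_normalizedResidual_sub_le hS hμ hg hσ h1 h2 (hz w) hw (hu w) (hv w) huv)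
  have hmark := mul_meas_ge_le_lintegral₀ (μ := stdGaussian (EuclideanSpace ℝ (Fin p)))
    (f := fun w => ENNReal.ofReal ((gaussianDiv f w / τ) ^ 2) + ENNReal.ofReal (H w))
    (by fun_prop) (ENNReal.ofReal (threshold η))
  have ht := threshold_pos hη
  have hfin : ∫⁻ w, ENNReal.ofReal ((gaussianDiv f w / τ) ^ 2) + ENNReal.ofReal (H w)
      ∂(stdGaussian _) ≤ ∫⁻ w, ENNReal.ofReal
          (4 * (u w ^ 2 * v w ^ 2) + 4 * (p * (((n : ℝ) * μ)⁻¹) ^ 2 * u w ^ 2) + 9 * v w ^ 2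
            + 8 * (u w ^ 2 * v w ^ 4) + u w ^ 4 * v w ^ 2) ∂(stdGaussian _) := by
    rw [lintegral_add_left (by fun_prop)]
    refine (add_le_add_left hG _).trans ?_
    rw [← lintegral_add_left (by fun_prop)]
    refine lintegral_mono fun w => ?_
    simp only
    rw [← ENNReal.ofReal_add (hB w) (hH w)]
    refine ENNReal.ofReal_le_ofReal (le_of_eq ?_)
    simp only [B, H]
    ring
  refine hsub.trans ?_
  rw [ENNReal.ofReal_inv_of_pos ht, mul_comm, ← div_eq_mul_inv]
  rw [ENNReal.le_div_iff_mul_le (Or.inl (by simpa using ht)) (Or.inl ENNReal.ofReal_ne_top),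
    mul_comm]
  exact hmark.trans hfin

/-- The constant in the rate of convergence, with `c = γ / μ²`. -/
noncomputable def rateConst (c : ℝ) : ℝ :=
  6 * gaussianMoment 2 + gaussianMoment 4 / 2 + 13 * (c * gaussianMoment 1)
    + 5 / 2 * (c ^ 2 * gaussianMoment 2) + 4 * (c ^ 4 * gaussianMoment 4)

/-- The factors u and s = ‖w‖ are dependent, so products are separated by the arithmetic-geometric
inequality. The weights N⁻¹ and N make every resulting expectation O(1/n) when N = n. -/
lemma error_poly_le {N k P u s : ℝ} (hN : 0 < N) :
    4 * (u ^ 2 * (k * s) ^ 2) + 4 * (P * k ^ 2 * u ^ 2) + 9 * (k * s) ^ 2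
        + 8 * (u ^ 2 * (k * s) ^ 4) + u ^ 4 * (k * s) ^ 2
      ≤ 6 * N⁻¹ * u ^ (2 * 2) + N⁻¹ / 2 * u ^ (2 * 4) + 4 * (P * k ^ 2) * u ^ (2 * 1)
        + (9 * k ^ 2 * s ^ (2 * (0 + 1)) + 5 / 2 * N * k ^ 4 * s ^ (2 * (1 + 1))
          + 4 * N * k ^ 8 * s ^ (2 * (3 + 1))) := by
  have amgm : ∀ x y : ℝ, x * y ≤ N⁻¹ / 2 * x ^ 2 + N / 2 * y ^ 2 := by
    intro x y
    have h : 0 ≤ N⁻¹ / 2 * (x - N * y) ^ 2 := by positivity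
    have h2 : N⁻¹ / 2 * (x - N * y) ^ 2 = N⁻¹ / 2 * x ^ 2 + N / 2 * y ^ 2 - x * y := by
      field_simp
      ring
    linarith
  have h1 := amgm (u ^ 2) ((k * s) ^ 2)
  have h2 := amgm (u ^ 2) ((k * s) ^ 4)
  have h3 := amgm (u ^ 4) ((k * s) ^ 2)
  ring_nf at h1 h2 h3 ⊢
  linarith

lemma lintegral_error_le {γ : ℝ} (hμ : 0 < μ) (hn : 0 < n) (hp : (p : ℝ) / n ≤ γ)
    (S : Matrix (Fin p) (Fin p) ℝ) {σ : ℝ} (hσ : 0 < σ) (b : EuclideanSpace ℝ (Fin p))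
    {u v : ℝ × EuclideanSpace ℝ (Fin p) → ℝ} (hu : ∀ q, u q = looResidual S σ b q.2 q.1)
    (hv : ∀ q, v q = ((n : ℝ) * μ)⁻¹ * ‖q.2‖) :
    ∫⁻ q : ℝ × EuclideanSpace ℝ (Fin p), ENNReal.ofReal
        (4 * (u q ^ 2 * v q ^ 2) + 4 * (p * (((n : ℝ) * μ)⁻¹) ^ 2 * u q ^ 2) + 9 * v q ^ 2
          + 8 * (u q ^ 2 * v q ^ 4) + u q ^ 4 * v q ^ 2)
      ∂((gaussianReal 0 (σ ^ 2).toNNReal).prod (stdGaussian _))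
      ≤ ENNReal.ofReal (rateConst (γ / μ ^ 2) / n) := by
  set Q := (gaussianReal 0 (σ ^ 2).toNNReal).prod (stdGaussian (EuclideanSpace ℝ (Fin p)))
  set k := ((n : ℝ) * μ)⁻¹ with hk
  have hN : (1 : ℝ) ≤ n := by exact_mod_cast hn
  have hN0 : (0 : ℝ) < n := by linarith
  have hk0 : 0 < k := by positivity
  have hIu : ∀ j, Integrable (fun q => u q ^ j) Q := fun j => by
    simp_rw [hu]; exact integrable_looResidual_pow S hσ b j
  have hIw : ∀ j, Integrable (fun q : ℝ × EuclideanSpace ℝ (Fin p) => ‖q.2‖ ^ j) Q := fun j =>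
    (integrable_norm_pow_stdGaussian (p := p) j).comp_snd _
  have hEu : ∀ j, ∫ q, u q ^ (2 * j) ∂Q = gaussianMoment j := fun j => by
    simp_rw [hu]; exact integral_looResidual_pow S hσ b j
  have hEw : ∀ j, ∫ q : ℝ × EuclideanSpace ℝ (Fin p), ‖q.2‖ ^ (2 * (j + 1)) ∂Q
      ≤ (p : ℝ) ^ (j + 1) * gaussianMoment (j + 1) := fun j => by
    refine le_trans (le_of_eq ?_) (integral_norm_pow_stdGaussian_le (p := p) j)
    exact integral_fun_snd (fun w : EuclideanSpace ℝ (Fin p) => ‖w‖ ^ (2 * (j + 1)))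
      |>.trans (by simp)
  set R : ℝ × EuclideanSpace ℝ (Fin p) → ℝ := fun q =>
    6 * (n : ℝ)⁻¹ * u q ^ (2 * 2) + (n : ℝ)⁻¹ / 2 * u q ^ (2 * 4) + 4 * (p * k ^ 2) * u q ^ (2 * 1)
        + (9 * k ^ 2 * ‖q.2‖ ^ (2 * (0 + 1)) + 5 / 2 * n * k ^ 4 * ‖q.2‖ ^ (2 * (1 + 1))
          + 4 * n * k ^ 8 * ‖q.2‖ ^ (2 * (3 + 1))) with hR
  have i1 := (hIu (2 * 2)).const_mul (6 * (n : ℝ)⁻¹)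
  have i2 := (hIu (2 * 4)).const_mul ((n : ℝ)⁻¹ / 2)
  have i3 := (hIu (2 * 1)).const_mul (4 * (p * k ^ 2))
  have i4 := (hIw (2 * (0 + 1))).const_mul (9 * k ^ 2)
  have i5 := (hIw (2 * (1 + 1))).const_mul (5 / 2 * n * k ^ 4)
  have i6 := (hIw (2 * (3 + 1))).const_mul (4 * n * k ^ 8)
  have hRint : Integrable R Q := ((i1.add i2).add i3).add ((i4.add i5).add i6)
  have hle : ∀ q, 4 * (u q ^ 2 * v q ^ 2) + 4 * (p * k ^ 2 * u q ^ 2) + 9 * v q ^ 2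
          + 8 * (u q ^ 2 * v q ^ 4) + u q ^ 4 * v q ^ 2 ≤ R q := fun q => by
    rw [hv]; exact error_poly_le hN0
  refine (lintegral_mono fun q => ENNReal.ofReal_le_ofReal (hle q)).trans ?_
  rw [← ofReal_integral_eq_lintegral_ofReal hRint (Eventually.of_forall fun q => by
    have := hle q
    have h0 : 0 ≤ v q := by rw [hv]; positivity
    refine le_trans ?_ this
    positivity)]
  refine ENNReal.ofReal_le_ofReal ?_
  have hint : ∫ q, R q ∂Q = 6 * (n : ℝ)⁻¹ * gaussianMoment 2 + (n : ℝ)⁻¹ / 2 * gaussianMoment 4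
      + 4 * (p * k ^ 2) * gaussianMoment 1
      + (9 * k ^ 2 * ∫ q : ℝ × EuclideanSpace ℝ (Fin p), ‖q.2‖ ^ (2 * (0 + 1)) ∂Q
        + 5 / 2 * n * k ^ 4 * ∫ q : ℝ × EuclideanSpace ℝ (Fin p), ‖q.2‖ ^ (2 * (1 + 1)) ∂Q
        + 4 * n * k ^ 8 * ∫ q : ℝ × EuclideanSpace ℝ (Fin p), ‖q.2‖ ^ (2 * (3 + 1)) ∂Q) := by
    have e0 : ∫ q, R q ∂Q = _ := integral_add' ((i1.add i2).add i3) ((i4.add i5).add i6)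
    rw [e0, integral_add ?_ i3, integral_add i1 i2, integral_add ?_ i6, integral_add i4 i5]
    · simp only [integral_const_mul, hEu]
    · exact i4.add i5
    · exact i1.add i2
  rw [hint]
  set c := γ / μ ^ 2 with hc
  -- The only place where p/n ≤ γ acts: each power of ‖w‖² pairs with k², and E‖w‖^{2j} is at most a
  -- constant times p^j.
  have hpk : p * k ^ 2 ≤ c * (n : ℝ)⁻¹ := by
    have : p * k ^ 2 = (p / n) * (n : ℝ)⁻¹ / μ ^ 2 := by
      rw [hk]; field_simp
    rw [this, hc, div_mul_eq_mul_div γ]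
    gcongr
  have hpk0 : 0 ≤ p * k ^ 2 := by positivity
  have hc0 : 0 ≤ c * (n : ℝ)⁻¹ := hpk0.trans hpk
  have m1 := gaussianMoment_nonneg 1
  have m2 := gaussianMoment_nonneg 2
  have m4 := gaussianMoment_nonneg 4
  have b3 : 4 * (p * k ^ 2) * gaussianMoment 1 ≤ 4 * (c * (n : ℝ)⁻¹) * gaussianMoment 1 := by
    gcongr
  have b4 : 9 * k ^ 2 * ∫ q : ℝ × EuclideanSpace ℝ (Fin p), ‖q.2‖ ^ (2 * (0 + 1)) ∂Q
      ≤ 9 * (c * (n : ℝ)⁻¹) * gaussianMoment 1 := by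
    calc _ ≤ 9 * k ^ 2 * ((p : ℝ) ^ (0 + 1) * gaussianMoment (0 + 1)) := by
            gcongr; exact hEw 0
      _ = 9 * (p * k ^ 2) * gaussianMoment 1 := by ring
      _ ≤ _ := by gcongr
  have b5 : 5 / 2 * n * k ^ 4 * ∫ q : ℝ × EuclideanSpace ℝ (Fin p), ‖q.2‖ ^ (2 * (1 + 1)) ∂Q
      ≤ 5 / 2 * c ^ 2 * (n : ℝ)⁻¹ * gaussianMoment 2 := by
    calc _ ≤ 5 / 2 * n * k ^ 4 * ((p : ℝ) ^ (1 + 1) * gaussianMoment (1 + 1)) := by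
            gcongr; exact hEw 1
      _ = 5 / 2 * n * (p * k ^ 2) ^ 2 * gaussianMoment 2 := by ring
      _ ≤ 5 / 2 * n * (c * (n : ℝ)⁻¹) ^ 2 * gaussianMoment 2 := by gcongr
      _ = _ := by field_simp
  have b6 : 4 * n * k ^ 8 * ∫ q : ℝ × EuclideanSpace ℝ (Fin p), ‖q.2‖ ^ (2 * (3 + 1)) ∂Q
      ≤ 4 * c ^ 4 * (n : ℝ)⁻¹ * gaussianMoment 4 := by
    calc _ ≤ 4 * n * k ^ 8 * ((p : ℝ) ^ (3 + 1) * gaussianMoment (3 + 1)) := by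
            gcongr; exact hEw 3
      _ = 4 * n * (p * k ^ 2) ^ 4 * gaussianMoment 4 := by ring
      _ ≤ 4 * n * (c * (n : ℝ)⁻¹) ^ 4 * gaussianMoment 4 := by gcongr
      _ = 4 * c ^ 4 * (n : ℝ)⁻¹ ^ 3 * gaussianMoment 4 := by field_simp
      _ ≤ _ := by
          have h3 : (n : ℝ)⁻¹ ^ 3 ≤ (n : ℝ)⁻¹ := by
            have h0 : (n : ℝ)⁻¹ ≤ 1 := inv_le_one_of_one_le₀ hN
            exact pow_le_of_le_one (by positivity) h0 (by norm_num)
          have : 0 ≤ c ^ 4 := by positivity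
          gcongr
  have e : rateConst c / n = 6 * (n : ℝ)⁻¹ * gaussianMoment 2 + (n : ℝ)⁻¹ / 2 * gaussianMoment 4
      + 4 * (c * (n : ℝ)⁻¹) * gaussianMoment 1 + (9 * (c * (n : ℝ)⁻¹) * gaussianMoment 1
      + 5 / 2 * c ^ 2 * (n : ℝ)⁻¹ * gaussianMoment 2
      + 4 * c ^ 4 * (n : ℝ)⁻¹ * gaussianMoment 4) := by
    rw [rateConst, div_eq_mul_inv]; ring
  rw [e]
  linarith

end Closeness

/-! ### The two statistics under the law of the data -/

section Statistics

variable {n p : ℕ} {S : Matrix (Fin p) (Fin p) ℝ} {μ σ : ℝ} {g : EuclideanSpace ℝ (Fin p) → ℝ}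
  {βs : EuclideanSpace ℝ (Fin p)} {i₀ : Fin n}

/-- The normalized residual as a function of the design and of the noise. -/
noncomputable def fullStatistic (S : Matrix (Fin p) (Fin p) ℝ) (g : EuclideanSpace ℝ (Fin p) → ℝ)
    (βs : EuclideanSpace ℝ (Fin p)) (σ : ℝ) (i₀ : Fin n) (D : Design n p × Resp n) : ℝ :=
  normalizedResidual squareLoss g S βs σ (derivMatrix g (modelData βs D))
    (modelData βs D).1 (modelData βs D).2 i₀

/-- The leave-one-out residual as a function of the design and of the noise. -/
noncomputable def looStatistic (S : Matrix (Fin p) (Fin p) ℝ) (g : EuclideanSpace ℝ (Fin p) → ℝ)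
    (βs : EuclideanSpace ℝ (Fin p)) (σ : ℝ) (i₀ : Fin n) (D : Design n p × Resp n) : ℝ :=
  looResidual S σ (estimator g (modelData βs (replaceRow i₀ D 0 0)) - βs)
    (act (CFC.sqrt S)⁻¹ (D.1 i₀)) (D.2 i₀)

lemma measurable_fullStatistic (hσ : 0 < σ)
    (hg : Measurable (estimator g : Resp n × Design n p → _)) :
    Measurable (fullStatistic S g βs σ i₀) := by
  have hz : Measurable fun z : Resp n × Design n p => normalizedResidual squareLoss g S βs σ
      (derivMatrix g z) z.1 z.2 i₀ := by
    simp_rw [normalizedResidual_eq hσ]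
    refine ((measurable_const.add ?_).mul (measurable_residual hg i₀)).div ?_
    · simp only [Matrix.trace, Matrix.diag, Matrix.mul_apply]
      exact Finset.measurable_sum _ fun i _ => Finset.measurable_sum _ fun j _ =>
        (measurable_derivMatrix hg j i).const_mul _
    · unfold scale
      fun_prop
  exact hz.comp (measurable_modelData βs)

lemma measurable_looStatistic (hg : Measurable (estimator g : Resp n × Design n p → _)) :
    Measurable (looStatistic S g βs σ i₀) := by
  have h0 : Measurable fun D : Design n p × Resp n => replaceRow i₀ D 0 0 :=
    (measurable_replaceRow i₀).comp
      (measurable_id.prodMk (measurable_const (a := ((0 : EuclideanSpace ℝ (Fin p)), (0 : ℝ)))))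
  have h1 : Measurable fun D : Design n p × Resp n =>
      estimator g (modelData βs (replaceRow i₀ D 0 0)) - βs :=
    (hg.comp ((measurable_modelData βs).comp h0)).sub_const _
  have h2 : Measurable fun D : Design n p × Resp n => D.1 i₀ := by fun_prop
  have h3 : Measurable fun D : Design n p × Resp n => D.2 i₀ := measurable_coord measurable_snd i₀
  have h4 : Measurable fun q : EuclideanSpace ℝ (Fin p) × EuclideanSpace ℝ (Fin p) × ℝ =>
      looResidual S σ q.1 q.2.1 q.2.2 := by
    unfold looResidual scale
    fun_prop
  exact h4.comp (h1.prodMk (((act (CFC.sqrt S)⁻¹).measurable.comp h2).prodMk h3))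

lemma looStatistic_replaceRow (hS : S.PosDef) (D : Design n p × Resp n)
    (w : EuclideanSpace ℝ (Fin p)) (e : ℝ) :
    looStatistic S g βs σ i₀ (replaceRow i₀ D (act (CFC.sqrt S) w) e)
      = looResidual S σ (estimator g (modelData βs (replaceRow i₀ D 0 0)) - βs) w e := by
  rw [looStatistic, replaceRow_replaceRow]
  have h1 : (replaceRow i₀ D (act (CFC.sqrt S) w) e).1 i₀ = act (CFC.sqrt S) w := by
    simp [replaceRow]
  have h2 : (replaceRow i₀ D (act (CFC.sqrt S) w) e).2 i₀ = e := by simp [replaceRow]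
  rw [h1, h2, act_inv_sqrt_act hS]

/-- After resampling the row, the conditional law given the other rows is N(0,1) whatever they are,
so the mixture is N(0,1) exactly, for every n. -/
lemma map_looStatistic (hS : S.PosDef) (hσ : 0 < σ)
    (hg : Measurable (estimator g : Resp n × Design n p → _)) :
    (dataLaw n S σ).map (looStatistic S g βs σ i₀) = gaussianReal 0 1 := by
  have hρ := measurePreserving_replaceRow_std (n := n) S hσ i₀
  have hU := measurable_looStatistic (S := S) (βs := βs) (σ := σ) (i₀ := i₀) hg
  rw [← hρ.map_eq, Measure.map_map hU hρ.measurable]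
  ext s hs
  rw [Measure.map_apply (hU.comp hρ.measurable) hs,
    Measure.prod_apply (hU.comp hρ.measurable hs)]
  have : ∀ D : Design n p × Resp n, ((gaussianReal 0 (σ ^ 2).toNNReal).prod
      (stdGaussian (EuclideanSpace ℝ (Fin p)))) (Prod.mk D ⁻¹' ((looStatistic S g βs σ i₀ ∘
        fun q : (Design n p × Resp n) × (ℝ × EuclideanSpace ℝ (Fin p)) =>
          replaceRow i₀ q.1 (act (CFC.sqrt S) q.2.2) q.2.1) ⁻¹' s)) = gaussianReal 0 1 s := by
    intro D
    rw [← map_looResidual S hσ (estimator g (modelData βs (replaceRow i₀ D 0 0)) - βs),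
      Measure.map_apply (by unfold looResidual; fun_prop) hs]
    congr 1
    ext q
    simp only [Set.mem_preimage, Function.comp_apply, looStatistic_replaceRow hS]
  simp only [this, lintegral_const, measure_univ, mul_one]

/-- Resample the row and apply Fubini: Stein's inequality in w, then the moment bound in (e, w). The
result is uniform in the remaining rows. -/
lemma dataLaw_deviation_le {γ : ℝ} (hS : S.PosDef) (hμ : 0 < μ) (hg : StronglyConvexWrt S μ g)
    (hσ : 0 < σ) (hp : (p : ℝ) / n ≤ γ) {η : ℝ} (hη : 0 < η) :
    dataLaw n S σ {D | η ≤ |fullStatistic S g βs σ i₀ D - looStatistic S g βs σ i₀ D|}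
      ≤ ENNReal.ofReal (threshold η)⁻¹ * ENNReal.ofReal (rateConst (γ / μ ^ 2) / n) := by
  have hn : 0 < n := i₀.pos
  have hgm : Measurable (estimator g : Resp n × Design n p → _) :=
    (continuous_estimator hn hS hμ hg).measurable
  have hρ := measurePreserving_replaceRow_std (n := n) S hσ i₀
  have hE : MeasurableSet {D | η ≤ |fullStatistic S g βs σ i₀ D - looStatistic S g βs σ i₀ D|} :=
    measurableSet_le measurable_const
      ((measurable_fullStatistic hσ hgm).sub (measurable_looStatistic hgm)).abs
  set ρ := fun q : (Design n p × Resp n) × (ℝ × EuclideanSpace ℝ (Fin p)) =>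
    replaceRow i₀ q.1 (act (CFC.sqrt S) q.2.2) q.2.1
  set E := {D | η ≤ |fullStatistic S g βs σ i₀ D - looStatistic S g βs σ i₀ D|}
  have hA : ∀ᵐ D ∂(dataLaw n S σ), IsDerivMatrix squareLoss g S μ (modelData βs D).1
      (modelData βs D).2 (derivMatrix g (modelData βs D)) :=
    ae_of_ae_map (measurable_modelData βs).aemeasurable
      ((map_modelData_absolutelyContinuous hS hσ βs).ae_le
        (ae_isDerivMatrix_derivMatrix hn hS hμ hg))
  have hA2 := Measure.ae_ae_of_ae_prod (hρ.quasiMeasurePreserving.ae hA)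
  rw [← hρ.measure_preimage hE.nullMeasurableSet, Measure.prod_apply (hρ.measurable hE)]
  refine (lintegral_mono_ae (g := fun _ => ENNReal.ofReal (threshold η)⁻¹
    * ENNReal.ofReal (rateConst (γ / μ ^ 2) / n)) ?_).trans (by simp)
  filter_upwards [hA2] with D hD
  have hD2 := Measure.ae_ae_of_ae_prod hD
  have hED : MeasurableSet (Prod.mk D ⁻¹' (ρ ⁻¹' E)) := measurable_prodMk_left (hρ.measurable hE)
  set z₀ := modelData βs (replaceRow i₀ D 0 0)
  set u : ℝ × EuclideanSpace ℝ (Fin p) → ℝ := fun q =>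
    looResidual S σ (estimator g z₀ - βs) q.2 q.1
  set v : ℝ × EuclideanSpace ℝ (Fin p) → ℝ := fun q => ((n : ℝ) * μ)⁻¹ * ‖q.2‖
  rw [Measure.prod_apply hED]
  set F : ℝ × EuclideanSpace ℝ (Fin p) → ENNReal := fun q => ENNReal.ofReal
    (4 * (u q ^ 2 * v q ^ 2) + 4 * (p * (((n : ℝ) * μ)⁻¹) ^ 2 * u q ^ 2) + 9 * v q ^ 2
      + 8 * (u q ^ 2 * v q ^ 4) + u q ^ 4 * v q ^ 2)
  have hF : Measurable F := by
    simp only [F, u, v, looResidual]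
    fun_prop
  calc ∫⁻ e, stdGaussian (EuclideanSpace ℝ (Fin p)) (Prod.mk e ⁻¹' (Prod.mk D ⁻¹' (ρ ⁻¹' E)))
        ∂(gaussianReal 0 (σ ^ 2).toNNReal)
      ≤ ∫⁻ e, ENNReal.ofReal (threshold η)⁻¹ * ∫⁻ w, F (e, w) ∂(stdGaussian _)
        ∂(gaussianReal 0 (σ ^ 2).toNNReal) := by
        refine lintegral_mono_ae ?_
        filter_upwards [hD2] with e he
        refine le_trans (le_of_eq ?_) (stdGaussian_deviation_le hS hμ hg hσ
          (modelData_replaceRow_zero_fst βs i₀ D) (modelData_replaceRow_zero_snd βs i₀ D)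
          (z := fun w => modelData βs (replaceRow i₀ D (act (CFC.sqrt S) w) e))
          (fun w => modelData_replaceRow βs i₀ D _ e) he (u := fun w => u (e, w))
          (v := fun w => v (e, w)) (fun w => rfl) (fun w => rfl) hη)
        congr 1
        ext w
        change η ≤ |fullStatistic S g βs σ i₀ (replaceRow i₀ D (act (CFC.sqrt S) w) e)
          - looStatistic S g βs σ i₀ (replaceRow i₀ D (act (CFC.sqrt S) w) e)| ↔ _
        rw [looStatistic_replaceRow hS]
        rfl
    _ = ENNReal.ofReal (threshold η)⁻¹ * ∫⁻ q, F q
        ∂((gaussianReal 0 (σ ^ 2).toNNReal).prod (stdGaussian _)) := by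
        rw [lintegral_const_mul' _ _ ENNReal.ofReal_ne_top, lintegral_prod _ hF.aemeasurable]
    _ ≤ _ := by
        gcongr
        exact lintegral_error_le hμ hn hp S hσ _ (fun q => rfl) (fun q => rfl)

end Statistics

/-! ### Convergence in distribution -/

section Convergence

/-- Slutsky's theorem on a common space: the problems are placed on the infinite product of the Ω n.
Only the law of each pair (T n, U n) matters, so this coupling is harmless. -/
lemma tendstoInDistribution_of_deviation {Ω : ℕ → Type*} [∀ n, MeasurableSpace (Ω n)]
    (P : ∀ n, Measure (Ω n)) [∀ n, IsProbabilityMeasure (P n)] {T U : ∀ n, Ω n → ℝ}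
    (hT : ∀ n, Measurable (T n)) (hU : ∀ n, Measurable (U n)) {ν : Measure ℝ}
    [IsProbabilityMeasure ν] (hlaw : ∀ n, (P n).map (U n) = ν)
    (hdev : ∀ η : ℝ, 0 < η →
      Tendsto (fun n => P n {ω | η ≤ |T n ω - U n ω|}) atTop (𝓝 0)) :
    TendstoInDistribution T atTop (id : ℝ → ℝ) P ν := by
  have heval := fun n => measurePreserving_eval_infinitePi P n
  have hmap : ∀ (V : ∀ n, Ω n → ℝ), (∀ n, Measurable (V n)) → ∀ n,
      (Measure.infinitePi P).map (fun ω => V n (ω n)) = (P n).map (V n) := by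
    intro V hV n
    rw [← (heval n).map_eq, Measure.map_map (hV n) (heval n).measurable]
    rfl
  have hmT : ∀ n, Measurable fun ω : ∀ n, Ω n => T n (ω n) := fun n =>
    (hT n).comp (heval n).measurable
  have hmU : ∀ n, Measurable fun ω : ∀ n, Ω n => U n (ω n) := fun n =>
    (hU n).comp (heval n).measurable
  have key : TendstoInDistribution (fun n (ω : ∀ n, Ω n) => T n (ω n)) atTop (id : ℝ → ℝ)
      (fun _ => Measure.infinitePi P) ν := by
    refine tendstoInDistribution_of_tendstoInMeasure_sub (X := fun n ω => U n (ω n)) _ _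
      ⟨fun n => (hmU n).aemeasurable, aemeasurable_id, ?_⟩ ?_ fun n => (hmT n).aemeasurable
    · refine tendsto_const_nhds.congr fun n => Subtype.ext ?_
      change ν.map id = (Measure.infinitePi P).map fun ω => U n (ω n)
      rw [hmap U hU, hlaw, Measure.map_id]
    · rw [tendstoInMeasure_iff_norm]
      intro η hη
      refine (hdev η hη).congr fun n => ?_
      have hs : MeasurableSet {ω | η ≤ |T n ω - U n ω|} :=
        measurableSet_le measurable_const ((hT n).sub (hU n)).abs
      rw [← (heval n).measure_preimage hs.nullMeasurableSet]
      simp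
  refine ⟨fun n => (hT n).aemeasurable, aemeasurable_id, key.tendsto.congr fun n => Subtype.ext ?_⟩
  exact hmap T hT n

lemma TendstoInDistribution.comp_hasLaw {Ω Ω' : ℕ → Type*} [∀ n, MeasurableSpace (Ω n)]
    [∀ n, MeasurableSpace (Ω' n)] {P : ∀ n, Measure (Ω n)} [∀ n, IsProbabilityMeasure (P n)]
    {Q : ∀ n, Measure (Ω' n)} [∀ n, IsProbabilityMeasure (Q n)] {T : ∀ n, Ω' n → ℝ}
    {R : ∀ n, Ω n → ℝ} {W : ∀ n, Ω n → Ω' n} {ν : Measure ℝ} [IsProbabilityMeasure ν]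
    (h : TendstoInDistribution T atTop (id : ℝ → ℝ) Q ν) (hT : ∀ n, Measurable (T n))
    (hW : ∀ n, HasLaw (W n) (Q n) (P n)) (hR : ∀ n, R n =ᵐ[P n] T n ∘ W n) :
    TendstoInDistribution R atTop (id : ℝ → ℝ) P ν := by
  have hTW : ∀ n, AEMeasurable (T n ∘ W n) (P n) := fun n =>
    (hT n).comp_aemeasurable (hW n).aemeasurable
  refine ⟨fun n => (hTW n).congr (hR n).symm, aemeasurable_id,
    h.tendsto.congr fun n => Subtype.ext ?_⟩
  change (Q n).map (T n) = (P n).map (R n)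
  rw [Measure.map_congr (hR n), ← (hW n).map_eq,
    AEMeasurable.map_map_of_aemeasurable (hT n).aemeasurable (hW n).aemeasurable]

variable {n p : ℕ} {S : Matrix (Fin p) (Fin p) ℝ} {μ σ : ℝ} {g : EuclideanSpace ℝ (Fin p) → ℝ}

lemma hasLaw_data {Ω : Type*} [MeasurableSpace Ω] {P : Measure Ω} [IsProbabilityMeasure P]
    {X : Ω → Design n p} {ε : Ω → Resp n}
    (hX : ∀ i, HasLaw (fun ω => X ω i) (multivariateGaussian 0 S) P)
    (hXi : iIndepFun (fun i ω => X ω i) P)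
    (hε : HasLaw ε (multivariateGaussian 0 (σ ^ 2 • 1)) P) (hXε : IndepFun X ε P) :
    HasLaw (fun ω => (X ω, ε ω)) (dataLaw n S σ) P := by
  have h1 : HasLaw X (Measure.pi fun _ => multivariateGaussian 0 S) P := hXi.hasLaw_pi hX
  exact (indepFun_iff_hasLaw_prodMk_prod h1 hε).1 hXε

/-- Uniqueness of the derivative matrix outside a null set, which the absolutely continuous law of
the data does not charge. -/
lemma normalizedResidual_ae_eq_fullStatistic (hn : 0 < n) (hS : S.PosDef) (hμ : 0 < μ)
    (hg : StronglyConvexWrt S μ g) (hσ : 0 < σ) (βs : EuclideanSpace ℝ (Fin p)) (i₀ : Fin n)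
    {A : Resp n → Design n p → Matrix (Fin p) (Fin p) ℝ}
    (hA : ∀ᵐ z : Resp n × Design n p, IsDerivMatrix squareLoss g S μ z.1 z.2 (A z.1 z.2)) :
    ∀ᵐ D ∂(dataLaw n S σ), normalizedResidual squareLoss g S βs σ
      (A (response D.1 βs D.2) D.1) (response D.1 βs D.2) D.1 i₀
      = fullStatistic S g βs σ i₀ D := by
  have h : ∀ᵐ z : Resp n × Design n p, A z.1 z.2 = derivMatrix g z := by
    filter_upwards [hA, ae_exists_residual_ne_zero (n := n) hn hS hμ hg] with z hz hr
    exact hz.eq_derivMatrix hr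
  filter_upwards [ae_of_ae_map (measurable_modelData βs).aemeasurable
    ((map_modelData_absolutelyContinuous hS hσ βs).ae_le h)] with D hD
  rw [fullStatistic, ← hD]
  rfl

lemma tendstoInDistribution_fullStatistic (γ : ℝ) (hμ : 0 < μ) {p : ℕ → ℕ}
    (hp : ∀ n, (p n : ℝ) / ((n + 1 : ℕ) : ℝ) ≤ γ) {S : ∀ n, Matrix (Fin (p n)) (Fin (p n)) ℝ}
    (hS : ∀ n, (S n).PosDef) {g : ∀ n, EuclideanSpace ℝ (Fin (p n)) → ℝ}
    (hg : ∀ n, StronglyConvexWrt (S n) μ (g n)) (βs : ∀ n, EuclideanSpace ℝ (Fin (p n)))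
    {σ : ℕ → ℝ} (hσ : ∀ n, 0 < σ n) (i₀ : ∀ n, Fin (n + 1)) :
    TendstoInDistribution (fun n => fullStatistic (S n) (g n) (βs n) (σ n) (i₀ n)) atTop
      (id : ℝ → ℝ) (fun n => dataLaw (n + 1) (S n) (σ n)) (gaussianReal 0 1) := by
  have hgm : ∀ n, Measurable (estimator (g n) : Resp (n + 1) × Design (n + 1) (p n) → _) :=
    fun n => (continuous_estimator n.succ_pos (hS n) hμ (hg n)).measurable
  refine tendstoInDistribution_of_deviation _ (fun n => measurable_fullStatistic (hσ n) (hgm n))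
    (U := fun n => looStatistic (S n) (g n) (βs n) (σ n) (i₀ n))
    (fun n => measurable_looStatistic (hgm n))
    (fun n => map_looStatistic (hS n) (hσ n) (hgm n)) fun η hη => ?_
  have hlim : Tendsto (fun n : ℕ => ENNReal.ofReal (threshold η)⁻¹
      * ENNReal.ofReal (rateConst (γ / μ ^ 2) / ((n + 1 : ℕ) : ℝ))) atTop (𝓝 0) := by
    have h1 : Tendsto (fun n : ℕ => rateConst (γ / μ ^ 2) / ((n + 1 : ℕ) : ℝ)) atTop (𝓝 0) :=
      (tendsto_const_div_atTop_nhds_zero_nat _).comp (tendsto_add_atTop_nat 1)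
    have h2 := ENNReal.Tendsto.const_mul (a := ENNReal.ofReal (threshold η)⁻¹)
      (ENNReal.tendsto_ofReal h1) (Or.inr ENNReal.ofReal_ne_top)
    simpa using h2
  exact tendsto_of_tendsto_of_tendsto_of_le_of_le tendsto_const_nhds hlim (fun n => zero_le)
    fun n => dataLaw_deviation_le (hS n) hμ (hg n) (hσ n) (hp n) hη

end Convergence

end RegMEst

/-- The `n`-th regression problem of the sequence (`n = 0, 1, 2, …`) has `n + 1` observations,
so that the first observation is the one of index `0 : Fin (n + 1)`. -/
theorem mainTheorem8
    (γ μ : ℝ) (hγ : 0 < γ) (hμ : 0 < μ)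
    (p : ℕ → ℕ) (hp : ∀ n, (p n : ℝ) / ((n + 1 : ℕ) : ℝ) ≤ γ)
    (S : ∀ n, Matrix (Fin (p n)) (Fin (p n)) ℝ) (hS : ∀ n, (S n).PosDef)
    (g : ∀ n, EuclideanSpace ℝ (Fin (p n)) → ℝ)
    (hg : ∀ n, RegMEst.StronglyConvexWrt (S n) μ (g n))
    (βs : ∀ n, EuclideanSpace ℝ (Fin (p n)))
    (σ : ℕ → ℝ) (hσ : ∀ n, 0 < σ n)
    {Ω : ℕ → Type*} [∀ n, MeasurableSpace (Ω n)]
    (P : ∀ n, Measure (Ω n)) [∀ n, IsProbabilityMeasure (P n)]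
    (X : ∀ n, Ω n → RegMEst.Design (n + 1) (p n))
    (ε : ∀ n, Ω n → RegMEst.Resp (n + 1))
    (hXlaw : ∀ n i, HasLaw (fun ω => X n ω i) (multivariateGaussian 0 (S n)) (P n))
    (hXindep : ∀ n, iIndepFun (fun i ω => X n ω i) (P n))
    (hεlaw : ∀ n, HasLaw (ε n) (multivariateGaussian 0 (σ n ^ 2 • 1)) (P n))
    (hXε : ∀ n, IndepFun (X n) (ε n) (P n)) :
    (∀ n, ∀ᵐ z : RegMEst.Resp (n + 1) × RegMEst.Design (n + 1) (p n),
      ∃ A, RegMEst.IsDerivMatrix RegMEst.squareLoss (g n) (S n) μ z.1 z.2 A) ∧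
    ∀ A : ∀ n, RegMEst.Resp (n + 1) → RegMEst.Design (n + 1) (p n) →
        Matrix (Fin (p n)) (Fin (p n)) ℝ,
      (∀ n, ∀ᵐ z : RegMEst.Resp (n + 1) × RegMEst.Design (n + 1) (p n),
        RegMEst.IsDerivMatrix RegMEst.squareLoss (g n) (S n) μ z.1 z.2 (A n z.1 z.2)) →
      TendstoInDistribution
        (fun n ω => RegMEst.normalizedResidual RegMEst.squareLoss (g n) (S n) (βs n) (σ n)
          (A n (RegMEst.response (X n ω) (βs n) (ε n ω)) (X n ω))
          (RegMEst.response (X n ω) (βs n) (ε n ω)) (X n ω) 0)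
        atTop (id : ℝ → ℝ) P (gaussianReal 0 1) := by
  refine ⟨fun n => RegMEst.ae_exists_isDerivMatrix n.succ_pos (hS n) hμ (hg n), fun A hA => ?_⟩
  -- Convergence in distribution depends only on laws, so the given sample spaces can be exchanged
  -- for the canonical space of (X, ε).
  refine RegMEst.TendstoInDistribution.comp_hasLaw
    (RegMEst.tendstoInDistribution_fullStatistic γ hμ hp hS hg βs hσ fun _ => 0)
    (fun n => RegMEst.measurable_fullStatistic (hσ n)
      (RegMEst.continuous_estimator n.succ_pos (hS n) hμ (hg n)).measurable)
    (fun n => RegMEst.hasLaw_data (hXlaw n) (hXindep n) (hεlaw n) (hXε n)) fun n => ?_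
  have hW := RegMEst.hasLaw_data (hXlaw n) (hXindep n) (hεlaw n) (hXε n)
  have h := RegMEst.normalizedResidual_ae_eq_fullStatistic n.succ_pos (hS n) hμ (hg n) (hσ n)
    (βs n) 0 (hA n)
  rw [← hW.map_eq] at h
  exact ae_of_ae_map hW.aemeasurable h
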